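/- Let $F=\mathbb F_q$ be a finite field, $\bar F$ an algebraic closure, $\varphi\colon x\mapsto x^q$ the arithmetic Frobenius, $\hat G=\mathrm{Gal}(\bar F/F)$ and $G=\langle\varphi\rangle\subset\hat G$. Let $X$ be an $F$-scheme (for instance $X=\operatorname{Spec}F$), and let $\mathcal E$ be a full subcategory of the category of $X$-schemes that are separated and of finite type over $F$, containing with every $Y$ also every $X$-scheme $U$ that is étale and of finite type over $Y$ and separated over $F$. Let $\bar{\mathcal E}$ be the full subcategory of schemes over $X\times_F\bar F$ that are connected components of base changes $Y\times_F\bar F$, $Y\in\mathcal E$, with the étale topology. For $g\in\hat G$ and $U\in\bar{\mathcal E}$ put $gU=U\times_{\bar F,g^{-1}}\bar F$. An action of $G$ (or $\hat G$) on a sheaf $\mathcal F$ on $\bar{\mathcal E}$ is a family of isomorphisms $\sigma_g\colon\mathcal F\to g^*\mathcal F$, where $(g^*\mathcal F)(U)=\mathcal F(gU)$, with $\sigma_{gh}=h^*\sigma_g\circ\sigma_h$; we write $gf$ for $\sigma_g(f)$. A model $U=U'\times_{K}\bar F$ of $U$ over a finite extension $K\subset\bar F$ of $F$, with $U'$ separated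 and of finite type over $K$ (and over $X$), identifies $gU=U$ for $g\in\mathrm{Gal}(\bar F/K)$, so that this group acts on $\mathcal F(U)$ if $\hat G$ acts on $\mathcal F$. The action of $\hat G$ is continuous if all these actions on the discrete groups $\mathcal F(U)$ are continuous. Let $\mathcal T_G$ be the category of sheaves of abelian groups on $\bar{\mathcal E}$ with an action of $G$ (Weil-étale sheaves), and $\mathcal T_{\hat G}$ the category of sheaves of abelian groups on $\bar{\mathcal E}$ with a continuous action of $\hat G$. Let $\gamma^*\colon\mathcal T_{\hat G}\to\mathcal T_G$ be the functor restricting the action to $G$. Theorem. The functor $\gamma^*$ has a right adjoint $\gamma_*$, and every object of $\mathcal T_G$ has an injective resolution. For every $\mathcal F\in\mathcal T_G$ there are an object $\Xi(\mathcal F)$ of $\mathcal T_{\hat G}$ and an endomorphism $t$ of it such that: 1. for every $U\in\bar{\mathcal E}$, $$\Xi(\mathcal F)(U)=\operatorname{colim}_{m}\ \bigoplus_{i\in\mathbb Z/m}\mathcal F(\varphi^iU),$$ where $m\ge1$ runs, ordered by divisibility, through the integers such that $U$ has a model over a subfield of $\mathbb F_{q^m}$ (which identifies $\varphi^{i+m}U=\varphi^iU$;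 two models of $U$ give the same identification for all sufficiently divisible $m$), the transition maps are $\delta_m^n(f)^{(j)}=f^{(j\bmod m)}$ for $j\in\mathbb Z/mn$, and the restriction maps are componentwise; moreover $(tf)^{(i)}=\varphi f^{(i-1)}$, and $g\in\hat G$ with $g\equiv\varphi^a \bmod m\hat G$ acts as $(gf)^{(i)}=f^{(i+a)}$, from $\bigoplus_{i\in\mathbb Z/m}\mathcal F(\varphi^iU)$ to $\bigoplus_{i\in\mathbb Z/m}\mathcal F(\varphi^igU)$; 2. $R\gamma_*\mathcal F$, that is, $\gamma_*I^\bullet$ for any injective resolution $\mathcal F\to I^\bullet$ in $\mathcal T_G$, is quasi-isomorphic, as a complex in $\mathcal T_{\hat G}$, to the complex $$\Xi(\mathcal F)\xrightarrow{\ t-1\ }\Xi(\mathcal F)$$ concentrated in degrees $0$ and $1$. Consequently $R^i\gamma_*\mathcal F=0$ for all $i>1$. -/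

import Mathlib

set_option linter.unusedSectionVars false

open CategoryTheory CategoryTheory.Limits AlgebraicGeometry Opposite

universe u

namespace WeilEtale

noncomputable section

/-! ## The Galois group and the Weil group of a finite field -/

section Galois

variable (F k : Type u) [Field F] [Fintype F] [Field k] [Algebra F k] [IsAlgClosure F k]

/-- The arithmetic Frobenius `x ↦ x ^ q` of `k = \bar F` over `F = 𝔽_q`. -/
def frob : Gal(k/F) := FiniteField.frobeniusAlgEquivOfAlgebraic F k

/-- The subgroup `G` of `Ĝ = Gal(k/F)` generated by the arithmetic Frobenius. -/
abbrev weilGroup : Subgroup Gal(k/F) := Subgroup.zpowers (frob F k)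

/-- `φ ^ n` as an element of `G`. -/
def frobPow (n : ℤ) : weilGroup F k := ⟨frob F k ^ n, Subgroup.zpow_mem_zpowers _ _⟩

/-- The field `𝔽_{q^m}`, as the fixed field of `φ ^ m` in `k`. Its fixing subgroup is `mĜ`. -/
def levelField (m : ℕ) : IntermediateField F k :=
  IntermediateField.fixedField (Subgroup.zpowers (frob F k ^ m))

variable {F k}

lemma le_levelField {K : IntermediateField F k} {m : ℕ}
    (hm : frob F k ^ m ∈ K.fixingSubgroup) : K ≤ levelField F k m := by
  rw [levelField, IntermediateField.le_iff_le]
  simpa using hm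

/-- The absolute Galois group of a finite field is commutative. -/
lemma gal_mul_comm (g h : Gal(k/F)) : g * h = h * g := by
  have : Algebra.IsAlgebraic F k := IsAlgClosure.isAlgebraic
  ext x
  let L : IntermediateField F k := IntermediateField.adjoin F {x}
  have hx : x ∈ L := IntermediateField.mem_adjoin_simple_self F x
  have : FiniteDimensional F L :=
    IntermediateField.adjoin.finiteDimensional (Algebra.IsIntegral.isIntegral x)
  have : Finite L := Module.finite_of_finite F
  have : IsGalois F L := inferInstance
  have key : (g * h).restrictNormal L = (h * g).restrictNormal L := by
    change AlgEquiv.restrictNormalHom L (g * h) = AlgEquiv.restrictNormalHom L (h * g)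
    rw [map_mul, map_mul]
    exact (IsCyclic.isMulCommutative (α := Gal(L/F))).is_comm.comm _ _
  have h1 := AlgEquiv.restrictNormal_commutes (g * h) L ⟨x, hx⟩
  have h2 := AlgEquiv.restrictNormal_commutes (h * g) L ⟨x, hx⟩
  rw [key] at h1
  exact h1.symm.trans h2

end Galois

variable {F k : Type u} [Field F] [Field k] [Algebra F k]

/-! ## Schemes over the finite field and over its algebraic closure -/

variable (F k) in
/-- The structure morphism `Spec k ⟶ Spec F`. -/
def specAlg : Spec (.of k) ⟶ Spec (.of F) := Spec.map (CommRingCat.ofHom (algebraMap F k))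

/-- The automorphism of `Spec k` induced by the field automorphism `g`. -/
def galSpec (g : Gal(k/F)) : Spec (.of k) ⟶ Spec (.of k) :=
  Spec.map (CommRingCat.ofHom (g : k →+* k))

lemma galSpec_one : galSpec (1 : Gal(k/F)) = 𝟙 _ := by
  rw [galSpec, ← Spec.map_id]; rfl

lemma galSpec_mul (g h : Gal(k/F)) : galSpec (g * h) = galSpec g ≫ galSpec h := by
  rw [galSpec, galSpec, galSpec, ← Spec.map_comp]; rfl

lemma galSpec_specAlg (g : Gal(k/F)) : galSpec g ≫ specAlg F k = specAlg F k := by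
  rw [galSpec, specAlg, ← Spec.map_comp, ← CommRingCat.ofHom_comp]
  congr 2
  ext x
  exact g.commutes x

variable (k) in
/-- The base change `Y ×_F k`. -/
abbrev geom (Y : Over (Spec (.of F))) : Scheme.{u} := pullback Y.hom (specAlg F k)

/-- The automorphism `id × Spec g` of `Y ×_F k`. -/
def galAct (Y : Over (Spec (.of F))) (g : Gal(k/F)) : geom k Y ⟶ geom k Y :=
  pullback.lift (pullback.fst _ _) (pullback.snd _ _ ≫ galSpec g)
    (by rw [Category.assoc, galSpec_specAlg, pullback.condition])

@[simp]
lemma galAct_fst (Y : Over (Spec (.of F))) (g : Gal(k/F)) :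
    galAct Y g ≫ pullback.fst _ _ = pullback.fst _ _ :=
  pullback.lift_fst _ _ _

@[simp]
lemma galAct_snd (Y : Over (Spec (.of F))) (g : Gal(k/F)) :
    galAct Y g ≫ pullback.snd _ _ = pullback.snd _ _ ≫ galSpec g :=
  pullback.lift_snd _ _ _

lemma galAct_one (Y : Over (Spec (.of F))) : galAct Y (1 : Gal(k/F)) = 𝟙 _ := by
  apply pullback.hom_ext
  · rw [galAct_fst, Category.id_comp]
  · rw [galAct_snd, galSpec_one, Category.comp_id, Category.id_comp]

lemma galAct_mul (Y : Over (Spec (.of F))) (g h : Gal(k/F)) :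
    galAct Y (g * h) = galAct Y g ≫ galAct Y h := by
  apply pullback.hom_ext
  · rw [galAct_fst, Category.assoc, galAct_fst, galAct_fst]
  · rw [galAct_snd, Category.assoc, galAct_snd, ← Category.assoc, galAct_snd, galSpec_mul,
      Category.assoc]

instance (Y : Over (Spec (.of F))) (g : Gal(k/F)) : IsIso (galAct Y g) :=
  ⟨galAct Y g⁻¹, by rw [← galAct_mul, mul_inv_cancel, galAct_one],
    by rw [← galAct_mul, inv_mul_cancel, galAct_one]⟩

variable {X : Over (Spec (.of F))}

variable (X) in
/-- A full subcategory `ℰ` of the category of schemes over `X` that are separated and of finite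
type over `F`, containing with `Y` every `U ∈ Over X` that is étale and of finite type over `Y`
(and separated over `F`).  For `X = Spec F` this is a full subcategory of the category of
separated `F`-schemes of finite type; for general `X` the small étale site of `X` is covered. -/
structure SchemeSubcategory where
  /-- the objects of `ℰ` -/
  mem : ObjectProperty (Over X.left)
  isSeparated : ∀ Y, mem Y → IsSeparated (Y.hom ≫ X.hom)
  locallyOfFiniteType : ∀ Y, mem Y → LocallyOfFiniteType (Y.hom ≫ X.hom)
  quasiCompact : ∀ Y, mem Y → QuasiCompact (Y.hom ≫ X.hom)
  mem_of_etale : ∀ {U Y : Over X.left} (f : U ⟶ Y), mem Y → Etale f.left →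
    QuasiCompact f.left → IsSeparated (U.hom ≫ X.hom) → mem U

variable (k) in
/-- `U → X ×_F k` is (isomorphic to) a connected component of `Y ×_F k` for some `Y` in `ℰ`. -/
def IsComponent (E : SchemeSubcategory X) : ObjectProperty (Over (geom k X)) := fun U =>
  ∃ Y : Over X.left, E.mem Y ∧ ∃ j : U.left ⟶ geom k (Over.mk (Y.hom ≫ X.hom)),
    IsOpenImmersion j ∧
    j ≫ pullback.fst _ _ ≫ Y.hom = U.hom ≫ pullback.fst _ _ ∧
    j ≫ pullback.snd _ _ = U.hom ≫ pullback.snd _ _ ∧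
    ∃ y, Set.range j = connectedComponent y

lemma IsComponent.twist {E : SchemeSubcategory X} {U : Over (geom k X)} (hU : IsComponent k E U)
    (g : Gal(k/F)) : IsComponent k E (Over.mk (U.hom ≫ galAct X g)) := by
  obtain ⟨Y, hY, j, hj, h1, h2, y, hy⟩ := hU
  refine ⟨Y, hY, j ≫ galAct _ g, inferInstance, ?_, ?_, galAct _ g y, ?_⟩
  · have := galAct_fst (Over.mk (Y.hom ≫ X.hom)) g
    change _ = (U.hom ≫ galAct X g) ≫ pullback.fst _ _
    rw [Category.assoc, reassoc_of% this, h1, Category.assoc, galAct_fst]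
  · change _ = (U.hom ≫ galAct X g) ≫ pullback.snd _ _
    rw [Category.assoc, galAct_snd, Category.assoc, galAct_snd, reassoc_of% h2]
  · rw [Scheme.Hom.comp_base, TopCat.coe_comp, Set.range_comp, hy]
    have := (Scheme.homeoOfIso (asIso (galAct (Over.mk (Y.hom ≫ X.hom)) g))).image_connectedComponentIn
      (Set.mem_univ y)
    rw [connectedComponentIn_univ, Set.image_univ, EquivLike.range_eq_univ,
      connectedComponentIn_univ] at this
    exact this

variable (k) in
/-- The category `\bar ℰ`: the full subcategory of schemes over `X ×_F k` (for `X = Spec F`: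
schemes over `k`) that are connected components of the base change of a scheme in `ℰ`. -/
abbrev Ebar (E : SchemeSubcategory X) := (IsComponent k E).FullSubcategory

namespace Ebar

variable {E : SchemeSubcategory X}

/-- The underlying scheme of an object of `\bar ℰ`. -/
abbrev sch (U : Ebar k E) : Scheme.{u} := U.obj.left

/-- The structure morphism to `X ×_F k`. -/
abbrev str (U : Ebar k E) : U.sch ⟶ geom k X := U.obj.hom

/-- The morphism in `\bar ℰ` given by a morphism of the underlying schemes over `X ×_F k`. -/
def mkHom {U V : Ebar k E} (f : U.sch ⟶ V.sch) (w : f ≫ V.str = U.str) : U ⟶ V :=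
  ObjectProperty.homMk (Over.homMk f w)

/-- The functor `U ↦ gU = U ×_{k, g⁻¹} k`. As `Spec g` is an isomorphism, `gU` is the scheme `U`
with its structure morphism composed with (the automorphism of `X ×_F k` induced by) `Spec g`. -/
def twist (g : Gal(k/F)) : Ebar k E ⥤ Ebar k E where
  obj U := ⟨Over.mk (U.str ≫ galAct X g), U.property.twist g⟩
  map {U V} f := mkHom (U := ⟨_, U.property.twist g⟩) (V := ⟨_, V.property.twist g⟩) f.hom.left
    ((Category.assoc _ _ _).symm.trans (congrArg (· ≫ galAct X g) (Over.w f.hom)))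
  map_id _ := rfl
  map_comp _ _ := rfl

/-- Morphisms between twists of `U` and `V`: morphisms `f` of the underlying schemes that are
semilinear. -/
def twistHom (g h : Gal(k/F)) {U V : Ebar k E} (f : U.sch ⟶ V.sch)
    (w : f ≫ V.str ≫ galAct X h = U.str ≫ galAct X g) : (twist g).obj U ⟶ (twist h).obj V :=
  mkHom (U := (twist g).obj U) (V := (twist h).obj V) f w

/-- The identification `U = gU` for `g = 1`. -/
def toTwistOne (U : Ebar k E) {g : Gal(k/F)} (hg : g = 1) : U ⟶ (twist g).obj U :=
  mkHom (V := (twist g).obj U) (𝟙 U.sch)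
    (by
      change 𝟙 U.sch ≫ U.str ≫ galAct X g = U.str
      rw [hg, galAct_one, Category.id_comp, Category.comp_id])

/-- The étale topology on `\bar ℰ`.  A sieve is covering if it contains a jointly surjective
family of étale morphisms; since such families are stable under base change in `\bar ℰ`, it is
the same to ask this for all pullbacks of the sieve, which is the form chosen here. -/
def etaleTopology (E : SchemeSubcategory X) : GrothendieckTopology (Ebar k E) where
  sieves U := { S | ∀ ⦃V : Ebar k E⦄ (f : V ⟶ U) (v : V.sch),
    ∃ (W : Ebar k E) (h : W ⟶ V) (w : W.sch), S (h ≫ f) ∧ Etale h.hom.left ∧ h.hom.left w = v }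
  top_mem' U := fun V f v => ⟨V, 𝟙 V, v, trivial, by
    change Etale (𝟙 V.sch); infer_instance, by
    change (𝟙 V.sch : V.sch ⟶ V.sch) v = v; simp⟩
  pullback_stable' U V S g hS := fun W f w => by
    obtain ⟨W', h, w', h1, h2, h3⟩ := hS (f ≫ g) w
    exact ⟨W', h, w', by simpa [Sieve.pullback] using h1, h2, h3⟩
  transitive' U S hS R hR := fun V f v => by
    obtain ⟨W, h, w, h1, h2, h3⟩ := hS f v
    obtain ⟨W', h', w', h1', h2', h3'⟩ := hR h1 (𝟙 W) w
    refine ⟨W', h' ≫ h, w', by simpa using h1', ?_, ?_⟩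
    · change Etale (h'.hom.left ≫ h.hom.left)
      infer_instance
    · change (h'.hom.left ≫ h.hom.left) w' = v
      rw [Scheme.Hom.comp_apply, h3', h3]

end Ebar

/-! ## Models over finite fields -/

/-- A model `U'` of the object `U` of `\bar ℰ` over a subfield `K` of `k`: a separated scheme of
finite type over `K` (over `X ×_F K`) together with an identification `U = U' ×_K k`. -/
structure Model {E : SchemeSubcategory X} (U : Ebar k E) (K : IntermediateField F k) where
  /-- the scheme `U'` -/
  obj : Scheme.{u}
  /-- the structure morphism to `Spec K` -/
  toField : obj ⟶ Spec (.of K)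
  /-- the structure morphism to `X` -/
  toBase : obj ⟶ X.left
  w : toBase ≫ X.hom = toField ≫ Spec.map (CommRingCat.ofHom (algebraMap F K))
  isSeparated : IsSeparated toField
  locallyOfFiniteType : LocallyOfFiniteType toField
  quasiCompact : QuasiCompact toField
  /-- the projection `U = U' ×_K k ⟶ U'` -/
  proj : U.sch ⟶ obj
  proj_toBase : proj ≫ toBase = U.str ≫ pullback.fst _ _
  isPullback : IsPullback proj (U.str ≫ pullback.snd _ _) toField
    (Spec.map (CommRingCat.ofHom (algebraMap K k)))

namespace Model

variable {E : SchemeSubcategory X} {U : Ebar k E} {K : IntermediateField F k} (M : Model U K)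

/-- The automorphism `id × Spec g` of the scheme `U = U' ×_K k`, for `g ∈ Gal(k/K)`. -/
def act (g : Gal(k/F)) (hg : g ∈ K.fixingSubgroup) : U.sch ⟶ U.sch :=
  M.isPullback.lift M.proj ((U.str ≫ pullback.snd _ _) ≫ galSpec g) (by
    rw [M.isPullback.w, Category.assoc _ (galSpec g), galSpec, ← Spec.map_comp,
      ← CommRingCat.ofHom_comp]
    congr 3
    ext x
    exact (hg x).symm)

lemma act_proj (g : Gal(k/F)) (hg : g ∈ K.fixingSubgroup) : M.act g hg ≫ M.proj = M.proj :=
  M.isPullback.lift_fst _ _ _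

lemma act_str (g : Gal(k/F)) (hg : g ∈ K.fixingSubgroup) :
    M.act g hg ≫ U.str = U.str ≫ galAct X g := by
  apply pullback.hom_ext
  · rw [Category.assoc, ← M.proj_toBase, Category.assoc, galAct_fst, ← Category.assoc,
      act_proj, M.proj_toBase]
  · rw [Category.assoc, Category.assoc, galAct_snd]
    exact (M.isPullback.lift_snd _ _ _).trans (Category.assoc _ _ _)

lemma act_mul (g h : Gal(k/F)) (hg : g ∈ K.fixingSubgroup) (hh : h ∈ K.fixingSubgroup) :
    M.act (g * h) (mul_mem hg hh) = M.act g hg ≫ M.act h hh := by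
  have snd (x : Gal(k/F)) (hx : x ∈ K.fixingSubgroup) :
      M.act x hx ≫ U.str ≫ pullback.snd _ _ = (U.str ≫ pullback.snd _ _) ≫ galSpec x :=
    M.isPullback.lift_snd _ _ _
  apply M.isPullback.hom_ext
  · rw [Category.assoc, act_proj, act_proj, act_proj]
  · rw [Category.assoc, snd, snd, ← Category.assoc, snd, galSpec_mul, ← Category.assoc (_ ≫ _)]

lemma act_one (h : (1 : Gal(k/F)) ∈ K.fixingSubgroup) : M.act 1 h = 𝟙 _ := by
  apply M.isPullback.hom_ext
  · rw [act_proj, Category.id_comp]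
  · rw [Category.id_comp, act]
    refine (M.isPullback.lift_snd _ _ _).trans ?_
    rw [galSpec_one, Category.comp_id]

end Model

/-! ## Sheaves with a group action -/

variable [Fintype F] [IsAlgClosure F k] {E : SchemeSubcategory X}

/-- The identification `(gh)U = g(hU)`; here `gh` is any element `x` with `x = g * h`. -/
def Ebar.twistMul (U : Ebar k E) {g h x : Gal(k/F)} (e : x = g * h) :
    (Ebar.twist x).obj U ⟶ (Ebar.twist g).obj ((Ebar.twist h).obj U) :=
  Ebar.mkHom (U := (Ebar.twist x).obj U) (V := (Ebar.twist g).obj ((Ebar.twist h).obj U))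
    (𝟙 U.sch) (by
      change 𝟙 U.sch ≫ (U.str ≫ galAct X h) ≫ galAct X g = U.str ≫ galAct X x
      rw [e, gal_mul_comm, galAct_mul, Category.id_comp, Category.assoc])

variable (E) in
/-- A sheaf of abelian groups `𝓕` on `\bar ℰ` with an action of the group `H`, which acts on
`\bar ℰ` through `ρ : H → Gal(k/F)`: morphisms `σ_h : 𝓕 ⟶ h^* 𝓕`, `(h^* 𝓕)(U) = 𝓕(hU)`, with
`σ_1 = id` and `σ_{gh} = h^* σ_g ∘ σ_h` (so that every `σ_h` is an isomorphism). -/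
structure EquivSheaf {H : Type u} [Group H] (ρ : H →* Gal(k/F)) where
  /-- the underlying sheaf -/
  sheaf : Sheaf (Ebar.etaleTopology (k := k) E) AddCommGrpCat.{u + 1}
  /-- the action -/
  σ (h : H) : sheaf.obj ⟶ (Ebar.twist (ρ h)).op ⋙ sheaf.obj
  σ_one (U : Ebar k E) :
    (σ 1).app (op U) ≫ sheaf.obj.map (Ebar.toTwistOne U (map_one ρ)).op = 𝟙 _
  σ_mul (g h : H) (U : Ebar k E) : (σ (g * h)).app (op U) =
    (σ h).app (op U) ≫ (σ g).app (op ((Ebar.twist (ρ h)).obj U)) ≫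
      sheaf.obj.map (Ebar.twistMul U (map_mul ρ g h)).op

namespace EquivSheaf

variable {H : Type u} [Group H] {ρ : H →* Gal(k/F)}

/-- A morphism of `H`-equivariant sheaves: a morphism of sheaves compatible with the actions. -/
@[ext]
structure Hom (𝓕 𝓖 : EquivSheaf E ρ) where
  /-- the underlying morphism of sheaves -/
  hom : 𝓕.sheaf ⟶ 𝓖.sheaf
  comm (h : H) : 𝓕.σ h ≫ Functor.whiskerLeft (Ebar.twist (ρ h)).op hom.hom = hom.hom ≫ 𝓖.σ h

instance : Category (EquivSheaf E ρ) where
  Hom 𝓕 𝓖 := Hom 𝓕 𝓖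
  id 𝓕 := ⟨𝟙 _, fun h => by
    change 𝓕.σ h ≫ Functor.whiskerLeft _ (𝟙 𝓕.sheaf.obj) = 𝟙 𝓕.sheaf.obj ≫ 𝓕.σ h
    simp⟩
  comp {𝓕 𝓖 𝓗} a b := ⟨a.hom ≫ b.hom, fun h => by
    change 𝓕.σ h ≫ Functor.whiskerLeft _ (a.hom.hom ≫ b.hom.hom) =
      (a.hom.hom ≫ b.hom.hom) ≫ 𝓗.σ h
    rw [Functor.whiskerLeft_comp, ← Category.assoc, a.comm, Category.assoc, b.comm,
      Category.assoc]⟩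

/-- The underlying sheaf. -/
def forget (ρ : H →* Gal(k/F)) :
    EquivSheaf E ρ ⥤ Sheaf (Ebar.etaleTopology (k := k) E) AddCommGrpCat.{u + 1} where
  obj 𝓕 := 𝓕.sheaf
  map a := a.hom

@[ext]
lemma hom_ext {𝓕 𝓖 : EquivSheaf E ρ} {a b : 𝓕 ⟶ 𝓖} (h : a.hom = b.hom) : a = b := Hom.ext h

lemma comm_app {𝓕 𝓖 : EquivSheaf E ρ} (a : 𝓕 ⟶ 𝓖) (h : H) (U : (Ebar k E)ᵒᵖ) :
    (𝓕.σ h).app U ≫ a.hom.hom.app ((Ebar.twist (ρ h)).op.obj U) =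
      a.hom.hom.app U ≫ (𝓖.σ h).app U :=
  NatTrans.congr_app (a.comm h) U

instance (𝓕 𝓖 : EquivSheaf E ρ) : Zero (𝓕 ⟶ 𝓖) := ⟨⟨0, fun h => by
  ext U : 2
  change (𝓕.σ h).app U ≫ 0 = 0 ≫ (𝓖.σ h).app U
  rw [comp_zero, zero_comp]⟩⟩

instance (𝓕 𝓖 : EquivSheaf E ρ) : Add (𝓕 ⟶ 𝓖) := ⟨fun a b => ⟨a.hom + b.hom, fun h => by
  ext U : 2
  change (𝓕.σ h).app U ≫ (a.hom.hom.app _ + b.hom.hom.app _) =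
    (a.hom.hom.app U + b.hom.hom.app U) ≫ (𝓖.σ h).app U
  rw [Preadditive.comp_add, Preadditive.add_comp, ← comm_app, ← comm_app]⟩⟩

instance (𝓕 𝓖 : EquivSheaf E ρ) : Neg (𝓕 ⟶ 𝓖) := ⟨fun a => ⟨-a.hom, fun h => by
  ext U : 2
  change (𝓕.σ h).app U ≫ (-(a.hom.hom.app _)) = (-(a.hom.hom.app U)) ≫ (𝓖.σ h).app U
  rw [Preadditive.comp_neg, Preadditive.neg_comp, ← comm_app]⟩⟩

instance (𝓕 𝓖 : EquivSheaf E ρ) : AddCommGroup (𝓕 ⟶ 𝓖) where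
  add_assoc a b c := hom_ext (add_assoc a.hom b.hom c.hom)
  zero_add a := hom_ext (zero_add a.hom)
  add_zero a := hom_ext (add_zero a.hom)
  nsmul := nsmulRec
  zsmul := zsmulRec
  neg_add_cancel a := hom_ext (neg_add_cancel a.hom)
  add_comm a b := hom_ext (add_comm a.hom b.hom)

instance : Preadditive (EquivSheaf E ρ) where
  add_comp _ _ _ a b c := hom_ext (Preadditive.add_comp _ _ _ a.hom b.hom c.hom)
  comp_add _ _ _ a b c := hom_ext (Preadditive.comp_add _ _ _ a.hom b.hom c.hom)

instance : (forget (E := E) ρ).Additive where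
  map_add := rfl

open scoped ZeroObject

/-- The zero sheaf. -/
def zero (ρ : H →* Gal(k/F)) : EquivSheaf E ρ where
  sheaf := 0
  σ _ := 0
  σ_one _ := by
    have h : IsZero ((sheafToPresheaf (Ebar.etaleTopology (k := k) E)
      AddCommGrpCat.{u + 1}).obj 0) := Functor.map_isZero _ (isZero_zero _)
    exact (h.obj _).eq_of_src _ _
  σ_mul _ _ _ := by
    have h : IsZero ((sheafToPresheaf (Ebar.etaleTopology (k := k) E)
      AddCommGrpCat.{u + 1}).obj 0) := Functor.map_isZero _ (isZero_zero _)
    exact (h.obj _).eq_of_src _ _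

lemma isZero_zero_sheaf : IsZero (zero (E := E) ρ) := by
  rw [IsZero.iff_id_eq_zero]
  exact hom_ext ((isZero_zero (Sheaf _ _)).eq_of_src _ _)

instance : HasZeroObject (EquivSheaf E ρ) := ⟨_, isZero_zero_sheaf⟩

/-- The group `𝓕(U)`. -/
abbrev sec (𝓕 : EquivSheaf E ρ) (U : Ebar k E) : Type (u + 1) := 𝓕.sheaf.obj.obj (op U)

/-- The restriction map `𝓕(V) → 𝓕(U)` along `f : U ⟶ V`. -/
def res (𝓕 : EquivSheaf E ρ) {U V : Ebar k E} (f : U ⟶ V) : 𝓕.sec V →+ 𝓕.sec U :=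
  (𝓕.sheaf.obj.map f.op).hom

/-- The map `σ_h : 𝓕(U) → 𝓕(hU)`. -/
def act (𝓕 : EquivSheaf E ρ) (h : H) (U : Ebar k E) :
    𝓕.sec U →+ 𝓕.sec ((Ebar.twist (ρ h)).obj U) :=
  ((𝓕.σ h).app (op U)).hom

/-- The map `𝓕(U) → 𝓖(U)` induced by a morphism. -/
def app {𝓕 𝓖 : EquivSheaf E ρ} (a : 𝓕 ⟶ 𝓖) (U : Ebar k E) : 𝓕.sec U →+ 𝓖.sec U :=
  (a.hom.hom.app (op U)).hom

lemma subsingleton_zero_sec (U : Ebar k E) : Subsingleton ((zero (E := E) ρ).sec U) := by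
  have h : IsZero ((sheafToPresheaf (Ebar.etaleTopology (k := k) E)
    AddCommGrpCat.{u + 1}).obj 0) := Functor.map_isZero _ (isZero_zero _)
  exact AddCommGrpCat.subsingleton_of_isZero (h.obj (op U))

end EquivSheaf

/-! ## Continuous actions and the morphism of topoi `γ` -/

/-- For `g ∈ Gal(k/K)`, the identification `U = gU` given by a model of `U` over `K`. -/
def Model.toTwist {U : Ebar k E} {K : IntermediateField F k} (M : Model U K)
    (g : K.fixingSubgroup) : U ⟶ (Ebar.twist (g : Gal(k/F))).obj U :=
  Ebar.mkHom (V := (Ebar.twist (g : Gal(k/F))).obj U) (M.act (g : Gal(k/F))⁻¹ (inv_mem g.2)) (by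
    change M.act _ _ ≫ U.str ≫ galAct X g = U.str
    rw [← Category.assoc, M.act_str, Category.assoc, ← galAct_mul, inv_mul_cancel, galAct_one,
      Category.comp_id])

/-- The action of `Gal(k/K)` on `𝓖(U)`, for a sheaf `𝓖` with an action of `Ĝ = Gal(k/F)` and an
object `U` with a model over `K`: the composition `𝓖(U) → 𝓖(gU) = 𝓖(U)`. -/
def Model.galSec {U : Ebar k E} {K : IntermediateField F k} (M : Model U K)
    (𝓖 : EquivSheaf E (MonoidHom.id Gal(k/F))) (g : K.fixingSubgroup) : 𝓖.sec U →+ 𝓖.sec U :=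
  (𝓖.res (M.toTwist g)).comp (𝓖.act (g : Gal(k/F)) U)

variable (k E) in
/-- The action of `Ĝ` on `𝓖` is continuous: whenever `U` has a model over a finite extension `K`
of `F`, the action of `Gal(k/K)` on the discrete group `𝓖(U)` is continuous. -/
def IsContinuousAction : ObjectProperty (EquivSheaf E (MonoidHom.id Gal(k/F))) := fun 𝓖 =>
  ∀ (U : Ebar k E) (K : IntermediateField F k) [FiniteDimensional F K] (M : Model U K),
    letI : TopologicalSpace (𝓖.sec U) := ⊥
    Continuous fun p : K.fixingSubgroup × 𝓖.sec U => M.galSec 𝓖 p.1 p.2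

variable (k E) in
/-- The category `𝓣_G` of Weil-étale sheaves (of abelian groups): sheaves on `\bar ℰ` with an
action of `G`. -/
abbrev WeilSheaf := EquivSheaf E (weilGroup F k).subtype

variable (k E) in
/-- The category `𝓣_Ĝ` of sheaves of abelian groups on `\bar ℰ` with a continuous action
of `Ĝ = Gal(k/F)`. -/
abbrev GaloisSheaf := (IsContinuousAction k E).FullSubcategory

instance : (IsContinuousAction k E).ContainsZero where
  exists_zero := by
    refine ⟨_, EquivSheaf.isZero_zero_sheaf, fun U K _ M => ?_⟩
    have hz := EquivSheaf.subsingleton_zero_sec (ρ := MonoidHom.id Gal(k/F)) U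
    let _ : TopologicalSpace
      ((EquivSheaf.zero (E := E) (MonoidHom.id Gal(k/F))).sec U) := ⊥
    exact continuous_of_const fun _ _ => Subsingleton.elim _ _

variable (k E) in
/-- The functor `γ^* : 𝓣_Ĝ ⥤ 𝓣_G` restricting the action of `Ĝ` to `G`. -/
def gammaPullback : GaloisSheaf k E ⥤ WeilSheaf k E where
  obj 𝓖 :=
    { sheaf := 𝓖.obj.sheaf
      σ := fun g => 𝓖.obj.σ (g : Gal(k/F))
      σ_one := fun U => 𝓖.obj.σ_one U
      σ_mul := fun g h U => 𝓖.obj.σ_mul (g : Gal(k/F)) (h : Gal(k/F)) U }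
  map a := ⟨a.hom.hom, fun h => a.hom.comm (h : Gal(k/F))⟩

instance : (gammaPullback k E).Additive where
  map_add := rfl

/-- The complex `γ_* I`, for a right adjoint `γ_*` of `γ^*`. -/
def pushforwardComplex {γ : WeilSheaf k E ⥤ GaloisSheaf k E} (adj : gammaPullback k E ⊣ γ)
    (I : CochainComplex (WeilSheaf k E) ℕ) : CochainComplex (GaloisSheaf k E) ℕ :=
  haveI : γ.Additive := adj.right_adjoint_additive
  (γ.mapHomologicalComplex _).obj I

variable (k E) in
/-- The underlying sheaf on `\bar ℰ` of a sheaf with continuous `Ĝ`-action. -/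
def underlying :
    GaloisSheaf k E ⥤ Sheaf (Ebar.etaleTopology (k := k) E) AddCommGrpCat.{u + 1} :=
  (IsContinuousAction k E).ι ⋙ EquivSheaf.forget _

instance : (underlying k E).Additive where
  map_add := rfl

/-- A morphism of complexes of sheaves with continuous `Ĝ`-action is a quasi-isomorphism if it
induces isomorphisms on the cohomology sheaves. -/
def IsQuasiIso {K L : CochainComplex (GaloisSheaf k E) ℕ} (f : K ⟶ L) : Prop :=
  QuasiIso (((underlying k E).mapHomologicalComplex _).map f)

/-- Two complexes of sheaves with continuous `Ĝ`-action are quasi-isomorphic (isomorphic in the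
derived category): they admit quasi-isomorphisms to a common third complex. -/
def QuasiIsomorphic (K L : CochainComplex (GaloisSheaf k E) ℕ) : Prop :=
  ∃ (N : CochainComplex (GaloisSheaf k E) ℕ) (a : K ⟶ N) (b : L ⟶ N), IsQuasiIso a ∧ IsQuasiIso b

/-- The `i`-th cohomology sheaf of a complex of sheaves with continuous `Ĝ`-action vanishes. -/
def CohomologyVanishes (K : CochainComplex (GaloisSheaf k E) ℕ) (i : ℕ) : Prop :=
  (((underlying k E).mapHomologicalComplex _).obj K).ExactAt i

/-! ## The sheaf `Ξ(𝓕)` -/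

/-- The object `φ^i U`. -/
abbrev phi (i : ℤ) (U : Ebar k E) : Ebar k E := (Ebar.twist (frob F k ^ i)).obj U

/-- The identification `yxU = xU` for `y ∈ Gal(k/K)` given by a model of `U` over `K`. -/
def Model.shift {U : Ebar k E} {K : IntermediateField F k} (M : Model U K) (y : Gal(k/F))
    (hy : y ∈ K.fixingSubgroup) {w x : Gal(k/F)} (e : w = y * x) :
    (Ebar.twist w).obj U ⟶ (Ebar.twist x).obj U :=
  Ebar.mkHom (U := (Ebar.twist w).obj U) (V := (Ebar.twist x).obj U) (M.act y hy) (by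
    change M.act y hy ≫ U.str ≫ galAct X x = U.str ≫ galAct X w
    rw [e, galAct_mul, ← Category.assoc, M.act_str, Category.assoc])

/-- The identification `x(gU) = wU` for `gx = yw` with `y ∈ Gal(k/K)`, given by a model of `U`
over `K`. -/
def Model.shiftTwist {U : Ebar k E} {K : IntermediateField F k} (M : Model U K) (y : Gal(k/F))
    (hy : y ∈ K.fixingSubgroup) {g x w : Gal(k/F)} (e : g * x = y * w) :
    (Ebar.twist x).obj ((Ebar.twist g).obj U) ⟶ (Ebar.twist w).obj U :=
  Ebar.mkHom (U := (Ebar.twist x).obj ((Ebar.twist g).obj U)) (V := (Ebar.twist w).obj U)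
    (M.act y hy) (by
      change M.act y hy ≫ U.str ≫ galAct X w = (U.str ≫ galAct X g) ≫ galAct X x
      rw [Category.assoc, ← galAct_mul, e, galAct_mul, ← Category.assoc, M.act_str,
        Category.assoc])

lemma frob_zpow_add (i : ℤ) (m : ℕ) : frob F k ^ (i + m) = frob F k ^ m * frob F k ^ i := by
  rw [add_comm, zpow_add, zpow_natCast]

/-- Let `U` have a model over `K` and let `φ^m ∈ Gal(k/K)`, that is, `mG ⊆ S(U)`.  The group of
families `f^{(i)} ∈ 𝓕(φ^i U)`, `i ∈ ℤ`, with `f^{(i+m)} = f^{(i)}` under the identification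
`φ^{i+m} U = φ^i U`: this is `⨁_{i ∈ ℤ/m} 𝓕(φ^i U)`, written without a choice of
representatives (see `periodicEquiv`).  For `n ≥ 1`, the transition map `δ_m^n`,
`δ_m^n(f)^{(j)} = f^{(j mod m)}`, is the inclusion of the `m`-periodic into the `mn`-periodic
families (see `periodic_le`). -/
def periodic (𝓕 : WeilSheaf k E) {U : Ebar k E} {K : IntermediateField F k} (M : Model U K)
    (m : ℕ) (hm : frob F k ^ m ∈ K.fixingSubgroup) :
    AddSubgroup (∀ i : ℤ, 𝓕.sec (phi i U)) where
  carrier := { f | ∀ i : ℤ, f (i + m) = 𝓕.res (M.shift (frob F k ^ m) hm (frob_zpow_add i m)) (f i) }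
  zero_mem' := fun i => by simp
  add_mem' := fun {a b} ha hb i => by
    change a (i + m) + b (i + m) = 𝓕.res _ (a i + b i)
    rw [map_add, ha, hb]
  neg_mem' := fun {a} ha i => by
    change -a (i + m) = 𝓕.res _ (-a i)
    rw [map_neg, ha]

lemma EquivSheaf.res_comp {H : Type u} [Group H] {ρ : H →* Gal(k/F)} (𝓕 : EquivSheaf E ρ)
    {U V W : Ebar k E} (f : U ⟶ V) (g : V ⟶ W) (x : 𝓕.sec W) :
    𝓕.res f (𝓕.res g x) = 𝓕.res (f ≫ g) x := by
  simp [EquivSheaf.res]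

lemma Model.shift_comp {U : Ebar k E} {K : IntermediateField F k} (M : Model U K)
    {y z : Gal(k/F)} (hy : y ∈ K.fixingSubgroup) (hz : z ∈ K.fixingSubgroup) {w x v : Gal(k/F)}
    (e : w = y * x) (e' : x = z * v) :
    M.shift y hy e ≫ M.shift z hz e' =
      M.shift (y * z) (mul_mem hy hz) (by rw [e, e', mul_assoc]) := by
  apply ObjectProperty.hom_ext
  apply Over.OverMorphism.ext
  exact (M.act_mul y z hy hz).symm

lemma EquivSheaf.res_shift_one {𝓕 : WeilSheaf k E} {U : Ebar k E} {K : IntermediateField F k}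
    (M : Model U K) (f : ∀ i : ℤ, 𝓕.sec (phi i U)) {y : Gal(k/F)} (hy : y ∈ K.fixingSubgroup)
    {i j : ℤ} (e : frob F k ^ j = y * frob F k ^ i) (hij : j = i) (h1 : y = 1) :
    f j = 𝓕.res (M.shift y hy e) (f i) := by
  subst hij h1
  have : M.shift 1 hy e = 𝟙 (phi j U) := by
    apply ObjectProperty.hom_ext
    apply Over.OverMorphism.ext
    exact M.act_one hy
  rw [this]
  simp [EquivSheaf.res]

/-- In a periodic family, components whose indices differ by a multiple of the period agree. -/
lemma periodic_apply {𝓕 : WeilSheaf k E} {U : Ebar k E} {K : IntermediateField F k}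
    {M : Model U K} {m : ℕ} {hm : frob F k ^ m ∈ K.fixingSubgroup}
    {f : ∀ i : ℤ, 𝓕.sec (phi i U)} (hf : f ∈ periodic 𝓕 M m hm) (n : ℤ) :
    ∀ (i j : ℤ) (_ : j = i + m * n) (y : Gal(k/F)) (hy : y ∈ K.fixingSubgroup)
      (_ : y = (frob F k ^ m) ^ n) (e : frob F k ^ j = y * frob F k ^ i),
      f j = 𝓕.res (M.shift y hy e) (f i) := by
  induction n with
  | zero =>
    rintro i j hj y hy hyn e
    exact EquivSheaf.res_shift_one M f hy e (by simpa using hj) (by simpa using hyn)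
  | succ n ih =>
    rintro i j hj y hy rfl e
    obtain rfl : j = (i + m * n) + m := by rw [hj]; ring
    rw [hf, ih i _ rfl _ (zpow_mem hm n) rfl
      (by rw [← zpow_natCast (frob F k) m, ← zpow_mul, ← zpow_add, add_comm]),
      EquivSheaf.res_comp, Model.shift_comp]
    congr 3
    rw [zpow_add_one]; exact gal_mul_comm _ _
  | pred n ih =>
    rintro i j hj y hy rfl e
    have h1 := hf j
    have h2 := ih i (j + m) (by rw [hj]; ring) _ (zpow_mem hm _) rfl
      (by rw [← zpow_natCast (frob F k) m, ← zpow_mul, ← zpow_add, hj]; congr 1; ring)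
    have e' : frob F k ^ j = (frob F k ^ m)⁻¹ * frob F k ^ (j + m) := by
      rw [frob_zpow_add, inv_mul_cancel_left]
    have h3 := congrArg (𝓕.res (M.shift _ (inv_mem hm) e')) (h1.symm.trans h2)
    rw [EquivSheaf.res_comp, EquivSheaf.res_comp, Model.shift_comp, Model.shift_comp] at h3
    rw [← EquivSheaf.res_shift_one M f _ _ rfl (by simp)] at h3
    rw [h3]
    congr 3
    rw [zpow_sub_one]; exact gal_mul_comm _ _

lemma periodic_le (𝓕 : WeilSheaf k E) {U : Ebar k E} {K : IntermediateField F k}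
    (M : Model U K) (m n : ℕ) (hm : frob F k ^ m ∈ K.fixingSubgroup) :
    periodic 𝓕 M m hm ≤ periodic 𝓕 M (m * n) (by rw [pow_mul]; exact pow_mem hm n) :=
  fun _ hf i => periodic_apply hf n i _ (by push_cast; ring) _ _ (by rw [pow_mul, zpow_natCast]) _

/-- The components with indices `0, …, m - 1` of a periodic family. -/
def periodicToPi (𝓕 : WeilSheaf k E) {U : Ebar k E} {K : IntermediateField F k} (M : Model U K)
    (m : ℕ) (hm : frob F k ^ m ∈ K.fixingSubgroup) :
    periodic 𝓕 M m hm →+ ∀ i : Fin m, 𝓕.sec (phi ((i : ℕ) : ℤ) U) where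
  toFun f i := f.1 ((i : ℕ) : ℤ)
  map_zero' := rfl
  map_add' _ _ := rfl

lemma periodicToPi_bijective (𝓕 : WeilSheaf k E) {U : Ebar k E} {K : IntermediateField F k}
    (M : Model U K) (m : ℕ) (hm0 : 0 < m) (hm : frob F k ^ m ∈ K.fixingSubgroup) :
    Function.Bijective (periodicToPi 𝓕 M m hm) := by
  have hdiv (i : ℤ) : ∃ r : Fin m, ∃ q : ℤ, i = (r : ℕ) + m * q := by
    have h1 := Int.emod_nonneg i (b := m) (by omega)
    have h2 := Int.emod_lt_of_pos i (b := m) (by omega)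
    refine ⟨⟨(i % m).toNat, by omega⟩, i / m, ?_⟩
    have := Int.emod_add_mul_ediv i m
    simp only
    rw [Int.toNat_of_nonneg h1, this]
  have hpow (r : ℕ) (q : ℤ) : frob F k ^ ((r : ℤ) + m * q) =
      (frob F k ^ m) ^ q * frob F k ^ (r : ℤ) := by
    rw [← zpow_natCast (frob F k) m, ← zpow_mul, ← zpow_add, add_comm]
  constructor
  · intro f g hfg
    ext i : 2
    obtain ⟨r, q, rfl⟩ := hdiv i
    rw [periodic_apply f.2 q _ _ rfl _ (zpow_mem hm q) rfl (hpow _ _),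
      periodic_apply g.2 q _ _ rfl _ (zpow_mem hm q) rfl (hpow _ _)]
    exact congrArg _ (congrFun hfg r)
  · intro f
    choose r q hrq using hdiv
    let F' : ∀ i : ℤ, 𝓕.sec (phi i U) := fun i =>
      𝓕.res (M.shift ((frob F k ^ m) ^ q i) (zpow_mem hm _)
        ((congrArg (frob F k ^ ·) (hrq i)).trans (hpow _ _))) (f (r i))
    have uniq (i : ℤ) (s : Fin m) (p : ℤ) (h : i = (s : ℕ) + m * p) : r i = s ∧ q i = p := by
      have h0 := hrq i
      rw [h0] at h
      have hs := s.2
      have hr := (r i).2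
      have hqp : q i = p := by
        rcases lt_trichotomy (q i) p with hlt | heq | hlt
        · nlinarith
        · exact heq
        · nlinarith
      refine ⟨Fin.ext ?_, hqp⟩
      rw [hqp] at h
      omega
    have hF' (i : ℤ) (s : Fin m) (p : ℤ) (h : i = (s : ℕ) + m * p) (y : Gal(k/F))
        (hy : y ∈ K.fixingSubgroup) (hyp : y = (frob F k ^ m) ^ p)
        (e : frob F k ^ i = y * frob F k ^ ((s : ℕ) : ℤ)) :
        F' i = 𝓕.res (M.shift y hy e) (f s) := by
      obtain ⟨rfl, rfl⟩ := uniq i s p h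
      subst hyp
      rfl
    refine ⟨⟨F', fun i => ?_⟩, ?_⟩
    · rw [hF' (i + m) (r i) (q i + 1) (by nth_rewrite 1 [hrq i]; ring)
          ((frob F k ^ m) * (frob F k ^ m) ^ q i) (mul_mem hm (zpow_mem hm _))
          (by rw [zpow_add_one]; exact gal_mul_comm _ _)
          (by rw [frob_zpow_add, mul_assoc, ← hpow, ← hrq]),
        hF' i (r i) (q i) (hrq i) _ (zpow_mem hm _) rfl (by rw [← hpow, ← hrq]),
        EquivSheaf.res_comp, Model.shift_comp]
    · funext s
      change F' _ = f s
      rw [hF' _ s 0 (by simp) 1 (one_mem _) (by simp) (by simp)]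
      have : M.shift 1 (one_mem K.fixingSubgroup) (by simp) = 𝟙 (phi ((s : ℕ) : ℤ) U) := by
        apply ObjectProperty.hom_ext
        apply Over.OverMorphism.ext
        exact M.act_one (one_mem _)
      rw [this]
      simp [EquivSheaf.res]

/-- The group of `m`-periodic families is `⨁_{i ∈ ℤ/m} 𝓕(φ^i U)`. -/
def periodicEquiv (𝓕 : WeilSheaf k E) {U : Ebar k E} {K : IntermediateField F k} (M : Model U K)
    (m : ℕ) (hm0 : 0 < m) (hm : frob F k ^ m ∈ K.fixingSubgroup) :
    periodic 𝓕 M m hm ≃+ DirectSum (Fin m) fun i => 𝓕.sec (phi ((i : ℕ) : ℤ) U) :=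
  (AddEquiv.ofBijective _ (periodicToPi_bijective 𝓕 M m hm0 hm)).trans
    (DirectSum.addEquivProd _).symm

/-- The set of sections of `Ξ(𝓕)` over `U`, `colim_{mG ⊆ S(U)} ⨁_{i ∈ ℤ/m} 𝓕(φ^i U)`: as the
transition maps `δ_m^n` are inclusions of groups of periodic families, the colimit is the union
of these groups.  (Two models of `U` induce the same identifications `φ^m U = U` for all `m`
divisible by some `m₀`, so that the union over all models is that for any fixed model.) -/
def xiSections (𝓕 : WeilSheaf k E) (U : Ebar k E) : Set (∀ i : ℤ, 𝓕.sec (phi i U)) :=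
  { f | ∃ (K : IntermediateField F k) (_ : FiniteDimensional F K) (M : Model U K) (m : ℕ)
      (_ : 0 < m) (hm : frob F k ^ m ∈ K.fixingSubgroup), f ∈ periodic 𝓕 M m hm }

/-- `Ξ`, with the endomorphism `t`, is the sheaf `Ξ(𝓕)` with its operator `t`: an object of `𝓣_Ĝ`
whose group of sections over `U` is `colim_m ⨁_{i ∈ ℤ/m} 𝓕(φ^i U)`, with the componentwise
restriction maps, with `(tf)^{(i)} = φ f^{(i-1)}`, and on which `g ∈ Ĝ` with `g ≡ φ^a mod mĜ`
acts by `(gf)^{(i)} = f^{(i+a)}` on `⨁_{i ∈ ℤ/m} 𝓕(φ^i U)`. -/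
structure XiStructure (𝓕 : WeilSheaf k E) (Ξ : GaloisSheaf k E) (t : Ξ ⟶ Ξ) where
  /-- the family `(f^{(i)})` associated with a section -/
  family (U : Ebar k E) : Ξ.obj.sec U →+ ∀ i : ℤ, 𝓕.sec (phi i U)
  injective (U : Ebar k E) : Function.Injective (family U)
  range (U : Ebar k E) : Set.range (family U) = xiSections 𝓕 U
  res {V U : Ebar k E} (f : V ⟶ U) (x : Ξ.obj.sec U) (i : ℤ) :
    family V (Ξ.obj.res f x) i = 𝓕.res ((Ebar.twist (frob F k ^ i)).map f) (family U x i)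
  t_apply (U : Ebar k E) (x : Ξ.obj.sec U) (i : ℤ) :
    family U (EquivSheaf.app t.hom U x) i =
      𝓕.res (Ebar.twistMul U (x := frob F k ^ i) (g := frob F k ^ (1 : ℤ))
          (h := frob F k ^ (i - 1)) (by rw [← zpow_add]; congr 1; ring))
        (𝓕.act (frobPow F k 1) (phi (i - 1) U) (family U x (i - 1)))
  act_apply {U : Ebar k E} (x : Ξ.obj.sec U) {K : IntermediateField F k} [FiniteDimensional F K]
    (M : Model U K) (m : ℕ) (hm0 : 0 < m) (hm : frob F k ^ m ∈ K.fixingSubgroup)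
    (hx : family U x ∈ periodic 𝓕 M m hm) (g : Gal(k/F)) (a : ℤ)
    (hg : g * (frob F k ^ a)⁻¹ ∈ (levelField F k m).fixingSubgroup) (i : ℤ) :
    family ((Ebar.twist g).obj U) (Ξ.obj.act g U x) i =
      𝓕.res (M.shiftTwist (g * (frob F k ^ a)⁻¹)
          (IntermediateField.fixingSubgroup_antitone (le_levelField hm) hg)
          (by rw [mul_assoc, zpow_add, gal_mul_comm (frob F k ^ i), inv_mul_cancel_left]))
        (family U x (i + a))

end

end WeilEtale

namespace WeilEtale

noncomputable section

namespace Ebar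

variable {F k : Type u} [Field F] [Field k] [Algebra F k] {X : Over (Spec (.of F))}
  {E : SchemeSubcategory X}

lemma hom_ext {U V : Ebar k E} {f g : U ⟶ V} (h : f.hom.left = g.hom.left) : f = g :=
  ObjectProperty.hom_ext _ (Over.OverMorphism.ext h)

lemma str_comp_galAct_inv (V : Ebar k E) (g : Gal(k/F)) :
    (V.str ≫ galAct X g⁻¹) ≫ galAct X g = V.str := by
  rw [Category.assoc, ← galAct_mul, inv_mul_cancel, galAct_one, Category.comp_id]

lemma eq_comp_galAct_inv {S T : Scheme.{u}} {a : S ⟶ T} {t : T ⟶ geom k X} {s : S ⟶ geom k X}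
    {g : Gal(k/F)} (h : a ≫ t ≫ galAct X g = s) : a ≫ t = s ≫ galAct X g⁻¹ := by
  rw [← h, Category.assoc, Category.assoc, ← galAct_mul, mul_inv_cancel, galAct_one,
    Category.comp_id]

lemma eq_of_comp_galAct {S T : Scheme.{u}} {a : S ⟶ T} {t : T ⟶ geom k X} {s : S ⟶ geom k X}
    {g : Gal(k/F)} (h : a ≫ t ≫ galAct X g = s ≫ galAct X g) : a ≫ t = s := by
  rwa [← cancel_mono (galAct X g), Category.assoc]

/-- A morphism to `gU`, as a morphism from `g⁻¹V` to `U`. -/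
def untwist {g : Gal(k/F)} {V U : Ebar k E} (f : V ⟶ (twist g).obj U) :
    (twist g⁻¹).obj V ⟶ U :=
  mkHom (U := (twist g⁻¹).obj V) f.hom.left (eq_comp_galAct_inv (Over.w f.hom))

/-- The identification `g(g⁻¹V) = V`. -/
def twistTwistInv (g : Gal(k/F)) (V : Ebar k E) :
    (twist g).obj ((twist g⁻¹).obj V) ⟶ V :=
  mkHom (U := (twist g).obj ((twist g⁻¹).obj V)) (𝟙 V.sch)
    ((Category.id_comp _).trans (str_comp_galAct_inv V g).symm)

lemma isIso_of_isIso_left {U V : Ebar k E} (f : U ⟶ V) (h : IsIso f.hom.left) : IsIso f := by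
  have : IsIso f.hom.left := h
  refine ⟨mkHom (inv f.hom.left) ?_, hom_ext (IsIso.hom_inv_id f.hom.left),
    hom_ext (IsIso.inv_hom_id f.hom.left)⟩
  rw [IsIso.inv_comp_eq]
  exact (Over.w f.hom).symm

instance (g : Gal(k/F)) (V : Ebar k E) : IsIso (twistTwistInv g V) :=
  isIso_of_isIso_left _ (inferInstanceAs (IsIso (𝟙 V.sch)))

instance (g : Gal(k/F)) : (twist (E := E) g).Faithful where
  map_injective h := hom_ext (congrArg (fun a => a.hom.left) h)

instance (g : Gal(k/F)) : (twist (E := E) g).Full where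
  map_surjective f := ⟨mkHom f.hom.left (eq_of_comp_galAct (Over.w f.hom)), rfl⟩

instance (g : Gal(k/F)) : (twist (E := E) g).EssSurj where
  mem_essImage V := ⟨_, ⟨asIso (twistTwistInv g V)⟩⟩

instance (g : Gal(k/F)) : (twist (E := E) g).IsEquivalence where

lemma functorPullback_twist_mem (g : Gal(k/F)) {U : Ebar k E} {S : Sieve ((twist g).obj U)}
    (hS : S ∈ etaleTopology E _) : S.functorPullback (twist g) ∈ etaleTopology E U := by
  intro V f v
  obtain ⟨W, h, w, h1, h2, h3⟩ := hS ((twist g).map f) v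
  refine ⟨(twist g⁻¹).obj W, untwist h, w, ?_, h2, h3⟩
  change S ((twist g).map (untwist h ≫ f))
  convert S.downward_closed h1 (twistTwistInv g W) using 1
  exact hom_ext (Category.id_comp _).symm

lemma functorPushforward_twist_mem (g : Gal(k/F)) {U : Ebar k E} {S : Sieve U}
    (hS : S ∈ etaleTopology E U) : S.functorPushforward (twist g) ∈ etaleTopology E _ := by
  intro V f v
  obtain ⟨W, h, w, h1, h2, h3⟩ := hS (untwist f) v
  refine ⟨(twist g).obj W, (twist g).map h ≫ twistTwistInv g V, w, ?_, ?_, ?_⟩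
  · convert Sieve.image_mem_functorPushforward (twist g) S h1 using 1
    refine hom_ext ?_
    change (h.hom.left ≫ 𝟙 _) ≫ f.hom.left = h.hom.left ≫ f.hom.left
    rw [Category.comp_id]
  · change Etale (h.hom.left ≫ 𝟙 _)
    rwa [Category.comp_id]
  · exact h3

instance (g : Gal(k/F)) :
    (twist (E := E) g).IsContinuous (etaleTopology E) (etaleTopology E) :=
  Functor.isContinuous_of_coverPreserving (compatiblePreservingOfFlat _ _)
    ⟨functorPushforward_twist_mem g⟩

lemma twist_op_comp_isSheaf (g : Gal(k/F))
    (A : Sheaf (etaleTopology (k := k) E) AddCommGrpCat.{u + 1}) :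
    Presheaf.IsSheaf (etaleTopology E) ((twist g).op ⋙ A.obj) :=
  (twist g).op_comp_isSheaf (etaleTopology E) (etaleTopology E) A

end Ebar

variable {F k : Type u} [Field F] [Field k] [Algebra F k] {X : Over (Spec (.of F))}

variable (E : SchemeSubcategory X) (k) in
/-- Sheaves of abelian groups on `\bar ℰ`. -/
abbrev AbSheaf := Sheaf (Ebar.etaleTopology (k := k) E) AddCommGrpCat.{u + 1}

variable {E : SchemeSubcategory X}

instance : IsGrothendieckAbelian.{u + 1} (AbSheaf k E) := by
  have : EssentiallySmall.{u + 1} (Ebar k E) := essentiallySmallSelf.{u + 1} _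
  exact Sheaf.isGrothendieckAbelian_of_essentiallySmall _ _

instance : EnoughInjectives (AbSheaf k E) := IsGrothendieckAbelian.enoughInjectives

instance : (sheafToPresheaf (Ebar.etaleTopology (k := k) E) AddCommGrpCat.{u + 1}).Additive where
  map_add := rfl

end

end WeilEtale

namespace WeilEtale

noncomputable section

variable {F k : Type u} [Field F] [Fintype F] [Field k] [Algebra F k] [IsAlgClosure F k]
  {X : Over (Spec (.of F))} {E : SchemeSubcategory X}

namespace Ebar

/-- `toTwistOne` as a natural transformation. -/
def toTwistOneNat {g : Gal(k/F)} (hg : g = 1) : 𝟭 (Ebar k E) ⟶ twist g where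
  app U := toTwistOne U hg
  naturality _ _ f := hom_ext ((Category.comp_id f.hom.left).trans (Category.id_comp f.hom.left).symm)

/-- `twistMul` as a natural transformation. -/
def twistMulNat {g h x : Gal(k/F)} (e : x = g * h) :
    twist (E := E) x ⟶ twist h ⋙ twist g where
  app U := twistMul U e
  naturality _ _ f := hom_ext ((Category.comp_id f.hom.left).trans (Category.id_comp f.hom.left).symm)

end Ebar

/-- The functor `A ↦ g^* A` on sheaves, with values in presheaves. -/
abbrev twistPre (g : Gal(k/F)) : AbSheaf k E ⥤ (Ebar k E)ᵒᵖ ⥤ AddCommGrpCat.{u + 1} :=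
  sheafToPresheaf _ _ ⋙ (Functor.whiskeringLeft _ _ _).obj (Ebar.twist g).op

lemma AbSheaf.hom_cancel_epi {A B : AbSheaf k E} (p : A ⟶ B) [Epi p]
    {P : (Ebar k E)ᵒᵖ ⥤ AddCommGrpCat.{u + 1}} (hP : Presheaf.IsSheaf (Ebar.etaleTopology E) P)
    {f g : B.obj ⟶ P} (h : p.hom ≫ f = p.hom ≫ g) : f = g := by
  let f' : B ⟶ ⟨P, hP⟩ := ⟨f⟩
  let g' : B ⟶ ⟨P, hP⟩ := ⟨g⟩
  have : f' = g' := by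
    rw [← cancel_epi p]
    exact Sheaf.hom_ext h
  exact congrArg (fun a => a.hom) this

namespace EquivSheaf

variable {H : Type u} [Group H] {ρ : H →* Gal(k/F)}

/-- The action on a subsheaf that is stable under the action. -/
def ofMono (𝓕 : EquivSheaf E ρ) {K : AbSheaf k E} (i : K ⟶ 𝓕.sheaf) [Mono i]
    (σ : ∀ h : H, K.obj ⟶ (Ebar.twist (ρ h)).op ⋙ K.obj)
    (w : ∀ h, σ h ≫ (twistPre (ρ h)).map i = i.hom ≫ 𝓕.σ h) : EquivSheaf E ρ where
  sheaf := K
  σ := σ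
  σ_one U := by
    have w' := NatTrans.congr_app (w 1) (op U)
    have : Mono (i.hom.app (op U)) := inferInstanceAs (Mono (((sheafToPresheaf _ _) ⋙
      (evaluation _ _).obj (op U)).map i))
    rw [← cancel_mono (i.hom.app (op U)), Category.assoc, i.hom.naturality, Category.id_comp]
    change (σ 1).app (op U) ≫ i.hom.app (op ((Ebar.twist (ρ 1)).obj U)) ≫ _ = _
    change (σ 1).app (op U) ≫ i.hom.app (op ((Ebar.twist (ρ 1)).obj U)) = _ at w'
    rw [← Category.assoc, w']
    change (i.hom.app (op U) ≫ (𝓕.σ 1).app (op U)) ≫ _ = _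
    rw [Category.assoc]
    exact (congrArg (i.hom.app (op U) ≫ ·) (𝓕.σ_one U)).trans (Category.comp_id _)
  σ_mul g h U := by
    have w' (h : H) (U : Ebar k E) : (σ h).app (op U) ≫
      i.hom.app (op ((Ebar.twist (ρ h)).obj U)) = i.hom.app (op U) ≫ (𝓕.σ h).app (op U) :=
      NatTrans.congr_app (w h) (op U)
    have : Mono (i.hom.app (op ((Ebar.twist (ρ (g * h))).obj U))) :=
      inferInstanceAs (Mono (((sheafToPresheaf _ _) ⋙ (evaluation _ _).obj _).map i))
    rw [← cancel_mono (i.hom.app (op ((Ebar.twist (ρ (g * h))).obj U)))]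
    refine (w' _ _).trans ?_
    rw [𝓕.σ_mul, Category.assoc, Category.assoc, i.hom.naturality]
    change _ = (σ h).app (op U) ≫ (σ g).app (op ((Ebar.twist (ρ h)).obj U)) ≫
      i.hom.app (op ((Ebar.twist (ρ g)).obj ((Ebar.twist (ρ h)).obj U))) ≫ _
    rw [reassoc_of% (w' g), reassoc_of% (w' h)]

/-- The action on a quotient sheaf that is stable under the action. -/
def ofEpi (𝓕 : EquivSheaf E ρ) {Q : AbSheaf k E} (p : 𝓕.sheaf ⟶ Q) [Epi p]
    (σ : ∀ h : H, Q.obj ⟶ (Ebar.twist (ρ h)).op ⋙ Q.obj)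
    (w : ∀ h, p.hom ≫ σ h = 𝓕.σ h ≫ (twistPre (ρ h)).map p) : EquivSheaf E ρ where
  sheaf := Q
  σ := σ
  σ_one U := by
    have : σ 1 ≫ Functor.whiskerRight (NatTrans.op (Ebar.toTwistOneNat (map_one ρ))) Q.obj =
        𝟙 Q.obj := by
      refine AbSheaf.hom_cancel_epi p Q.property ?_
      rw [reassoc_of% (w 1), Category.comp_id]
      ext V : 2
      change (𝓕.σ 1).app V ≫ p.hom.app (op ((Ebar.twist (ρ 1)).obj V.unop)) ≫ Q.obj.map _ = _
      rw [← p.hom.naturality, ← Category.assoc]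
      exact (congrArg (· ≫ _) (𝓕.σ_one V.unop)).trans (Category.id_comp _)
    exact NatTrans.congr_app this (op U)
  σ_mul g h U := by
    have w' (h : H) (U : Ebar k E) : p.hom.app (op U) ≫ (σ h).app (op U) =
      (𝓕.σ h).app (op U) ≫ p.hom.app (op ((Ebar.twist (ρ h)).obj U)) :=
      NatTrans.congr_app (w h) (op U)
    have : σ (g * h) = σ h ≫ Functor.whiskerLeft (Ebar.twist (ρ h)).op (σ g) ≫
        Functor.whiskerRight (NatTrans.op (Ebar.twistMulNat (map_mul ρ g h))) Q.obj := by
      refine AbSheaf.hom_cancel_epi p (Ebar.twist_op_comp_isSheaf _ Q) ?_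
      ext V : 2
      change p.hom.app (op V.unop) ≫ (σ (g * h)).app (op V.unop) =
        p.hom.app (op V.unop) ≫ (σ h).app (op V.unop) ≫
          (σ g).app (op ((Ebar.twist (ρ h)).obj V.unop)) ≫ Q.obj.map _
      rw [w', reassoc_of% w', reassoc_of% w', 𝓕.σ_mul, ← p.hom.naturality]
      simp only [Category.assoc]
      rfl
    exact NatTrans.congr_app this (op U)

/-- A morphism of sheaves is equivariant if it is so after composition with an equivariant
monomorphism. -/
def liftHom {𝓕 𝓖 𝓗 : EquivSheaf E ρ} (a : 𝓕 ⟶ 𝓖) [Mono a.hom] (b : 𝓗 ⟶ 𝓖)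
    (l : 𝓗.sheaf ⟶ 𝓕.sheaf) (hl : l ≫ a.hom = b.hom) : 𝓗 ⟶ 𝓕 where
  hom := l
  comm h := by
    have h1 : (twistPre (ρ h)).map l ≫ (twistPre (ρ h)).map a.hom = (twistPre (ρ h)).map b.hom := by
      rw [← Functor.map_comp, hl]
    have h2 : l.hom ≫ a.hom.hom = b.hom.hom := congrArg (fun x => x.hom) hl
    change 𝓗.σ h ≫ (twistPre (ρ h)).map l = _
    rw [← cancel_mono ((twistPre (ρ h)).map a.hom), Category.assoc, h1, Category.assoc]
    refine (b.comm h).trans ?_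
    rw [← h2, Category.assoc]
    exact congrArg (l.hom ≫ ·) (a.comm h).symm

/-- A morphism of sheaves is equivariant if it is so after composition with an equivariant
epimorphism. -/
def descHom {𝓕 𝓖 𝓗 : EquivSheaf E ρ} (a : 𝓕 ⟶ 𝓖) [Epi a.hom] (b : 𝓕 ⟶ 𝓗)
    (l : 𝓖.sheaf ⟶ 𝓗.sheaf) (hl : a.hom ≫ l = b.hom) : 𝓖 ⟶ 𝓗 where
  hom := l
  comm h := by
    have h1 : (twistPre (ρ h)).map a.hom ≫ (twistPre (ρ h)).map l = (twistPre (ρ h)).map b.hom := by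
      rw [← Functor.map_comp, hl]
    have h2 : a.hom.hom ≫ l.hom = b.hom.hom := congrArg (fun x => x.hom) hl
    change 𝓖.σ h ≫ (twistPre (ρ h)).map l = _
    refine AbSheaf.hom_cancel_epi a.hom (Ebar.twist_op_comp_isSheaf _ _) ?_
    have h3 : a.hom.hom ≫ 𝓖.σ h = 𝓕.σ h ≫ (twistPre (ρ h)).map a.hom := (a.comm h).symm
    rw [← Category.assoc, h3, Category.assoc, h1, ← Category.assoc, h2]
    exact b.comm h

/-- The kernel of a morphism of equivariant sheaves. -/
def kernelObj {𝓕 𝓖 : EquivSheaf E ρ} (a : 𝓕 ⟶ 𝓖) : EquivSheaf E ρ :=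
  ofMono 𝓕 (kernel.ι a.hom)
    (fun h => Fork.IsLimit.lift (KernelFork.mapIsLimit _ (kernelIsKernel a.hom) (twistPre (ρ h)))
      ((kernel.ι a.hom).hom ≫ 𝓕.σ h) (by
        have h1 : 𝓕.σ h ≫ (twistPre (ρ h)).map a.hom = a.hom.hom ≫ 𝓖.σ h := a.comm h
        have h2 : (kernel.ι a.hom).hom ≫ a.hom.hom = 0 :=
          congrArg (fun x => x.hom) (kernel.condition a.hom)
        rw [Category.assoc, h1, reassoc_of% h2, zero_comp, comp_zero]))
    (fun h => Fork.IsLimit.lift_ι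
      (KernelFork.mapIsLimit _ (kernelIsKernel a.hom) (twistPre (ρ h))))

/-- The inclusion of the kernel. -/
def kernelι {𝓕 𝓖 : EquivSheaf E ρ} (a : 𝓕 ⟶ 𝓖) : kernelObj a ⟶ 𝓕 where
  hom := kernel.ι a.hom
  comm h := Fork.IsLimit.lift_ι
      (KernelFork.mapIsLimit _ (kernelIsKernel a.hom) (twistPre (ρ h)))

/-- `h^* coker(a)` as a sheaf. -/
abbrev twistSheaf (h : H) (A : AbSheaf k E) : AbSheaf k E :=
  ⟨_, Ebar.twist_op_comp_isSheaf (ρ h) A⟩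

/-- The composition `𝓖 ⟶ h^* 𝓖 ⟶ h^* coker(a)`. -/
def toTwistCokernel {𝓕 𝓖 : EquivSheaf E ρ} (a : 𝓕 ⟶ 𝓖) (h : H) :
    𝓖.sheaf ⟶ twistSheaf (ρ := ρ) h (cokernel a.hom) :=
  ⟨𝓖.σ h ≫ (twistPre (ρ h)).map (cokernel.π a.hom)⟩

lemma comp_toTwistCokernel {𝓕 𝓖 : EquivSheaf E ρ} (a : 𝓕 ⟶ 𝓖) (h : H) :
    a.hom ≫ toTwistCokernel a h = 0 := by
  apply Sheaf.hom_ext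
  have h1 : a.hom.hom ≫ 𝓖.σ h = 𝓕.σ h ≫ (twistPre (ρ h)).map a.hom := (a.comm h).symm
  change a.hom.hom ≫ 𝓖.σ h ≫ (twistPre (ρ h)).map (cokernel.π a.hom) = 0
  rw [← Category.assoc, h1, Category.assoc, ← Functor.map_comp, cokernel.condition,
    Functor.map_zero, comp_zero]

/-- The action on the cokernel. -/
def cokernelσ {𝓕 𝓖 : EquivSheaf E ρ} (a : 𝓕 ⟶ 𝓖) (h : H) :
    (cokernel a.hom).obj ⟶ (Ebar.twist (ρ h)).op ⋙ (cokernel a.hom).obj :=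
  (cokernel.desc a.hom (toTwistCokernel a h) (comp_toTwistCokernel a h)).hom

lemma π_cokernelσ {𝓕 𝓖 : EquivSheaf E ρ} (a : 𝓕 ⟶ 𝓖) (h : H) :
    (cokernel.π a.hom).hom ≫ cokernelσ a h =
      𝓖.σ h ≫ (twistPre (ρ h)).map (cokernel.π a.hom) :=
  congrArg (fun x => x.hom)
    (cokernel.π_desc a.hom (toTwistCokernel a h) (comp_toTwistCokernel a h))

/-- The cokernel of a morphism of equivariant sheaves. -/
def cokernelObj {𝓕 𝓖 : EquivSheaf E ρ} (a : 𝓕 ⟶ 𝓖) : EquivSheaf E ρ :=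
  ofEpi 𝓖 (cokernel.π a.hom) (cokernelσ a) (π_cokernelσ a)

/-- The projection to the cokernel. -/
def cokernelπ {𝓕 𝓖 : EquivSheaf E ρ} (a : 𝓕 ⟶ 𝓖) : 𝓖 ⟶ cokernelObj a where
  hom := cokernel.π a.hom
  comm h := (π_cokernelσ a h).symm

instance {𝓕 𝓖 : EquivSheaf E ρ} (a : 𝓕 ⟶ 𝓖) : Mono (kernelι a).hom :=
  inferInstanceAs (Mono (kernel.ι a.hom))

instance {𝓕 𝓖 : EquivSheaf E ρ} (a : 𝓕 ⟶ 𝓖) : Epi (cokernelπ a).hom :=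
  inferInstanceAs (Epi (cokernel.π a.hom))

lemma comp_hom {𝓕 𝓖 𝓗 : EquivSheaf E ρ} (a : 𝓕 ⟶ 𝓖) (b : 𝓖 ⟶ 𝓗) :
    (a ≫ b).hom = a.hom ≫ b.hom := rfl

instance : (forget (E := E) ρ).Faithful where
  map_injective h := hom_ext h

/-- `kernelι a` is a kernel. -/
def kernelIsLimit {𝓕 𝓖 : EquivSheaf E ρ} (a : 𝓕 ⟶ 𝓖) :
    IsLimit (KernelFork.ofι (kernelι a) (hom_ext (kernel.condition a.hom))) :=
  KernelFork.IsLimit.ofι _ _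
    (fun b hb => liftHom (kernelι a) b (kernel.lift a.hom b.hom (congrArg Hom.hom hb))
      (kernel.lift_ι _ _ _))
    (fun b hb => hom_ext (kernel.lift_ι _ _ _))
    (fun b hb m hm => hom_ext (by
      rw [← cancel_mono (kernelι a).hom, ← comp_hom, hm]
      exact (kernel.lift_ι _ _ _).symm))

/-- `cokernelπ a` is a cokernel. -/
def cokernelIsColimit {𝓕 𝓖 : EquivSheaf E ρ} (a : 𝓕 ⟶ 𝓖) :
    IsColimit (CokernelCofork.ofπ (cokernelπ a) (hom_ext (cokernel.condition a.hom))) :=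
  CokernelCofork.IsColimit.ofπ _ _
    (fun b hb => descHom (cokernelπ a) b (cokernel.desc a.hom b.hom (congrArg Hom.hom hb))
      (cokernel.π_desc _ _ _))
    (fun b hb => hom_ext (cokernel.π_desc _ _ _))
    (fun b hb m hm => hom_ext (by
      rw [← cancel_epi (cokernelπ a).hom, ← comp_hom, hm]
      exact (cokernel.π_desc _ _ _).symm))

instance : HasKernels (EquivSheaf E ρ) where
  has_limit a := ⟨⟨_, kernelIsLimit a⟩⟩

instance : HasCokernels (EquivSheaf E ρ) where
  has_colimit a := ⟨⟨_, cokernelIsColimit a⟩⟩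

lemma mono_hom {𝓕 𝓖 : EquivSheaf E ρ} (a : 𝓕 ⟶ 𝓖) [Mono a] : Mono a.hom := by
  have h : kernelι a = 0 := by
    rw [← cancel_mono a, zero_comp]
    exact hom_ext (kernel.condition a.hom)
  exact Preadditive.mono_of_kernel_zero (congrArg Hom.hom h)

lemma epi_hom {𝓕 𝓖 : EquivSheaf E ρ} (a : 𝓕 ⟶ 𝓖) [Epi a] : Epi a.hom := by
  have h : cokernelπ a = 0 := by
    rw [← cancel_epi a, comp_zero]
    exact hom_ext (cokernel.condition a.hom)
  exact Preadditive.epi_of_cokernel_zero (congrArg Hom.hom h)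

lemma comp_hom_app {A B C : AbSheaf k E} (a : A ⟶ B) (b : B ⟶ C) (c : A ⟶ C) (h : a ≫ b = c)
    (U : (Ebar k E)ᵒᵖ) : a.hom.app U ≫ b.hom.app U = c.hom.app U := by
  rw [← h]; rfl

variable {𝓕 𝓖 : EquivSheaf E ρ} (b : BinaryBicone 𝓕.sheaf 𝓖.sheaf)
  (hb : b.fst ≫ b.inl + b.snd ≫ b.inr = 𝟙 b.pt)

/-- The direct sum of two equivariant sheaves. -/
def biprodObj : EquivSheaf E ρ where
  sheaf := b.pt
  σ h := b.fst.hom ≫ 𝓕.σ h ≫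
      (twistPre (ρ h)).map b.inl +
    b.snd.hom ≫ 𝓖.σ h ≫
      (twistPre (ρ h)).map b.inr
  σ_one U := by
    have total : b.fst.hom.app (op U) ≫ b.inl.hom.app (op U) +
        b.snd.hom.app (op U) ≫ b.inr.hom.app (op U) = 𝟙 _ :=
      congrArg (fun x => x.hom.app (op U)) hb
    rw [← total]
    change (_ ≫ (𝓕.σ 1).app (op U) ≫ b.inl.hom.app (op ((Ebar.twist (ρ 1)).obj U)) +
      _ ≫ (𝓖.σ 1).app (op U) ≫ b.inr.hom.app (op ((Ebar.twist (ρ 1)).obj U))) ≫ _ = _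
    rw [Preadditive.add_comp]
    simp only [Category.assoc]
    rw [← b.inl.hom.naturality, ← b.inr.hom.naturality]
    have h1 := 𝓕.σ_one U
    have h2 := 𝓖.σ_one U
    congr 2
    · rw [← Category.assoc ((𝓕.σ 1).app (op U))]
      exact (congrArg (· ≫ _) h1).trans (Category.id_comp _)
    · rw [← Category.assoc ((𝓖.σ 1).app (op U))]
      exact (congrArg (· ≫ _) h2).trans (Category.id_comp _)
  σ_mul g h U := by
    change _ ≫ (𝓕.σ (g * h)).app (op U) ≫
        b.inl.hom.app (op ((Ebar.twist (ρ (g * h))).obj U)) +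
      _ ≫ (𝓖.σ (g * h)).app (op U) ≫
        b.inr.hom.app (op ((Ebar.twist (ρ (g * h))).obj U)) =
      (_ ≫ (𝓕.σ h).app (op U) ≫ b.inl.hom.app (op ((Ebar.twist (ρ h)).obj U)) +
      _ ≫ (𝓖.σ h).app (op U) ≫ b.inr.hom.app (op ((Ebar.twist (ρ h)).obj U))) ≫
      (b.fst.hom.app (op ((Ebar.twist (ρ h)).obj U)) ≫
        (𝓕.σ g).app (op ((Ebar.twist (ρ h)).obj U)) ≫
        b.inl.hom.app (op ((Ebar.twist (ρ g)).obj ((Ebar.twist (ρ h)).obj U))) +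
      b.snd.hom.app (op ((Ebar.twist (ρ h)).obj U)) ≫
        (𝓖.σ g).app (op ((Ebar.twist (ρ h)).obj U)) ≫
        b.inr.hom.app (op ((Ebar.twist (ρ g)).obj ((Ebar.twist (ρ h)).obj U)))) ≫ _
    have e1 := comp_hom_app _ _ _ (b.inl_fst)
      (op ((Ebar.twist (ρ h)).obj U))
    have e2 := comp_hom_app _ _ _ (b.inl_snd)
      (op ((Ebar.twist (ρ h)).obj U))
    have e3 := comp_hom_app _ _ _ (b.inr_fst)
      (op ((Ebar.twist (ρ h)).obj U))
    have e4 := comp_hom_app _ _ _ (b.inr_snd)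
      (op ((Ebar.twist (ρ h)).obj U))
    change _ = 𝟙 _ at e1
    change _ = 0 at e2
    change _ = 0 at e3
    change _ = 𝟙 _ at e4
    simp only [Preadditive.add_comp, Preadditive.comp_add, Category.assoc, reassoc_of% e1,
      reassoc_of% e2, reassoc_of% e3, reassoc_of% e4, zero_comp, comp_zero, add_zero, zero_add]
    rw [𝓕.σ_mul, 𝓖.σ_mul, ← b.inl.hom.naturality, ← b.inr.hom.naturality]
    simp only [Category.assoc]

/-- The first inclusion and projection, and the second ones, as equivariant morphisms. -/
def biprodBicone : BinaryBicone 𝓕 𝓖 where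
  pt := biprodObj b hb
  inl := ⟨b.inl, fun h => by
    have e1 := congrArg (fun x => x.hom) (b.inl_fst)
    have e2 := congrArg (fun x => x.hom) (b.inl_snd)
    change b.inl.hom ≫ b.fst.hom = 𝟙 _ at e1
    change b.inl.hom ≫ b.snd.hom = 0 at e2
    change _ = b.inl.hom ≫ (b.fst.hom ≫ 𝓕.σ h ≫ (twistPre (ρ h)).map b.inl +
      b.snd.hom ≫ 𝓖.σ h ≫ (twistPre (ρ h)).map b.inr)
    rw [Preadditive.comp_add, ← Category.assoc b.inl.hom b.fst.hom, e1,
      ← Category.assoc b.inl.hom b.snd.hom, e2,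
      zero_comp, add_zero, Category.id_comp]
    rfl⟩
  inr := ⟨b.inr, fun h => by
    have e1 := congrArg (fun x => x.hom) (b.inr_fst)
    have e2 := congrArg (fun x => x.hom) (b.inr_snd)
    change b.inr.hom ≫ b.fst.hom = 0 at e1
    change b.inr.hom ≫ b.snd.hom = 𝟙 _ at e2
    change _ = b.inr.hom ≫ (b.fst.hom ≫ 𝓕.σ h ≫ (twistPre (ρ h)).map b.inl +
      b.snd.hom ≫ 𝓖.σ h ≫ (twistPre (ρ h)).map b.inr)
    rw [Preadditive.comp_add, ← Category.assoc b.inr.hom b.fst.hom, e1,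
      ← Category.assoc b.inr.hom b.snd.hom, e2,
      zero_comp, zero_add, Category.id_comp]
    rfl⟩
  fst := ⟨b.fst, fun h => by
    change (b.fst.hom ≫ 𝓕.σ h ≫ (twistPre (ρ h)).map b.inl +
      b.snd.hom ≫ 𝓖.σ h ≫ (twistPre (ρ h)).map b.inr) ≫ (twistPre (ρ h)).map b.fst = _
    simp only [Preadditive.add_comp, Category.assoc, ← Functor.map_comp]
    rw [b.inl_fst, b.inr_fst, Functor.map_zero, comp_zero, comp_zero, add_zero,
      CategoryTheory.Functor.map_id]
    rfl⟩
  snd := ⟨b.snd, fun h => by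
    change (b.fst.hom ≫ 𝓕.σ h ≫ (twistPre (ρ h)).map b.inl +
      b.snd.hom ≫ 𝓖.σ h ≫ (twistPre (ρ h)).map b.inr) ≫ (twistPre (ρ h)).map b.snd = _
    simp only [Preadditive.add_comp, Category.assoc, ← Functor.map_comp]
    rw [b.inl_snd, b.inr_snd, Functor.map_zero, comp_zero, comp_zero, zero_add,
      CategoryTheory.Functor.map_id]
    rfl⟩
  inl_fst := hom_ext b.inl_fst
  inl_snd := hom_ext b.inl_snd
  inr_fst := hom_ext b.inr_fst
  inr_snd := hom_ext b.inr_snd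

instance : HasBinaryBiproducts (EquivSheaf E ρ) where
  has_binary_biproduct 𝓕 𝓖 := HasBinaryBiproduct.mk
    ⟨biprodBicone (BinaryBiproduct.bicone 𝓕.sheaf 𝓖.sheaf) biprod.total,
      isBinaryBilimitOfTotal _ (hom_ext biprod.total)⟩

instance : IsNormalMonoCategory (EquivSheaf E ρ) where
  normalMonoOfMono {𝓕 𝓖} a _ := by
    have := mono_hom a
    refine ⟨⟨_, cokernelπ a, hom_ext (cokernel.condition a.hom), ?_⟩⟩
    refine KernelFork.IsLimit.ofι _ _
      (fun b hb => liftHom a b (Abelian.monoLift a.hom b.hom (congrArg Hom.hom hb))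
        (Abelian.monoLift_comp _ _ _))
      (fun b hb => hom_ext (Abelian.monoLift_comp _ _ _))
      (fun b hb m hm => hom_ext ?_)
    rw [← cancel_mono a.hom, ← comp_hom, hm]
    exact (Abelian.monoLift_comp _ _ _).symm

instance : IsNormalEpiCategory (EquivSheaf E ρ) where
  normalEpiOfEpi {𝓕 𝓖} a _ := by
    have := epi_hom a
    refine ⟨⟨_, kernelι a, hom_ext (kernel.condition a.hom), ?_⟩⟩
    refine CokernelCofork.IsColimit.ofπ _ _
      (fun b hb => descHom a b (Abelian.epiDesc a.hom b.hom (congrArg Hom.hom hb))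
        (Abelian.comp_epiDesc _ _ _))
      (fun b hb => hom_ext (Abelian.comp_epiDesc _ _ _))
      (fun b hb m hm => hom_ext ?_)
    rw [← cancel_epi a.hom, ← comp_hom, hm]
    exact (Abelian.comp_epiDesc _ _ _).symm

instance : HasFiniteProducts (EquivSheaf E ρ) :=
  have : HasTerminal (EquivSheaf E ρ) := HasZeroObject.hasTerminal
  hasFiniteProducts_of_has_binary_and_terminal

instance : Abelian (EquivSheaf E ρ) where

instance : (forget (E := E) ρ).PreservesHomology where
  preservesKernels _ _ a := preservesLimit_of_preserves_limit_cone (kernelIsLimit a) <|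
    (KernelFork.isLimitMapConeEquiv _ (forget ρ)).symm (kernelIsKernel a.hom)
  preservesCokernels _ _ a := preservesColimit_of_preserves_colimit_cocone
    (cokernelIsColimit a) <|
      (CokernelCofork.isColimitMapCoconeEquiv _ (forget ρ)).symm (cokernelIsCokernel a.hom)

end EquivSheaf
end
end WeilEtale

namespace WeilEtale

noncomputable section

section Galois

variable {F k : Type u} [Field F] [Fintype F] [Field k] [Algebra F k] [IsAlgClosure F k]

lemma frob_pow_apply (n : ℕ) (x : k) : (frob F k ^ n) x = x ^ Fintype.card F ^ n := by
  have : Algebra.IsAlgebraic F k := IsAlgClosure.isAlgebraic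
  induction n with
  | zero => simp
  | succ n ih =>
    rw [pow_succ', AlgEquiv.mul_apply, ih, frob, FiniteField.coe_frobeniusAlgEquivOfAlgebraic, pow_succ, pow_mul]

lemma mem_levelField {m : ℕ} {x : k} :
    x ∈ levelField F k m ↔ x ^ Fintype.card F ^ m = x := by
  rw [levelField, IntermediateField.mem_fixedField_iff, ← frob_pow_apply]
  constructor
  · exact fun h => h _ (Subgroup.mem_zpowers _)
  · rintro h _ ⟨n, rfl⟩
    have h' : frob F k ^ m ∈ MulAction.stabilizer Gal(k/F) x := h
    exact zpow_mem h' n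

open Polynomial in
lemma card_levelField {m : ℕ} (hm : 0 < m) :
    (levelField F k m : Set k).ncard = Fintype.card F ^ m ∧ (levelField F k m : Set k).Finite := by
  have : IsAlgClosed k := IsAlgClosure.isAlgClosed F
  have hq : 1 < Fintype.card F ^ m := Nat.one_lt_pow hm.ne' Fintype.one_lt_card
  obtain ⟨p, hp⟩ := CharP.exists k
  have hpp : p ∣ Fintype.card F ^ m := by
    rw [← CharP.cast_eq_zero_iff k p]
    have := congrArg (algebraMap F k) (FiniteField.cast_card_eq_zero F)
    simp only [map_natCast, map_zero] at this
    rw [Nat.cast_pow, this, zero_pow hm.ne']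
  have hs : (X ^ Fintype.card F ^ m - X : k[X]).rootSet k = (levelField F k m : Set k) := by
    ext x
    rw [mem_rootSet, SetLike.mem_coe, mem_levelField]
    simp [FiniteField.X_pow_card_sub_X_ne_zero k hq, sub_eq_zero]
  rw [← hs]
  refine ⟨?_, rootSet_finite _ _⟩
  have h1 := card_rootSet_eq_natDegree (K := k)
    (galois_poly_separable (K := k) p (Fintype.card F ^ m) hpp)
    (IsAlgClosed.splits _)
  rw [FiniteField.X_pow_card_sub_X_natDegree_eq k hq] at h1
  exact (Set.ncard_eq_toFinset_card' _).trans ((Set.toFinset_card _).trans h1)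

lemma finiteDimensional_levelField {m : ℕ} (hm : 0 < m) :
    FiniteDimensional F (levelField F k m) := by
  have : Finite (levelField F k m) := (card_levelField hm).2
  exact Module.Finite.of_finite

open Polynomial in
lemma dvd_of_frob_zpow_mem {m : ℕ} (hm : 0 < m) {b : ℤ}
    (hb : frob F k ^ b ∈ (levelField F k m).fixingSubgroup) : (m : ℤ) ∣ b := by
  by_contra hd
  have hm' : frob F k ^ m ∈ (levelField F k m).fixingSubgroup := fun x => by
    change (frob F k ^ m) x = x
    rw [frob_pow_apply]
    exact mem_levelField.1 x.2
  obtain ⟨r, hr⟩ := Int.eq_ofNat_of_zero_le (Int.emod_nonneg b (by omega : (m : ℤ) ≠ 0))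
  have hr0 : 0 < r := by
    by_contra h
    exact hd (Int.dvd_of_emod_eq_zero (by omega))
  have hrm : r < m := by
    have := Int.emod_lt_of_pos b (by omega : (0 : ℤ) < m)
    omega
  have h1 : frob F k ^ r ∈ (levelField F k m).fixingSubgroup := by
    have h2 : b = r + m * (b / m) := by
      have := Int.emod_add_mul_ediv b m
      omega
    rw [h2, zpow_add, zpow_mul, zpow_natCast, zpow_natCast] at hb
    exact (Subgroup.mul_mem_cancel_right _ (zpow_mem hm' _)).1 hb
  have h3 : (levelField F k m : Set k) ⊆ levelField F k r := fun x hx => by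
    rw [SetLike.mem_coe, mem_levelField, ← frob_pow_apply]
    exact h1 ⟨x, hx⟩
  have h4 := Set.ncard_le_ncard h3 (card_levelField hr0).2
  rw [(card_levelField hm).1, (card_levelField hr0).1] at h4
  exact absurd h4 (not_le.2 (Nat.pow_lt_pow_right Fintype.one_lt_card hrm))

lemma frob_pow_mem_levelField (m : ℕ) :
    frob F k ^ m ∈ (levelField F k m).fixingSubgroup := fun x => by
  change (frob F k ^ m) x = x
  rw [frob_pow_apply]
  exact mem_levelField.1 x.2

lemma frob_zpow_injective : Function.Injective fun n : ℤ => frob F k ^ n := by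
  intro a b h
  have h1 : frob F k ^ (a - b) = 1 := by
    rw [zpow_sub]
    exact mul_inv_eq_one.2 h
  have h2 : (((a - b).natAbs + 1 : ℕ) : ℤ) ∣ a - b := by
    refine dvd_of_frob_zpow_mem (F := F) (k := k) (Nat.succ_pos _) ?_
    rw [h1]
    exact one_mem _
  by_contra hab
  have := Int.natAbs_dvd_natAbs.2 h2
  have := Nat.le_of_dvd (by omega) this
  omega

lemma exists_frob_zpow_mem (g : Gal(k/F)) {m : ℕ} (hm : 0 < m) :
    ∃ a : ℤ, g * (frob F k ^ a)⁻¹ ∈ (levelField F k m).fixingSubgroup := by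
  have : Algebra.IsAlgebraic F k := IsAlgClosure.isAlgebraic
  have := finiteDimensional_levelField (F := F) (k := k) hm
  have : Finite (levelField F k m) := (card_levelField hm).2
  obtain ⟨n, hn⟩ := (FiniteField.bijective_frobeniusAlgHom_pow F (levelField F k m)).2
    (g.restrictNormal (levelField F k m) : levelField F k m →ₐ[F] levelField F k m)
  refine ⟨n, ?_⟩
  rw [gal_mul_comm, zpow_natCast]
  intro x
  change (frob F k ^ (n : ℕ))⁻¹ (g x) = x
  have h1 : g x = (frob F k ^ (n : ℕ)) x := by
    have h2 := AlgEquiv.restrictNormal_commutes g (levelField F k m) x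
    refine h2.symm.trans ?_
    have h3 := congrArg (algebraMap (levelField F k m) k) (DFunLike.congr_fun hn x)
    rw [frob_pow_apply]
    refine h3.symm.trans ?_
    simp [AlgHom.coe_pow, FiniteField.coe_frobeniusAlgHom, pow_iterate]
  rw [h1]
  exact (frob F k ^ (n : ℕ)).symm_apply_apply _

lemma exists_le_levelField (K : IntermediateField F k) [FiniteDimensional F K] :
    ∃ m : ℕ, 0 < m ∧ frob F k ^ m ∈ K.fixingSubgroup := by
  have : Finite K := Module.finite_of_finite F
  refine ⟨Module.finrank F K, Module.finrank_pos, fun x => ?_⟩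
  change (frob F k ^ _) (x : k) = x
  have : Fintype K := Fintype.ofFinite K
  rw [frob_pow_apply, ← Module.card_eq_pow_finrank (K := F) (V := K)]
  exact_mod_cast congrArg (algebraMap K k) (FiniteField.pow_card x)

lemma pow_mul_mem {K : IntermediateField F k} {m : ℕ} (h : frob F k ^ m ∈ K.fixingSubgroup)
    (n : ℕ) : frob F k ^ (m * n) ∈ K.fixingSubgroup := by
  rw [pow_mul]; exact pow_mem h n

lemma fixingSubgroup_levelField_le {K : IntermediateField F k} {m : ℕ}
    (hm : frob F k ^ m ∈ K.fixingSubgroup) :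
    (levelField F k m).fixingSubgroup ≤ K.fixingSubgroup :=
  IntermediateField.fixingSubgroup_antitone (le_levelField hm)

end Galois
end
end WeilEtale

namespace WeilEtale

noncomputable section

section Levels

variable {F k : Type u} [Field F] [Field k] [Algebra F k] {K : IntermediateField F k}

variable (K) in
/-- The subfields of `k` that contain `K` and are finite over `F`. -/
abbrev FinExt := {L : IntermediateField F k // K ≤ L ∧ FiniteDimensional F L}

/-- A finite subextension containing `K` and `x`. -/
def FinExt.adjoin [Algebra.IsAlgebraic F k] [FiniteDimensional F K] (x : k) : FinExt K :=
  ⟨K ⊔ IntermediateField.adjoin F {x}, le_sup_left, by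
    have : FiniteDimensional F (IntermediateField.adjoin F {x}) :=
      IntermediateField.adjoin.finiteDimensional (Algebra.IsIntegral.isIntegral x)
    infer_instance⟩

lemma FinExt.mem_adjoin [Algebra.IsAlgebraic F k] [FiniteDimensional F K] (x : k) :
    x ∈ (FinExt.adjoin (K := K) x).1 :=
  (le_sup_right : _ ≤ K ⊔ _) (IntermediateField.mem_adjoin_simple_self F x)

instance : IsDirectedOrder (FinExt K) where
  directed L L' := ⟨⟨L.1 ⊔ L'.1, L.2.1.trans le_sup_left, by
    have := L.2.2
    have := L'.2.2
    infer_instance⟩, le_sup_left (a := L.1), le_sup_right (a := L.1)⟩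

instance [h : FiniteDimensional F K] : Nonempty (FinExt K) := ⟨⟨K, le_rfl, h⟩⟩

variable (K) in
/-- The finite subextensions as a diagram of rings. -/
@[simps]
def fieldDiagram : FinExt K ⥤ CommRingCat.{u} where
  obj L := .of L.1
  map {L L'} h := CommRingCat.ofHom (IntermediateField.inclusion (leOfHom h) : L.1 →+* L'.1)
  map_id _ := rfl
  map_comp _ _ := rfl

variable (K) in
/-- `k` as the union of the finite subextensions. -/
@[simps]
def fieldCocone : Cocone (fieldDiagram K) where
  pt := .of k
  ι := { app L := CommRingCat.ofHom (algebraMap L.1 k) }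

lemma fieldCocone_glue {c : Cocone (fieldDiagram K)} {L L' : FinExt K} (x : L.1) (y : L'.1)
    (h : (x : k) = y) : (c.ι.app L).hom x = (c.ι.app L').hom y := by
  obtain ⟨M, h1, h2⟩ := exists_ge_ge L L'
  have e1 := congrArg (fun φ => φ.hom x) (c.w (homOfLE h1))
  have e2 := congrArg (fun φ => φ.hom y) (c.w (homOfLE h2))
  refine e1.symm.trans (Eq.trans ?_ e2)
  exact congrArg (c.ι.app M).hom (Subtype.ext h)

section Glue

variable [Algebra.IsAlgebraic F k] [FiniteDimensional F K] {B : Type*} [CommRing B]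

/-- The ring homomorphism from `k` given by compatible homomorphisms from the finite
subextensions. -/
def FinExt.glue (φ : ∀ L : FinExt K, L.1 →+* B)
    (hφ : ∀ (L L' : FinExt K) (x : L.1) (y : L'.1), (x : k) = y → φ L x = φ L' y) : k →+* B where
  toFun x := φ (FinExt.adjoin x) ⟨x, FinExt.mem_adjoin x⟩
  map_one' := map_one (φ (FinExt.adjoin 1))
  map_zero' := map_zero (φ (FinExt.adjoin 0))
  map_mul' x y := by
    obtain ⟨M, h1, h2⟩ := exists_ge_ge (FinExt.adjoin (K := K) x) (FinExt.adjoin y)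
    rw [hφ (FinExt.adjoin x) M ⟨x, FinExt.mem_adjoin x⟩ ⟨x, h1 (FinExt.mem_adjoin x)⟩ rfl,
      hφ (FinExt.adjoin y) M ⟨y, FinExt.mem_adjoin y⟩ ⟨y, h2 (FinExt.mem_adjoin y)⟩ rfl, ← map_mul]
    exact hφ _ _ _ _ rfl
  map_add' x y := by
    obtain ⟨M, h1, h2⟩ := exists_ge_ge (FinExt.adjoin (K := K) x) (FinExt.adjoin y)
    rw [hφ (FinExt.adjoin x) M ⟨x, FinExt.mem_adjoin x⟩ ⟨x, h1 (FinExt.mem_adjoin x)⟩ rfl,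
      hφ (FinExt.adjoin y) M ⟨y, FinExt.mem_adjoin y⟩ ⟨y, h2 (FinExt.mem_adjoin y)⟩ rfl, ← map_add]
    exact hφ _ _ _ _ rfl

end Glue

variable (K) in
/-- `k` is the colimit of the finite subextensions. -/
def fieldCoconeIsColimit [Algebra.IsAlgebraic F k] [FiniteDimensional F K] :
    IsColimit (fieldCocone K) where
  desc c := CommRingCat.ofHom (FinExt.glue (fun L => (c.ι.app L).hom)
    fun _ _ _ _ h => fieldCocone_glue _ _ h)
  fac _ _ := CommRingCat.hom_ext (RingHom.ext fun _ => fieldCocone_glue _ _ rfl)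
  uniq _ _ hm := CommRingCat.hom_ext (RingHom.ext fun x : k =>
    congrArg (fun φ => φ.hom (⟨x, FinExt.mem_adjoin x⟩ : (FinExt.adjoin (K := K) x).1))
      (hm (FinExt.adjoin x)))

variable (K) in
/-- `Spec k` is the limit of the spectra of the finite subextensions. -/
def specConeIsLimit [Algebra.IsAlgebraic F k] [FiniteDimensional F K] :
    IsLimit (Scheme.Spec.mapCone (fieldCocone K).op) :=
  isLimitOfPreserves Scheme.Spec (fieldCoconeIsColimit K).op

/-- The projection `Spec k ⟶ Spec L`. -/
abbrev specTo (L : IntermediateField F k) : Spec (.of k) ⟶ Spec (.of L) :=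
  Spec.map (CommRingCat.ofHom (algebraMap L k))

/-- The projection `Spec L' ⟶ Spec L`. -/
abbrev specIncl {L L' : IntermediateField F k} (h : L ≤ L') : Spec (.of L') ⟶ Spec (.of L) :=
  Spec.map (CommRingCat.ofHom (IntermediateField.inclusion h : L →+* L'))

lemma specTo_specIncl {L L' : IntermediateField F k} (h : L ≤ L') :
    specTo L' ≫ specIncl h = specTo L := by
  rw [specTo, ← Spec.map_comp]; rfl

lemma specIncl_specIncl {L L' L'' : IntermediateField F k} (h : L ≤ L') (h' : L' ≤ L'') :
    specIncl h' ≫ specIncl h = specIncl (h.trans h') := by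
  rw [specIncl, ← Spec.map_comp]; rfl

variable {Y S : Scheme.{u}} (f : Y ⟶ S) (s : Spec (.of K) ⟶ S)

/-- The base changes of `Y` to the finite subextensions. -/
def levelDiagram : (FinExt K)ᵒᵖ ⥤ Scheme.{u} where
  obj L := pullback f (specIncl L.unop.2.1 ≫ s)
  map {L L'} h := pullback.lift (pullback.fst _ _)
    (pullback.snd _ _ ≫ specIncl (leOfHom h.unop)) (by
      rw [pullback.condition, Category.assoc, ← Category.assoc (specIncl _) _ s,
        specIncl_specIncl])
  map_id L := by
    apply pullback.hom_ext
    · exact (pullback.lift_fst _ _ _).trans (Category.id_comp _).symm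
    · rw [pullback.lift_snd, Category.id_comp]
      exact (congrArg (_ ≫ ·) (Spec.map_id _)).trans (Category.comp_id _)
  map_comp {L L' L''} h h' := by
    apply pullback.hom_ext
    · rw [pullback.lift_fst, Category.assoc, pullback.lift_fst, pullback.lift_fst]
    · rw [pullback.lift_snd, Category.assoc, pullback.lift_snd, ← Category.assoc,
        pullback.lift_snd, Category.assoc, specIncl_specIncl]

/-- The projection of the base change to `Y`. -/
def levelFst (L : (FinExt K)ᵒᵖ) : (levelDiagram f s).obj L ⟶ Y := pullback.fst _ _

/-- The projection of the base change to the finite subextension. -/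
def levelSnd (L : (FinExt K)ᵒᵖ) : (levelDiagram f s).obj L ⟶ Spec (.of L.unop.1) :=
  pullback.snd _ _

variable {f s}

lemma isPullback_level (L : (FinExt K)ᵒᵖ) :
    IsPullback (levelFst f s L) (levelSnd f s L) f (specIncl L.unop.2.1 ≫ s) :=
  .of_hasPullback _ _

lemma level_hom_ext {L : (FinExt K)ᵒᵖ} {T : Scheme.{u}} {a b : T ⟶ (levelDiagram f s).obj L}
    (h1 : a ≫ levelFst f s L = b ≫ levelFst f s L) (h2 : a ≫ levelSnd f s L = b ≫ levelSnd f s L) :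
    a = b :=
  (isPullback_level L).hom_ext h1 h2

lemma levelDiagram_map_fst {L L' : (FinExt K)ᵒᵖ} (a : L ⟶ L') :
    (levelDiagram f s).map a ≫ levelFst f s L' = levelFst f s L :=
  pullback.lift_fst _ _ _

lemma levelDiagram_map_snd {L L' : (FinExt K)ᵒᵖ} (a : L ⟶ L') :
    (levelDiagram f s).map a ≫ levelSnd f s L' = levelSnd f s L ≫ specIncl (leOfHom a.unop) :=
  pullback.lift_snd _ _ _

variable {P : Scheme.{u}} {p : P ⟶ Y} {q : P ⟶ Spec (.of k)}
  (h : IsPullback p q f (specTo K ≫ s))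

/-- The projection of the base change to `k` to the base change to `L`. -/
def levelProj (L : (FinExt K)ᵒᵖ) : P ⟶ (levelDiagram f s).obj L :=
  (isPullback_level L).lift p (q ≫ specTo L.unop.1) (by
    rw [h.w, Category.assoc, ← Category.assoc (specTo _), specTo_specIncl])

lemma levelProj_fst (L : (FinExt K)ᵒᵖ) : levelProj h L ≫ levelFst f s L = p :=
  (isPullback_level L).lift_fst _ _ _

lemma levelProj_snd (L : (FinExt K)ᵒᵖ) : levelProj h L ≫ levelSnd f s L = q ≫ specTo L.unop.1 :=
  (isPullback_level L).lift_snd _ _ _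

lemma levelProj_map {L L' : (FinExt K)ᵒᵖ} (a : L ⟶ L') :
    levelProj h L ≫ (levelDiagram f s).map a = levelProj h L' := by
  apply level_hom_ext
  · rw [levelProj_fst, Category.assoc, levelDiagram_map_fst, levelProj_fst]
  · rw [levelProj_snd, Category.assoc, levelDiagram_map_snd, ← Category.assoc,
      levelProj_snd, Category.assoc, specTo_specIncl]

lemma isPullback_levelProj (L : (FinExt K)ᵒᵖ) :
    IsPullback (levelProj h L) q (levelSnd f s L) (specTo L.unop.1) := by
  refine .of_right (h₁₂ := levelFst f s L) (v₁₃ := f) (h₂₂ := specIncl L.unop.2.1 ≫ s) ?_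
    (levelProj_snd h L) (isPullback_level L)
  rw [← Category.assoc, specTo_specIncl, levelProj_fst]
  exact h

/-- The base change to `k` as a cone over the base changes to the finite subextensions. -/
def levelCone : Cone (levelDiagram f s) where
  pt := P
  π :=
    { app L := levelProj h L
      naturality _ _ a := (Category.id_comp _).trans (levelProj_map h a).symm }

lemma levelConeSnd_aux (c : Cone (levelDiagram f s)) {L L' : (FinExt K)ᵒᵖ} (a : L ⟶ L') :
    c.π.app L' ≫ levelSnd f s L' = (c.π.app L ≫ levelSnd f s L) ≫ specIncl (leOfHom a.unop) := by
  have e := c.w a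
  rw [← e, Category.assoc, levelDiagram_map_snd, Category.assoc]

/-- The cone over the spectra of the finite subextensions given by a cone over `levelDiagram`. -/
def levelConeSnd (c : Cone (levelDiagram f s)) : Cone ((fieldDiagram K).op ⋙ Scheme.Spec) where
  pt := c.pt
  π :=
    { app L := c.π.app L ≫ levelSnd f s L
      naturality _ _ a := (Category.id_comp _).trans (levelConeSnd_aux c a) }

lemma levelCone_fst_eq (c : Cone (levelDiagram f s)) (L L' : (FinExt K)ᵒᵖ) :
    c.π.app L ≫ levelFst f s L = c.π.app L' ≫ levelFst f s L' := by
  obtain ⟨M, h1, h2⟩ := exists_ge_ge L.unop L'.unop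
  have e1 := c.w (homOfLE h1).op
  have e2 := c.w (homOfLE h2).op
  change _ = c.π.app L at e1
  change _ = c.π.app L' at e2
  rw [← e1, ← e2, Category.assoc, Category.assoc]
  exact congrArg (_ ≫ ·) ((levelDiagram_map_fst _).trans (levelDiagram_map_fst _).symm)

section Limit

variable [Algebra.IsAlgebraic F k] [FiniteDimensional F K]

lemma spec_hom_ext {T : Scheme.{u}} {a b : T ⟶ Spec (.of k)}
    (h : ∀ L : FinExt K, a ≫ specTo L.1 = b ≫ specTo L.1) : a = b :=
  (specConeIsLimit K).hom_ext fun L => h L.unop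

/-- The morphism to `Spec k` given by a cone over `levelDiagram`. -/
def levelLiftSnd (c : Cone (levelDiagram f s)) : c.pt ⟶ Spec (.of k) :=
  (specConeIsLimit K).lift (levelConeSnd c)

lemma levelLiftSnd_specTo (c : Cone (levelDiagram f s)) (L : (FinExt K)ᵒᵖ) :
    levelLiftSnd c ≫ specTo L.unop.1 = c.π.app L ≫ levelSnd f s L :=
  (specConeIsLimit K).fac (levelConeSnd c) L

lemma levelCone_condition (c : Cone (levelDiagram f s)) (L : (FinExt K)ᵒᵖ) :
    (c.π.app L ≫ levelFst f s L) ≫ f = levelLiftSnd c ≫ specTo K ≫ s := by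
  rw [Category.assoc, (isPullback_level L).w, ← Category.assoc (c.π.app L),
    ← levelLiftSnd_specTo, Category.assoc, ← Category.assoc (specTo _), specTo_specIncl]

lemma level_lift_uniq {T : Scheme.{u}} {a b : T ⟶ P} (L₀ : (FinExt K)ᵒᵖ)
    (hab : ∀ L : (FinExt K)ᵒᵖ, a ≫ levelProj h L = b ≫ levelProj h L) : a = b := by
  apply h.hom_ext
  · rw [← levelProj_fst h L₀, ← Category.assoc, hab, Category.assoc]
  · refine spec_hom_ext (K := K) fun L => ?_
    rw [Category.assoc, ← levelProj_snd h (op L), ← Category.assoc, hab, Category.assoc,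
      Category.assoc, levelProj_snd]

lemma level_lift_fac (c : Cone (levelDiagram f s)) (L L₀ : (FinExt K)ᵒᵖ) :
    h.lift (c.π.app L₀ ≫ levelFst f s L₀) (levelLiftSnd c) (levelCone_condition c _) ≫
      levelProj h L = c.π.app L := by
  apply level_hom_ext
  · rw [Category.assoc, levelProj_fst, h.lift_fst]
    exact levelCone_fst_eq _ _ _
  · rw [Category.assoc, levelProj_snd, ← Category.assoc, h.lift_snd]
    exact levelLiftSnd_specTo c L

/-- The base change to `k` is the limit of the base changes to the finite subextensions. -/
def levelConeIsLimit : IsLimit (levelCone h) where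
  lift c := h.lift (c.π.app (op (Classical.arbitrary _)) ≫ levelFst f s _)
    (levelLiftSnd c) (levelCone_condition c _)
  fac c L := level_lift_fac h c L _
  uniq c _ hm := level_lift_uniq h (op (Classical.arbitrary _)) fun L =>
    (hm L).trans (level_lift_fac h c L (op (Classical.arbitrary _))).symm

end Limit

section Affine

variable [IsAffine S]

instance isAffineHom_levelFst (L : (FinExt K)ᵒᵖ) : IsAffineHom (levelFst f s L) := by
  have : IsAffineHom (specIncl L.unop.2.1 ≫ s) := isAffineHom_of_isAffine _
  exact MorphismProperty.of_isPullback (isPullback_level L).flip this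

instance isAffineHom_levelDiagram_map {L L' : (FinExt K)ᵒᵖ} (a : L ⟶ L') :
    IsAffineHom ((levelDiagram f s).map a) := by
  have : IsAffineHom ((levelDiagram f s).map a ≫ levelFst f s L') := by
    rw [levelDiagram_map_fst]
    infer_instance
  exact .of_comp _ (levelFst f s L')

instance [CompactSpace Y] (L : (FinExt K)ᵒᵖ) : CompactSpace ((levelDiagram f s).obj L) :=
  QuasiCompact.compactSpace_of_compactSpace (levelFst f s L)

instance [QuasiSeparatedSpace Y] (L : (FinExt K)ᵒᵖ) :
    QuasiSeparatedSpace ((levelDiagram f s).obj L) :=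
  quasiSeparatedSpace_of_quasiSeparated (levelFst f s L)

end Affine

end Levels

end

end WeilEtale

namespace WeilEtale

noncomputable section

section Descent

variable {F k : Type u} [Field F] [Field k] [Algebra F k] [Algebra.IsAlgebraic F k]
  {K : IntermediateField F k} [FiniteDimensional F K]
  {Y S : Scheme.{u}} {f : Y ⟶ S} {s : Spec (.of K) ⟶ S} {P : Scheme.{u}} {p : P ⟶ Y}
  {q : P ⟶ Spec (.of k)} (h : IsPullback p q f (specTo K ≫ s)) [IsAffine S]

/-- A quasi-compact open subscheme of a base change to `k` is defined over a finite
subextension. -/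
lemma exists_isPullback_of_isOpenImmersion {U : Scheme.{u}} (j : U ⟶ P) [IsOpenImmersion j]
    [CompactSpace U] :
    ∃ (L : (FinExt K)ᵒᵖ) (V : ((levelDiagram f s).obj L).Opens) (r : U ⟶ V),
      IsCompact (V : Set ((levelDiagram f s).obj L)) ∧ r ≫ V.ι = j ≫ levelProj h L ∧
      IsPullback r (j ≫ q) (V.ι ≫ levelSnd f s L) (specTo L.unop.1) := by
  obtain ⟨L, V, hV, hVj⟩ := exists_preimage_eq (levelDiagram f s) (levelCone h)
    (levelConeIsLimit h) j.opensRange (isCompact_range j.continuous)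
  replace hVj : levelProj h L ⁻¹ᵁ V = j.opensRange := hVj
  have hr : Set.range (j ≫ levelProj h L) ⊆ Set.range V.ι := by
    rintro _ ⟨x, rfl⟩
    have hx : j x ∈ j.opensRange := ⟨x, rfl⟩
    rw [← hVj] at hx
    rw [Scheme.Opens.range_ι]
    exact hx
  refine ⟨L, V, IsOpenImmersion.lift V.ι (j ≫ levelProj h L) hr, hV,
    IsOpenImmersion.lift_fac _ _ _, ?_⟩
  have h1 := IsOpenImmersion.isPullback (IsOpenImmersion.lift V.ι (j ≫ levelProj h L) hr) j V.ι
    (levelProj h L) (IsOpenImmersion.lift_fac _ _ _).symm (by rw [Scheme.Opens.opensRange_ι, hVj])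
  exact (h1.flip.paste_horiz (isPullback_levelProj h L).flip).flip

/-- A morphism from a base change to `k` to a scheme locally of finite presentation factors
through a finite subextension. -/
lemma exists_levelProj_comp_eq [CompactSpace Y] [QuasiSeparatedSpace Y] {T B : Scheme.{u}}
    (π : T ⟶ B) [LocallyOfFinitePresentation π] (b : S ⟶ B) (a : P ⟶ T)
    (hab : a ≫ π = p ≫ f ≫ b) :
    ∃ (L : (FinExt K)ᵒᵖ) (r : (levelDiagram f s).obj L ⟶ T), levelProj h L ≫ r = a := by
  let t : levelDiagram f s ⟶ (Functor.const _).obj B :=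
    { app L := levelFst f s L ≫ f ≫ b
      naturality L L' x := by
        refine Eq.trans ?_ (Category.comp_id _).symm
        rw [← Category.assoc, levelDiagram_map_fst] }
  obtain ⟨L, r, hr, -⟩ := Scheme.exists_π_app_comp_eq_of_locallyOfFinitePresentation
    (levelDiagram f s) t π (levelCone h) (levelConeIsLimit h) a (by
      ext L : 2
      change levelProj h L ≫ levelFst f s L ≫ f ≫ b = a ≫ π
      rw [← Category.assoc, levelProj_fst, hab])
  exact ⟨L, r, hr⟩

end Descent

section Models

variable {F k : Type u} [Field F] [Fintype F] [Field k] [Algebra F k] [IsAlgClosure F k]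
  {X : Over (Spec (.of F))} {E : SchemeSubcategory X}

variable (F) in
/-- The structure morphism `Spec K ⟶ Spec F`. -/
abbrev specBot (K : IntermediateField F k) : Spec (.of K) ⟶ Spec (.of F) :=
  Spec.map (CommRingCat.ofHom (algebraMap F K))

lemma specTo_specBot (K : IntermediateField F k) : specTo K ≫ specBot F K = specAlg F k := by
  rw [specTo, ← Spec.map_comp]; rfl

lemma specIncl_specBot {K L : IntermediateField F k} (h : K ≤ L) :
    specIncl h ≫ specBot F K = specBot F L := by
  rw [specIncl, ← Spec.map_comp]; rfl

lemma galSpec_specTo {g : Gal(k/F)} {K : IntermediateField F k} (hg : g ∈ K.fixingSubgroup) :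
    galSpec g ≫ specTo K = specTo K := by
  rw [galSpec, specTo, ← Spec.map_comp, ← CommRingCat.ofHom_comp]
  congr 2
  ext x
  exact hg x

instance compactSpace_sch (U : Ebar k E) : CompactSpace U.sch := by
  obtain ⟨Y, hY, j, hj, -, -, y, hy⟩ := U.property
  have := E.quasiCompact Y hY
  have : CompactSpace (geom k (Over.mk (Y.hom ≫ X.hom))) := by
    have : QuasiCompact (Over.mk (Y.hom ≫ X.hom)).hom := this
    exact QuasiCompact.compactSpace_of_compactSpace (pullback.snd _ (specAlg F k))
  have h1 : IsCompact (Set.range j) := by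
    rw [hy]
    exact isClosed_connectedComponent.isCompact
  rw [← isCompact_univ_iff, j.isOpenEmbedding.isInducing.isCompact_iff, Set.image_univ]
  exact h1

/-- Every object of `\bar ℰ` has a model over a finite extension of `F`. -/
lemma exists_model (U : Ebar k E) :
    ∃ (K : IntermediateField F k) (_ : FiniteDimensional F K), Nonempty (Model U K) := by
  have : Algebra.IsAlgebraic F k := IsAlgClosure.isAlgebraic
  obtain ⟨Y, hY, j, hj, hj1, hj2, -, -⟩ := U.property
  have := E.isSeparated Y hY
  have := E.locallyOfFiniteType Y hY
  have h : IsPullback (pullback.fst (Y.hom ≫ X.hom) (specAlg F k)) (pullback.snd _ _)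
      (Y.hom ≫ X.hom) (specTo (⊥ : IntermediateField F k) ≫ specBot F ⊥) := by
    rw [specTo_specBot]
    exact .of_hasPullback _ _
  obtain ⟨L, V, r, hV, hr, hp⟩ := exists_isPullback_of_isOpenImmersion h j
  have hL : IsPullback (levelFst (Y.hom ≫ X.hom) (specBot F ⊥) L) (levelSnd _ _ L) _ _ :=
    isPullback_level L
  have := hL.w
  have : IsSeparated (levelSnd (Y.hom ≫ X.hom) (specBot F ⊥) L) :=
    MorphismProperty.of_isPullback hL inferInstance
  have : LocallyOfFiniteType (levelSnd (Y.hom ≫ X.hom) (specBot F ⊥) L) :=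
    MorphismProperty.of_isPullback hL inferInstance
  refine ⟨L.unop.1, L.unop.2.2, ⟨{
    obj := V
    toField := V.ι ≫ levelSnd _ _ L
    toBase := V.ι ≫ levelFst _ _ L ≫ Y.hom
    w := ?_
    isSeparated := inferInstance
    locallyOfFiniteType := inferInstance
    quasiCompact := ?_
    proj := r
    proj_toBase := ?_
    isPullback := ?_ }⟩⟩
  · rw [Category.assoc, Category.assoc, Category.assoc, hL.w, specIncl_specBot]
  · have : CompactSpace V := isCompact_iff_compactSpace.1 hV
    exact (quasiCompact_iff_compactSpace (f := V.ι ≫ levelSnd _ _ L)).2 this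
  · rw [← Category.assoc, hr, Category.assoc, ← Category.assoc (levelProj h L), levelProj_fst]
    exact hj1
  · rw [← show j ≫ pullback.snd (Y.hom ≫ X.hom) (specAlg F k) = _ from hj2]
    exact hp

namespace Model

variable {U : Ebar k E} {K : IntermediateField F k} (M : Model U K)

lemma act_snd (g : Gal(k/F)) (hg : g ∈ K.fixingSubgroup) :
    M.act g hg ≫ U.str ≫ pullback.snd _ _ = (U.str ≫ pullback.snd _ _) ≫ galSpec g :=
  M.isPullback.lift_snd _ _ _

/-- A morphism from an object of `\bar ℰ` to a scheme locally of finite type over `F` is invariant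
under a small subgroup of the Galois group. -/
lemma exists_act_comp_eq [FiniteDimensional F K] {T : Scheme.{u}} (π : T ⟶ Spec (.of F))
    [LocallyOfFiniteType π] (a : U.sch ⟶ T)
    (ha : a ≫ π = (U.str ≫ pullback.snd _ _) ≫ specAlg F k) :
    ∃ (n : ℕ) (_ : 0 < n) (hn : frob F k ^ n ∈ K.fixingSubgroup),
      ∀ (y : Gal(k/F)) (hy : y ∈ (levelField F k n).fixingSubgroup),
        M.act y (fixingSubgroup_levelField_le hn hy) ≫ a = a := by
  have : Algebra.IsAlgebraic F k := IsAlgClosure.isAlgebraic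
  have : LocallyOfFinitePresentation π := LocallyOfFinitePresentation.iff_locallyOfFiniteType.2 ‹_›
  have h : IsPullback M.proj (U.str ≫ pullback.snd _ _) M.toField (specTo K ≫ 𝟙 _) := by
    rw [Category.comp_id]
    exact M.isPullback
  have := M.quasiCompact
  have := M.isSeparated
  have : CompactSpace M.obj := QuasiCompact.compactSpace_of_compactSpace M.toField
  have : QuasiSeparatedSpace M.obj := quasiSeparatedSpace_of_quasiSeparated M.toField
  obtain ⟨L, r, rfl⟩ := exists_levelProj_comp_eq h π (specBot F K) a (by
    rw [ha, ← Category.assoc M.proj, M.isPullback.w, Category.assoc _ _ (specBot F K),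
      specTo_specBot])
  have := L.unop.2.2
  obtain ⟨n, hn0, hn⟩ := exists_le_levelField L.unop.1
  refine ⟨n, hn0, IntermediateField.fixingSubgroup_antitone L.unop.2.1 hn, fun y hy => ?_⟩
  rw [← Category.assoc]
  congr 1
  apply level_hom_ext
  · rw [Category.assoc, levelProj_fst, act_proj]
  · rw [Category.assoc, levelProj_snd, ← Category.assoc, act_snd, Category.assoc _ (galSpec y),
      galSpec_specTo (fixingSubgroup_levelField_le hn hy)]

end Model

end Models

end

end WeilEtale

namespace WeilEtale

noncomputable section

section EtaleAlgebra

open TensorProduct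

variable {F k A : Type u} [Field F] [Field k] [Algebra F k] [CommRing A] [Algebra F A]

/-- The inclusion `A ⊗ L → A ⊗ k`. -/
def levelMap (A : Type u) [CommRing A] [Algebra F A] (L : IntermediateField F k) :
    A ⊗[F] L →ₐ[A] A ⊗[F] k :=
  Algebra.TensorProduct.map (AlgHom.id A A) L.val

lemma levelMap_injective (L : IntermediateField F k) : Function.Injective (levelMap A L) := by
  have h := Module.Flat.lTensor_preserves_injective_linearMap (M := A) L.val.toLinearMap
    L.val.injective
  exact h

lemma levelMap_range_mono {L L' : IntermediateField F k} (h : L ≤ L') :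
    (levelMap A L).range ≤ (levelMap A L').range := by
  rintro _ ⟨x, rfl⟩
  refine ⟨Algebra.TensorProduct.map (AlgHom.id A A) (IntermediateField.inclusion h) x, ?_⟩
  change levelMap A L' _ = levelMap A L x
  induction x with
  | zero => simp
  | add x y hx hy => simp only [map_add, hx, hy]
  | tmul a x => rfl

variable [Algebra.IsAlgebraic F k]

lemma exists_mem_levelMap_range (x : A ⊗[F] k) :
    ∃ L : IntermediateField F k, FiniteDimensional F L ∧ x ∈ (levelMap A L).range := by
  induction x with
  | zero => exact ⟨⊥, inferInstance, zero_mem _⟩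
  | add x y hx hy =>
    obtain ⟨L, hL, hx⟩ := hx
    obtain ⟨L', hL', hy⟩ := hy
    exact ⟨L ⊔ L', inferInstance, add_mem (levelMap_range_mono le_sup_left hx)
      (levelMap_range_mono le_sup_right hy)⟩
  | tmul a x =>
    exact ⟨IntermediateField.adjoin F {x},
      IntermediateField.adjoin.finiteDimensional (Algebra.IsIntegral.isIntegral x),
      a ⊗ₜ ⟨x, IntermediateField.mem_adjoin_simple_self F x⟩, rfl⟩

lemma exists_le_levelMap_range {S : Subalgebra A (A ⊗[F] k)} (hS : S.FG) :
    ∃ L : IntermediateField F k, FiniteDimensional F L ∧ S ≤ (levelMap A L).range := by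
  obtain ⟨t, rfl⟩ := hS
  simp_rw [Algebra.adjoin_le_iff]
  classical
  induction t using Finset.induction_on with
  | empty => exact ⟨⊥, inferInstance, by simp⟩
  | insert x t _ ih =>
    obtain ⟨L, hL, ht⟩ := ih
    obtain ⟨L', hL', hx⟩ := exists_mem_levelMap_range x
    refine ⟨L ⊔ L', inferInstance, ?_⟩
    rw [Finset.coe_insert, Set.insert_subset_iff]
    exact ⟨levelMap_range_mono le_sup_right hx,
      ht.trans fun _ h => levelMap_range_mono le_sup_left h⟩

lemma exists_etale_of_le_range {A C D B : Type u} [CommRing A] [CommRing C] [CommRing D]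
    [CommRing B] [Algebra A C] [Algebra A D] [Algebra D B] [Algebra.Etale A C] (φ : C →ₐ[A] D)
    (hφ : Function.Injective φ) (A₀ : Subalgebra A D) (hA₀ : A₀ ≤ φ.range) (B₀ : Type u)
    [CommRing B₀] [Algebra A₀ B₀] [Algebra.Etale A₀ B₀] (e : B ≃ₐ[D] D ⊗[A₀] B₀) :
    ∃ (B' : Type u) (_ : CommRing B') (_ : Algebra A B') (_ : Algebra.Etale A B')
      (β : B' →+* B), (∀ a, β (algebraMap A B' a) = algebraMap D B (algebraMap A D a)) ∧
      ∀ b : B, b ∈ Subring.closure (Set.range β ∪ Set.range (algebraMap D B)) := by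
  let ψ : A₀ →ₐ[A] C :=
    (AlgEquiv.ofInjective _ hφ).symm.toAlgHom.comp (Subalgebra.inclusion hA₀)
  have hψ (x : A₀) : φ (ψ x) = x :=
    congrArg Subtype.val ((AlgEquiv.ofInjective _ hφ).apply_symm_apply (Subalgebra.inclusion hA₀ x))
  let _ : Algebra A₀ C := (ψ : A₀ →+* C).toAlgebra
  have : IsScalarTower A A₀ C := .of_algebraMap_eq fun x => (ψ.commutes x).symm
  have : Algebra.Etale A (C ⊗[A₀] B₀) := Algebra.Etale.comp A C _
  let φ' : C →ₐ[A₀] D := { (φ : C →+* D) with commutes' := hψ }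
  let β : C ⊗[A₀] B₀ →ₐ[A₀] D ⊗[A₀] B₀ := Algebra.TensorProduct.map φ' (AlgHom.id _ _)
  refine ⟨C ⊗[A₀] B₀, inferInstance, inferInstance, inferInstance,
    (e.symm : _ →+* B).comp β.toRingHom, fun a => ?_, fun b => ?_⟩
  · change e.symm (φ (algebraMap A C a) ⊗ₜ 1) = _
    rw [φ.commutes]
    exact e.symm.commutes _
  · obtain ⟨b, rfl⟩ := e.symm.surjective b
    induction b with
    | zero => rw [map_zero]; exact zero_mem _
    | add x y hx hy => rw [map_add]; exact add_mem hx hy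
    | tmul d b =>
      have : d ⊗ₜ[A₀] b = (d ⊗ₜ 1) * (1 ⊗ₜ b) := by simp
      rw [this, map_mul]
      refine mul_mem (Subring.subset_closure (Or.inr ⟨d, (e.symm.commutes d).symm⟩))
        (Subring.subset_closure (Or.inl ⟨1 ⊗ₜ b, ?_⟩))
      change e.symm (φ 1 ⊗ₜ b) = _
      rw [map_one]

lemma exists_etale_of_directed {A D B : Type u} [CommRing A] [CommRing D]
    [CommRing B] [Algebra A D] [Algebra D B] [Algebra.Etale D B]
    (h : ∀ S : Subalgebra A D, S.FG → ∃ (C : Type u) (_ : CommRing C) (_ : Algebra A C)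
      (_ : Algebra.Etale A C) (φ : C →ₐ[A] D), Function.Injective φ ∧ S ≤ φ.range) :
    ∃ (B' : Type u) (_ : CommRing B') (_ : Algebra A B') (_ : Algebra.Etale A B')
      (β : B' →+* B), (∀ a, β (algebraMap A B' a) = algebraMap D B (algebraMap A D a)) ∧
      ∀ b : B, b ∈ Subring.closure (Set.range β ∪ Set.range (algebraMap D B)) := by
  obtain ⟨A₀, B₀, _, _, hfg, _, ⟨e⟩⟩ := Algebra.Etale.exists_subalgebra_fg A D B
  obtain ⟨C, _, _, _, φ, hφ, hle⟩ := h A₀ hfg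
  exact exists_etale_of_le_range φ hφ A₀ hle B₀ e

lemma exists_etale_range_levelMap [PerfectField F] (S : Subalgebra A (A ⊗[F] k)) (hS : S.FG) :
    ∃ (C : Type u) (_ : CommRing C) (_ : Algebra A C)
      (_ : Algebra.Etale A C) (φ : C →ₐ[A] A ⊗[F] k), Function.Injective φ ∧ S ≤ φ.range := by
  obtain ⟨L, hL, hle⟩ := exists_le_levelMap_range hS
  have : Algebra.Etale F L := by
    have : Algebra.FormallyEtale F L := (Algebra.FormallyEtale.iff_isSeparable _ _).2 inferInstance
    exact ⟨this, (Algebra.FinitePresentation.of_finiteType).1 inferInstance⟩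
  exact ⟨A ⊗[F] L, inferInstance, inferInstance, inferInstance, levelMap A L,
    levelMap_injective L, hle⟩

/-- An étale algebra over `A ⊗ k` is a quotient of the base change to `k` of an étale
`A`-algebra. -/
lemma exists_etale_descent [PerfectField F] (B : Type u) [CommRing B] [Algebra (A ⊗[F] k) B]
    [Algebra.Etale (A ⊗[F] k) B] :
    ∃ (B' : Type u) (_ : CommRing B') (_ : Algebra A B') (_ : Algebra.Etale A B')
      (β : B' →+* B), (∀ a, β (algebraMap A B' a) = algebraMap (A ⊗[F] k) B (a ⊗ₜ 1)) ∧
      ∀ b : B, b ∈ Subring.closure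
        (Set.range β ∪ Set.range fun x : k => algebraMap (A ⊗[F] k) B (1 ⊗ₜ x)) := by
  obtain ⟨B', _, _, h1, β, h2, h3⟩ := exists_etale_of_directed (A := A) (D := A ⊗[F] k) (B := B)
    exists_etale_range_levelMap
  refine ⟨B', inferInstance, inferInstance, h1, β, h2, fun b => ?_⟩
  refine (Subring.closure_le.2 ?_) (h3 b)
  rintro _ (⟨x, rfl⟩ | ⟨d, rfl⟩)
  · exact Subring.subset_closure (Or.inl ⟨x, rfl⟩)
  · change _ ∈ Subring.closure _
    induction d with
    | zero => rw [map_zero]; exact zero_mem _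
    | add x y hx hy => rw [map_add]; exact add_mem hx hy
    | tmul a x =>
      have : a ⊗ₜ[F] x = (a ⊗ₜ 1) * (1 ⊗ₜ x) := by simp
      rw [this, map_mul]
      exact mul_mem (Subring.subset_closure (Or.inl ⟨_, h2 a⟩))
        (Subring.subset_closure (Or.inr ⟨x, rfl⟩))

end EtaleAlgebra

section Noetherian

lemma isOpen_connectedComponent_of_noetherianSpace {T : Type*} [TopologicalSpace T]
    [TopologicalSpace.NoetherianSpace T] (x : T) : IsOpen (connectedComponent x) := by
  have h : (connectedComponent x)ᶜ =
      ⋃₀ { Z ∈ irreducibleComponents T | Disjoint Z (connectedComponent x) } := by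
    ext y
    constructor
    · intro hy
      refine ⟨irreducibleComponent y, ⟨irreducibleComponent_mem_irreducibleComponents y, ?_⟩,
        mem_irreducibleComponent⟩
      rw [Set.disjoint_left]
      intro z hz hzx
      have h1 := isIrreducible_irreducibleComponent (x := y) |>.isConnected
      have h2 := h1.isPreconnected.subset_connectedComponent hz
      rw [← connectedComponent_eq hzx] at h2
      exact hy (h2 mem_irreducibleComponent)
    · rintro ⟨Z, ⟨-, hZ⟩, hyZ⟩ hy
      exact Set.disjoint_left.1 hZ hyZ hy
  rw [← isClosed_compl_iff, h]
  rw [Set.sUnion_eq_biUnion]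
  exact (TopologicalSpace.NoetherianSpace.finite_irreducibleComponents.subset
    fun Z h => h.1).isClosed_biUnion fun Z h => isClosed_of_mem_irreducibleComponents Z h.1

end Noetherian
end
end WeilEtale

namespace WeilEtale

noncomputable section

section EtaleDescent

open TensorProduct

variable {F k : Type u} [Field F] [Field k] [Algebra F k]

lemma isPullback_tensorProduct (A : Type u) [CommRing A] [Algebra F A] :
    IsPullback (Spec.map (CommRingCat.ofHom (algebraMap A (A ⊗[F] k))))
      (Spec.map (CommRingCat.ofHom
        (Algebra.TensorProduct.includeRight : k →ₐ[F] A ⊗[F] k).toRingHom))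
      (Spec.map (CommRingCat.ofHom (algebraMap F A))) (specAlg F k) :=
  isPullback_SpecMap_of_isPushout _ _ _ _ (CommRingCat.isPushout_tensorProduct F A k)

lemma isClosedImmersion_of_closure_eq_top {B' B : Type u} [CommRing B'] [CommRing B] [Algebra F B']
    (β : B' →+* B) (κ : k →+* B)
    (hβ : ∀ b : B, b ∈ Subring.closure (Set.range β ∪ Set.range κ))
    {P : Scheme.{u}} {p : P ⟶ Spec (.of B')} {q : P ⟶ Spec (.of k)}
    (h : IsPullback p q (Spec.map (CommRingCat.ofHom (algebraMap F B'))) (specAlg F k))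
    (r : Spec (.of B) ⟶ P) (hp : r ≫ p = Spec.map (CommRingCat.ofHom β))
    (hq : r ≫ q = Spec.map (CommRingCat.ofHom κ)) : IsClosedImmersion r := by
  let e := (isPullback_tensorProduct (k := k) B').isoIsPullback _ _ h
  obtain ⟨m, hm⟩ := Spec.map_surjective (r ≫ e.inv)
  have h1 : m.hom.comp (algebraMap B' (B' ⊗[F] k)) = β := by
    have : Spec.map (CommRingCat.ofHom (algebraMap B' (B' ⊗[F] k)) ≫ m) =
        Spec.map (CommRingCat.ofHom β) := by
      rw [Spec.map_comp, hm, ← hp, Category.assoc]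
      exact congrArg (r ≫ ·) (IsPullback.isoIsPullback_inv_fst _ _ _ _)
    exact congrArg (·.hom) (Spec.map_injective this)
  have h2 : m.hom.comp (Algebra.TensorProduct.includeRight : k →ₐ[F] B' ⊗[F] k).toRingHom = κ := by
    have : Spec.map (CommRingCat.ofHom
        (Algebra.TensorProduct.includeRight : k →ₐ[F] B' ⊗[F] k).toRingHom ≫ m) =
        Spec.map (CommRingCat.ofHom κ) := by
      rw [Spec.map_comp, hm, ← hq, Category.assoc]
      exact congrArg (r ≫ ·) (IsPullback.isoIsPullback_inv_snd _ _ _ _)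
    exact congrArg (·.hom) (Spec.map_injective this)
  have hs : Function.Surjective m.hom := by
    intro b
    have : Subring.closure (Set.range β ∪ Set.range κ) ≤ m.hom.range := by
      rw [Subring.closure_le]
      rintro _ (⟨x, rfl⟩ | ⟨x, rfl⟩)
      · exact ⟨_, congrArg (fun φ : B' →+* B => φ x) h1⟩
      · exact ⟨_, congrArg (fun φ : k →+* B => φ x) h2⟩
    exact this (hβ b)
  have : IsClosedImmersion (r ≫ e.inv) := hm ▸ IsClosedImmersion.spec_of_surjective m hs
  rw [← Category.comp_id r, ← e.inv_hom_id, ← Category.assoc]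
  infer_instance

/-- An affine scheme étale over `Spec A ×_F k` is open and closed in the base change of an étale
scheme over `Spec A`. -/
lemma exists_etale_affine [Algebra.IsAlgebraic F k] [PerfectField F] {A : Type u} [CommRing A]
    {y : Spec (.of A) ⟶ Spec (.of F)} {D : Scheme.{u}} {p : D ⟶ Spec (.of A)}
    {q : D ⟶ Spec (.of k)} (h : IsPullback p q y (specAlg F k)) {B : Type u} [CommRing B]
    (ε : Spec (.of B) ⟶ D) [Etale ε] :
    ∃ (Y' : Scheme.{u}) (f : Y' ⟶ Spec (.of A)), IsAffine Y' ∧ Etale f ∧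
      ∀ (g : Y' ⟶ Spec (.of F)) (_ : g = f ≫ y) (P : Scheme.{u}) (p' : P ⟶ Y')
        (q' : P ⟶ Spec (.of k)) (_ : IsPullback p' q' g (specAlg F k)),
        ∃ r : Spec (.of B) ⟶ P, IsOpenImmersion r ∧ IsClosedImmersion r ∧
          r ≫ p' ≫ f = ε ≫ p ∧ r ≫ q' = ε ≫ q := by
  obtain ⟨φ, rfl⟩ := Spec.map_surjective y
  let _ : Algebra F A := φ.hom.toAlgebra
  let e := (isPullback_tensorProduct (k := k) A).isoIsPullback _ _ h
  have e1 : e.inv ≫ Spec.map (CommRingCat.ofHom (algebraMap A (A ⊗[F] k))) = p :=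
    IsPullback.isoIsPullback_inv_fst _ _ _ _
  have e2 : e.inv ≫ Spec.map (CommRingCat.ofHom
      (Algebra.TensorProduct.includeRight : k →ₐ[F] A ⊗[F] k).toRingHom) = q :=
    IsPullback.isoIsPullback_inv_snd _ _ _ _
  obtain ⟨χ, hχ⟩ := Spec.map_surjective (ε ≫ e.inv)
  have hχe : χ.hom.Etale := by
    rw [← HasRingHomProperty.Spec_iff (P := @Etale), hχ]
    infer_instance
  let _ : Algebra (A ⊗[F] k) B := χ.hom.toAlgebra
  have : Algebra.Etale (A ⊗[F] k) B := hχe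
  obtain ⟨B', _, _, hB', β, hβ, hcl⟩ := exists_etale_descent (F := F) (k := k) (A := A) B
  have hf : Etale (Spec.map (CommRingCat.ofHom (algebraMap A B'))) := by
    rw [HasRingHomProperty.Spec_iff (P := @Etale)]
    exact RingHom.etale_algebraMap.2 hB'
  refine ⟨Spec (.of B'), Spec.map (CommRingCat.ofHom (algebraMap A B')), inferInstance, hf, ?_⟩
  rintro g hg P p' q' h'
  let _ : Algebra F B' := ((algebraMap A B').comp φ.hom).toAlgebra
  have hg' : g = Spec.map (CommRingCat.ofHom (algebraMap F B')) := by
    rw [hg, ← Spec.map_comp]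
    rfl
  subst hg'
  let κ : k →+* B :=
    χ.hom.comp (Algebra.TensorProduct.includeRight : k →ₐ[F] A ⊗[F] k).toRingHom
  have hκ : Spec.map (CommRingCat.ofHom κ) = ε ≫ q := by
    rw [← e2, ← Category.assoc, ← hχ, ← Spec.map_comp]
    rfl
  have hβε : Spec.map (CommRingCat.ofHom β) ≫ Spec.map (CommRingCat.ofHom (algebraMap A B')) =
      ε ≫ p := by
    rw [← e1, ← Category.assoc ε, ← hχ, ← Spec.map_comp, ← Spec.map_comp]
    congr 1
    exact CommRingCat.hom_ext (RingHom.ext hβ)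
  have hc : Spec.map (CommRingCat.ofHom β) ≫ Spec.map (CommRingCat.ofHom (algebraMap F B')) =
      Spec.map (CommRingCat.ofHom κ) ≫ specAlg F k := by
    rw [hg, ← Category.assoc, hβε, hκ, Category.assoc, Category.assoc, h.w]
  let r := h'.lift (Spec.map (CommRingCat.ofHom β)) (Spec.map (CommRingCat.ofHom κ)) hc
  have r1 : r ≫ p' = Spec.map (CommRingCat.ofHom β) := h'.lift_fst _ _ _
  have r2 : r ≫ q' = Spec.map (CommRingCat.ofHom κ) := h'.lift_snd _ _ _
  have hr : IsClosedImmersion r := isClosedImmersion_of_closure_eq_top β κ hcl h' r r1 r2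
  let l : P ⟶ D := h.lift (p' ≫ Spec.map (CommRingCat.ofHom (algebraMap A B'))) q' (by
    rw [Category.assoc, ← hg, h'.w])
  have l1 : l ≫ p = p' ≫ Spec.map (CommRingCat.ofHom (algebraMap A B')) := h.lift_fst _ _ _
  have l2 : l ≫ q = q' := h.lift_snd _ _ _
  have hl : IsPullback p' l (Spec.map (CommRingCat.ofHom (algebraMap A B'))) p := by
    refine .of_bot (h₁₁ := p') (v₁₁ := l) (h₂₁ := p) (v₁₂ := Spec.map (CommRingCat.ofHom (algebraMap A B')))
      (v₂₁ := q) (v₂₂ := Spec.map φ) (h₃₁ := specAlg F k) ?_ l1.symm h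
    rw [← hg, l2]
    exact h'
  have : Etale l := MorphismProperty.of_isPullback hl hf
  have hrl : r ≫ l = ε := by
    apply h.hom_ext
    · rw [Category.assoc, l1, ← Category.assoc, r1, hβε]
    · rw [Category.assoc, l2, r2, hκ]
  have : Etale (r ≫ l) := by rwa [hrl]
  have : Etale r := Etale.of_comp r l
  refine ⟨r, IsOpenImmersion.of_flat_of_mono r, hr, ?_, ?_⟩
  · rw [← Category.assoc, r1, hβε]
  · rw [r2, hκ]

/-- Every point of a scheme étale over `Y ×_F k` has a neighbourhood that is open and closed in the
base change of an affine étale scheme over `Y`. -/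
lemma exists_etale_clopen [Algebra.IsAlgebraic F k] [PerfectField F] {Y D T : Scheme.{u}}
    {y : Y ⟶ Spec (.of F)} {p : D ⟶ Y} {q : D ⟶ Spec (.of k)}
    (h : IsPullback p q y (specAlg F k)) (ε : T ⟶ D) [Etale ε] (t : T) :
    ∃ (Y' : Scheme.{u}) (f : Y' ⟶ Y), IsAffine Y' ∧ Etale f ∧
      ∀ (g : Y' ⟶ Spec (.of F)) (_ : g = f ≫ y) (P : Scheme.{u}) (p' : P ⟶ Y')
        (q' : P ⟶ Spec (.of k)) (_ : IsPullback p' q' g (specAlg F k)),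
        ∃ (Q : Scheme.{u}) (c : Q ⟶ T) (x : Q) (r : Q ⟶ P), IsOpenImmersion c ∧
          IsOpenImmersion r ∧ IsClosedImmersion r ∧ c x = t ∧
          r ≫ p' ≫ f = c ≫ ε ≫ p ∧ r ≫ q' = c ≫ ε ≫ q := by
  obtain ⟨A, i, hi, hti, -⟩ := Scheme.exists_affine_mem_range_and_range_subset
    (show p (ε t) ∈ (⊤ : Y.Opens) from trivial)
  let d := pullback.fst p i
  let p₀ := pullback.snd p i
  have hd : IsPullback d p₀ p i := .of_hasPullback p i
  have h₀ : IsPullback p₀ (d ≫ q) (i ≫ y) (specAlg F k) := hd.flip.paste_vert h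
  have htd : t ∈ ε ⁻¹ᵁ d.opensRange := by
    obtain ⟨a, ha⟩ := hti
    obtain ⟨z, hz, -⟩ := Scheme.Pullback.exists_preimage_pullback (f := p) (g := i) (ε t) a ha.symm
    exact ⟨z, hz⟩
  obtain ⟨B, c, hc, ⟨x, hx⟩, hcd⟩ := Scheme.exists_affine_mem_range_and_range_subset htd
  have hr : Set.range (c ≫ ε) ⊆ Set.range d := by
    rintro _ ⟨z, rfl⟩
    exact hcd ⟨z, rfl⟩
  let ε' := IsOpenImmersion.lift d (c ≫ ε) hr
  have hε' : ε' ≫ d = c ≫ ε := IsOpenImmersion.lift_fac _ _ _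
  have : Etale (ε' ≫ d) := by
    rw [hε']
    infer_instance
  have : Etale ε' := Etale.of_comp ε' d
  obtain ⟨Y', f, h1, h2, h3⟩ := exists_etale_affine h₀ ε'
  refine ⟨Y', f ≫ i, h1, inferInstance, fun g hg P p' q' hP => ?_⟩
  obtain ⟨r, hr1, hr2, hr3, hr4⟩ := h3 g (by rw [hg, Category.assoc]) P p' q' hP
  refine ⟨Spec B, c, x, r, hc, hr1, hr2, hx, ?_, ?_⟩
  · rw [← Category.assoc p', ← Category.assoc r, hr3, ← Category.assoc c, ← hε', Category.assoc,
      Category.assoc, hd.w]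
  · rw [hr4, ← Category.assoc c, ← hε', Category.assoc]

end EtaleDescent

section Components

variable {F k : Type u} [Field F] [Fintype F] [Field k] [Algebra F k] [IsAlgClosure F k]
  {X : Over (Spec (.of F))} {E : SchemeSubcategory X}

lemma noetherianSpace_geom {Y : Over X.left} (hY : E.mem Y) :
    TopologicalSpace.NoetherianSpace (geom k (Over.mk (Y.hom ≫ X.hom))) := by
  have := E.locallyOfFiniteType Y hY
  have := E.quasiCompact Y hY
  have : LocallyOfFiniteType (Over.mk (Y.hom ≫ X.hom)).hom := E.locallyOfFiniteType Y hY
  have : QuasiCompact (Over.mk (Y.hom ≫ X.hom)).hom := E.quasiCompact Y hY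
  have h1 := LocallyOfFiniteType.isLocallyNoetherian
    (pullback.snd (Over.mk (Y.hom ≫ X.hom)).hom (specAlg F k))
  have : CompactSpace (geom k (Over.mk (Y.hom ≫ X.hom))) :=
    QuasiCompact.compactSpace_of_compactSpace
      (pullback.snd (Over.mk (Y.hom ≫ X.hom)).hom (specAlg F k))
  have : IsNoetherian (geom k (Over.mk (Y.hom ≫ X.hom))) := { __ := h1 }
  infer_instance

lemma SchemeSubcategory.mem_of_isAffine {Y : Over X.left} (hY : E.mem Y) {Y' : Scheme.{u}}
    (f : Y' ⟶ Y.left) [IsAffine Y'] [Etale f] : E.mem (Over.mk (f ≫ Y.hom)) := by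
  have h1 := E.isSeparated Y hY
  have h2 : QuasiSeparatedSpace Y.left := quasiSeparatedSpace_of_quasiSeparated (Y.hom ≫ X.hom)
  have h5 := E.quasiCompact Y hY
  have h6 : CompactSpace Y.left := QuasiCompact.compactSpace_of_compactSpace (Y.hom ≫ X.hom)
  have h3 : QuasiCompact f := (quasiCompact_iff_compactSpace f).2 inferInstance
  have h4 : IsSeparated ((f ≫ Y.hom) ≫ X.hom) := inferInstance
  exact E.mem_of_etale (Over.homMk f : Over.mk (f ≫ Y.hom) ⟶ Y) hY ‹Etale f› h3 h4

lemma exists_component_of_clopen {P Q : Scheme.{u}} [TopologicalSpace.NoetherianSpace P]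
    (r : Q ⟶ P) [IsOpenImmersion r] [IsClosedImmersion r] (x : Q) :
    ∃ (Z : Scheme.{u}) (i : Z ⟶ P) (l : Z ⟶ Q) (z : Z), IsOpenImmersion i ∧ IsOpenImmersion l ∧
      Set.range i = connectedComponent (r x) ∧ l ≫ r = i ∧ l z = x := by
  let O : P.Opens := ⟨connectedComponent (r x), isOpen_connectedComponent_of_noetherianSpace (r x)⟩
  have hO : Set.range O.ι ⊆ Set.range r := by
    rw [Scheme.Opens.range_ι]
    exact IsClopen.connectedComponent_subset ⟨r.isClosedEmbedding.isClosed_range,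
      r.isOpenEmbedding.isOpen_range⟩ ⟨x, rfl⟩
  let l : O.toScheme ⟶ Q := IsOpenImmersion.lift r O.ι hO
  have hl : l ≫ r = O.ι := IsOpenImmersion.lift_fac _ _ _
  have : IsOpenImmersion (l ≫ r) := by
    rw [hl]
    infer_instance
  refine ⟨O, O.ι, l, ⟨r x, mem_connectedComponent⟩, inferInstance, IsOpenImmersion.of_comp l r,
    Scheme.Opens.range_ι O, hl, r.injective ?_⟩
  exact (Scheme.Hom.comp_apply l r _).symm.trans (congrArg (fun φ : O.toScheme ⟶ P => φ _) hl)

lemma exists_ebar_of_component (V : Ebar k E) {Y : Over X.left} (hY : E.mem Y) {Z : Scheme.{u}}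
    (i : Z ⟶ geom k (Over.mk (Y.hom ≫ X.hom))) (hi : IsOpenImmersion i)
    {y : geom k (Over.mk (Y.hom ≫ X.hom))} (hy : Set.range i = connectedComponent y)
    (b : Z ⟶ V.sch) (e1 : i ≫ pullback.fst _ _ ≫ Y.hom = (b ≫ V.str) ≫ pullback.fst _ _)
    (e2 : i ≫ pullback.snd _ _ = (b ≫ V.str) ≫ pullback.snd _ _) :
    ∃ (Z' : Ebar k E) (a : Z' ⟶ V) (c : Z'.sch ⟶ Z), IsIso c ∧
      c ≫ b = a.hom.left :=
  ⟨⟨Over.mk (b ≫ V.str), Y, hY, i, hi, e1, e2, y, hy⟩, Ebar.mkHom b rfl, 𝟙 Z,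
    inferInstanceAs (IsIso (𝟙 Z)), Category.id_comp _⟩

lemma exists_etale_ebar_aux (V : Ebar k E) {T : Scheme.{u}} (ε : T ⟶ V.sch) [Etale ε] {t : T}
    {Y Y' : Over X.left} (f : Y' ⟶ Y) (hY' : E.mem Y')
    {j : V.sch ⟶ geom k (Over.mk (Y.hom ≫ X.hom))}
    (hj1 : j ≫ pullback.fst _ _ ≫ Y.hom = V.str ≫ pullback.fst _ _)
    (hj2 : j ≫ pullback.snd _ _ = V.str ≫ pullback.snd _ _) {Q : Scheme.{u}} (c : Q ⟶ T) {x : Q}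
    (r : Q ⟶ geom k (Over.mk (Y'.hom ≫ X.hom))) [IsOpenImmersion c]
    [IsOpenImmersion r] [IsClosedImmersion r] (hx : c x = t)
    (hr1 : r ≫ pullback.fst _ _ ≫ f.left = c ≫ (ε ≫ j) ≫ pullback.fst _ _)
    (hr2 : r ≫ pullback.snd _ _ = c ≫ (ε ≫ j) ≫ pullback.snd _ _) :
    ∃ (Z : Ebar k E) (a : Z ⟶ V) (b : Z.sch ⟶ T) (z : Z.sch), Etale a.hom.left ∧ b z = t ∧
      b ≫ ε = a.hom.left := by
  have hN := noetherianSpace_geom (k := k) hY'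
  obtain ⟨O, i, l, z, hi, hl', hO, hl, hz⟩ := exists_component_of_clopen r x
  have hf := Over.w f
  have e1 : i ≫ pullback.fst (Over.mk (Y'.hom ≫ X.hom)).hom (specAlg F k) ≫ Y'.hom =
      ((l ≫ c ≫ ε) ≫ V.str) ≫ pullback.fst X.hom (specAlg F k) := by
    have h1 := congrArg (fun z => l ≫ z ≫ Y.hom) hr1
    have h2 := congrArg (fun z => l ≫ c ≫ ε ≫ z) hj1
    simp only [Category.assoc, ← hl, ← hf] at h1 h2 ⊢
    exact h1.trans h2
  have e2 : i ≫ pullback.snd (Over.mk (Y'.hom ≫ X.hom)).hom (specAlg F k) =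
      ((l ≫ c ≫ ε) ≫ V.str) ≫ pullback.snd X.hom (specAlg F k) := by
    have h1 := congrArg (fun z => l ≫ z) hr2
    have h2 := congrArg (fun z => l ≫ c ≫ ε ≫ z) hj2
    simp only [Category.assoc, ← hl] at h1 h2 ⊢
    exact h1.trans h2
  obtain ⟨Z, a, d, hd, hda⟩ := exists_ebar_of_component V hY' i hi hO (l ≫ c ≫ ε) e1 e2
  obtain ⟨z', rfl⟩ := d.surjective z
  refine ⟨Z, a, d ≫ l ≫ c, z', ?_, ?_, ?_⟩
  · rw [← hda]
    infer_instance
  · rw [Scheme.Hom.comp_apply, Scheme.Hom.comp_apply, hz, hx]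
  · rw [← hda, Category.assoc, Category.assoc]

/-- Étale morphisms of schemes to objects of `\bar ℰ` are locally given by morphisms of
`\bar ℰ`. -/
lemma exists_etale_ebar (V : Ebar k E) {T : Scheme.{u}} (ε : T ⟶ V.sch) [Etale ε] (t : T) :
    ∃ (Z : Ebar k E) (a : Z ⟶ V) (b : Z.sch ⟶ T) (z : Z.sch), Etale a.hom.left ∧ b z = t ∧
      b ≫ ε = a.hom.left := by
  have : Algebra.IsAlgebraic F k := IsAlgClosure.isAlgebraic
  obtain ⟨Y, hY, j, hj, hj1, hj2, -⟩ := V.property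
  have hj' : Etale (ε ≫ j) := inferInstance
  obtain ⟨Y', f, hY', hf, h⟩ := exists_etale_clopen (k := k)
    (IsPullback.of_hasPullback (Over.mk (Y.hom ≫ X.hom)).hom (specAlg F k)) (ε ≫ j) t
  have hE := E.mem_of_isAffine hY f
  obtain ⟨Q, c, x, r, hc, hr, hr', hx, hr1, hr2⟩ := h ((f ≫ Y.hom) ≫ X.hom) (Category.assoc _ _ _)
    (geom k (Over.mk ((Over.mk (f ≫ Y.hom)).hom ≫ X.hom))) _ _
    (.of_hasPullback ((f ≫ Y.hom) ≫ X.hom) (specAlg F k))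
  exact exists_etale_ebar_aux V ε (Over.homMk f : Over.mk (f ≫ Y.hom) ⟶ Y) hE hj1 hj2 c r hx hr1 hr2

/-- Étale morphisms of `\bar ℰ` can be pulled back, locally for the étale topology. -/
lemma exists_etale_lift {U V W : Ebar k E} (g : V ⟶ U) (f : W ⟶ U) (hf : Etale f.hom.left)
    (v : V.sch) (w : W.sch) (hvw : g.hom.left v = f.hom.left w) :
    ∃ (Z : Ebar k E) (a : Z ⟶ V) (b : Z ⟶ W) (z : Z.sch), Etale a.hom.left ∧ a.hom.left z = v ∧
      a ≫ g = b ≫ f := by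
  obtain ⟨t, ht, -⟩ := Scheme.Pullback.exists_preimage_pullback v w hvw
  obtain ⟨Z, a, b, z, ha, hz, hb⟩ := exists_etale_ebar V (pullback.fst g.hom.left f.hom.left) t
  have h1 : (b ≫ pullback.snd g.hom.left f.hom.left) ≫ f.hom.left = a.hom.left ≫ g.hom.left := by
    rw [Category.assoc, ← pullback.condition, ← Category.assoc, hb]
  refine ⟨Z, a, Ebar.mkHom (b ≫ pullback.snd _ _) ?_, z, ha, ?_, Ebar.hom_ext h1.symm⟩
  · rw [← show f.hom.left ≫ U.str = W.str from Over.w f.hom, ← Category.assoc, h1,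
      Category.assoc, show g.hom.left ≫ U.str = V.str from Over.w g.hom]
    exact Over.w a.hom
  · rw [← hb, Scheme.Hom.comp_apply, hz, ht]

end Components

end

end WeilEtale

namespace WeilEtale

noncomputable section

variable {F k : Type u} [Field F] [Fintype F] [Field k] [Algebra F k] [IsAlgClosure F k]
  {X : Over (Spec (.of F))} {E : SchemeSubcategory X}

namespace AbSheaf

/-- The restriction map of a sheaf. -/
def res (A : AbSheaf k E) {U V : Ebar k E} (f : U ⟶ V) : A.obj.obj (op V) →+ A.obj.obj (op U) :=
  (A.obj.map f.op).hom

lemma res_comp (A : AbSheaf k E) {U V W : Ebar k E} (f : U ⟶ V) (g : V ⟶ W)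
    (x : A.obj.obj (op W)) : A.res f (A.res g x) = A.res (f ≫ g) x := by
  simp [res]

lemma res_id (A : AbSheaf k E) {U : Ebar k E} (x : A.obj.obj (op U)) : A.res (𝟙 U) x = x := by
  simp [res]

/-- The map on sections given by a morphism of sheaves. -/
def app {A B : AbSheaf k E} (a : A ⟶ B) (U : Ebar k E) : A.obj.obj (op U) →+ B.obj.obj (op U) :=
  (a.hom.app (op U)).hom

lemma app_res {A B : AbSheaf k E} (a : A ⟶ B) {U V : Ebar k E} (f : U ⟶ V)
    (x : A.obj.obj (op V)) : app a U (A.res f x) = B.res f (app a V x) :=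
  congrArg (fun φ => φ.hom x) (a.hom.naturality f.op)

lemma hom_ext {A B : AbSheaf k E} {a b : A ⟶ B} (h : ∀ U x, app a U x = app b U x) : a = b :=
  Sheaf.hom_ext (NatTrans.ext (funext fun U => AddCommGrpCat.hom_ext
    (AddMonoidHom.ext fun x => h U.unop x)))

/-- A section is determined by its restrictions to a covering sieve. -/
lemma eq_of_locally_eq (A : AbSheaf k E) {U : Ebar k E} {S : Sieve U}
    (hS : S ∈ Ebar.etaleTopology E U) {x y : A.obj.obj (op U)}
    (h : ∀ (V : Ebar k E) (f : V ⟶ U), S f → A.res f x = A.res f y) : x = y := by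
  have hA := (Presheaf.isSheaf_iff_isSheaf_forget (Ebar.etaleTopology E) A.obj
    (CategoryTheory.forget AddCommGrpCat)).1 A.property
  rw [isSheaf_iff_isSheaf_of_type] at hA
  exact (hA.isSeparated S hS).ext fun V f hf => h V f hf

end AbSheaf

namespace EquivSheaf

variable {H : Type u} [Group H] {ρ : H →* Gal(k/F)} (𝓕 : EquivSheaf E ρ)

lemma res_id {U : Ebar k E} (x : 𝓕.sec U) : 𝓕.res (𝟙 U) x = x :=
  AbSheaf.res_id 𝓕.sheaf x

variable {𝓕} in
lemma res_congr {U V : Ebar k E} {f g : U ⟶ V} (h : f.hom.left = g.hom.left)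
    (x : 𝓕.sec V) : 𝓕.res f x = 𝓕.res g x := by
  rw [Ebar.hom_ext h]

lemma act_res (h : H) {U V : Ebar k E} (f : U ⟶ V) (x : 𝓕.sec V) :
    𝓕.act h U (𝓕.res f x) = 𝓕.res ((Ebar.twist (ρ h)).map f) (𝓕.act h V x) :=
  congrArg (fun φ => φ.hom x) ((𝓕.σ h).naturality f.op)

lemma act_mul (g h : H) (U : Ebar k E) (x : 𝓕.sec U) :
    𝓕.act (g * h) U x =
      𝓕.res (Ebar.twistMul U (map_mul ρ g h)) (𝓕.act g _ (𝓕.act h U x)) :=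
  congrArg (fun φ => φ.hom x) (𝓕.σ_mul g h U)

lemma res_act_one (U : Ebar k E) (x : 𝓕.sec U) :
    𝓕.res (Ebar.toTwistOne U (map_one ρ)) (𝓕.act 1 U x) = x :=
  congrArg (fun φ => φ.hom x) (𝓕.σ_one U)

variable {U V W : Ebar k E}

/-- The map `𝓕(U) → 𝓕(V)` given by a `ρ(h)`-semilinear morphism `V ⟶ U`. -/
def pull (h : H) (f : V.sch ⟶ U.sch) (w : f ≫ U.str ≫ galAct X (ρ h) = V.str) :
    𝓕.sec U →+ 𝓕.sec V :=
  (𝓕.res (Ebar.mkHom f w : V ⟶ (Ebar.twist (ρ h)).obj U)).comp (𝓕.act h U)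

lemma pull_congr {h h' : H} {f f' : V.sch ⟶ U.sch} (hh : h = h') (hf : f = f')
    (w : f ≫ U.str ≫ galAct X (ρ h) = V.str) (x : 𝓕.sec U) :
    𝓕.pull h f w x = 𝓕.pull h' f' (by rw [← hh, ← hf, w]) x := by
  subst hh hf
  rfl

lemma semilinear_comp {g h : Gal(k/F)} {f : V.sch ⟶ U.sch} (w : f ≫ U.str ≫ galAct X h = V.str)
    {f' : W.sch ⟶ V.sch} (w' : f' ≫ V.str ≫ galAct X g = W.str) :
    (f' ≫ f) ≫ U.str ≫ galAct X (g * h) = W.str := by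
  rw [gal_mul_comm, galAct_mul, ← w', ← w]
  simp only [Category.assoc]

lemma semilinear_comp' {g h : H} {f : V.sch ⟶ U.sch} (w : f ≫ U.str ≫ galAct X (ρ h) = V.str)
    {f' : W.sch ⟶ V.sch} (w' : f' ≫ V.str ≫ galAct X (ρ g) = W.str) :
    (f' ≫ f) ≫ U.str ≫ galAct X (ρ (g * h)) = W.str := by
  rw [map_mul]
  exact semilinear_comp w w'

lemma pull_pull {g h : H} {f : V.sch ⟶ U.sch} (w : f ≫ U.str ≫ galAct X (ρ h) = V.str)
    {f' : W.sch ⟶ V.sch} (w' : f' ≫ V.str ≫ galAct X (ρ g) = W.str) (x : 𝓕.sec U) :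
    𝓕.pull g f' w' (𝓕.pull h f w x) = 𝓕.pull (g * h) (f' ≫ f) (semilinear_comp' w w') x := by
  change 𝓕.res _ (𝓕.act g V (𝓕.res _ (𝓕.act h U x))) = 𝓕.res _ (𝓕.act (g * h) U x)
  rw [act_res, act_mul, res_comp, res_comp]
  exact res_congr (Category.comp_id (f' ≫ f)) _

variable (ρ) in
lemma semilinear_one {f : V.sch ⟶ U.sch} (w : f ≫ U.str = V.str) :
    f ≫ U.str ≫ galAct X (ρ 1) = V.str := by
  rw [map_one, galAct_one, Category.comp_id, w]

lemma res_eq_pull (f : V ⟶ U) (x : 𝓕.sec U) :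
    𝓕.res f x = 𝓕.pull 1 f.hom.left (semilinear_one ρ (Over.w f.hom)) x := by
  refine (congrArg (𝓕.res f) (𝓕.res_act_one U x)).symm.trans ?_
  rw [res_comp]
  exact congrArg (fun φ => 𝓕.res φ (𝓕.act 1 U x)) (Ebar.hom_ext (Category.comp_id f.hom.left))

lemma act_eq_pull (h : H) (U : Ebar k E) (x : 𝓕.sec U) :
    𝓕.act h U x = 𝓕.pull h (V := (Ebar.twist (ρ h)).obj U) (𝟙 U.sch) (Category.id_comp _) x :=
  (𝓕.res_id _).symm

lemma pull_one {f : U.sch ⟶ U.sch} (hf : f = 𝟙 _) {h : H} (hh : h = 1) (w) (x : 𝓕.sec U) :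
    𝓕.pull h f w x = x := by
  subst hf hh
  exact (𝓕.res_eq_pull (𝟙 U) x).symm.trans (𝓕.res_id x)

variable {𝓕} {𝓖 : EquivSheaf E ρ}

lemma app_act (a : 𝓕 ⟶ 𝓖) (h : H) (U : Ebar k E) (x : 𝓕.sec U) :
    app a _ (𝓕.act h U x) = 𝓖.act h U (app a U x) :=
  congrArg (fun φ => φ.hom x) (comm_app a h (op U))

lemma app_res (a : 𝓕 ⟶ 𝓖) (f : V ⟶ U) (x : 𝓕.sec U) :
    app a V (𝓕.res f x) = 𝓖.res f (app a U x) :=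
  AbSheaf.app_res a.hom f x

lemma app_pull (a : 𝓕 ⟶ 𝓖) {h : H} {f : V.sch ⟶ U.sch}
    (w : f ≫ U.str ≫ galAct X (ρ h) = V.str) (x : 𝓕.sec U) :
    app a V (𝓕.pull h f w x) = 𝓖.pull h f w (app a U x) :=
  (app_res a _ _).trans (congrArg _ (app_act a h U x))

lemma hom_ext_app {a b : 𝓕 ⟶ 𝓖} (h : ∀ U x, app a U x = app b U x) : a = b :=
  hom_ext (AbSheaf.hom_ext h)

/-- Functorial maps of a sheaf along semilinear morphisms. -/
structure PullData (ρ : H →* Gal(k/F)) (A : AbSheaf k E) where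
  /-- the map along a semilinear morphism -/
  pull (h : H) {U V : Ebar k E} (f : V.sch ⟶ U.sch) (w : f ≫ U.str ≫ galAct X (ρ h) = V.str) :
    A.obj.obj (op U) →+ A.obj.obj (op V)
  pull_pull {g h : H} {U V W : Ebar k E} {f : V.sch ⟶ U.sch}
    (w : f ≫ U.str ≫ galAct X (ρ h) = V.str) {f' : W.sch ⟶ V.sch}
    (w' : f' ≫ V.str ≫ galAct X (ρ g) = W.str) (x : A.obj.obj (op U)) :
    pull g f' w' (pull h f w x) = pull (g * h) (f' ≫ f) (semilinear_comp' w w') x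
  res_eq_pull {U V : Ebar k E} (f : V ⟶ U) (x : A.obj.obj (op U)) :
    A.res f x = pull 1 f.hom.left (semilinear_one ρ (Over.w f.hom)) x

namespace PullData

variable {A : AbSheaf k E} (D : PullData ρ A)

lemma congr {h h' : H} {f f' : V.sch ⟶ U.sch} (hh : h = h') (hf : f = f')
    (w : f ≫ U.str ≫ galAct X (ρ h) = V.str) (w' : f' ≫ U.str ≫ galAct X (ρ h') = V.str)
    (x : A.obj.obj (op U)) : D.pull h f w x = D.pull h' f' w' x := by
  subst hh hf
  rfl

lemma res_pull {h : H} {f : V.sch ⟶ U.sch} (w : f ≫ U.str ≫ galAct X (ρ h) = V.str)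
    (φ : W ⟶ V) {l : W.sch ⟶ U.sch} (hl : l = φ.hom.left ≫ f)
    (wl : l ≫ U.str ≫ galAct X (ρ h) = W.str) (x : A.obj.obj (op U)) :
    A.res φ (D.pull h f w x) = D.pull h l wl x := by
  rw [D.res_eq_pull, D.pull_pull]
  exact D.congr (one_mul h) hl.symm _ _ x

lemma pull_one' {h : H} (hh : h = 1) {f : U.sch ⟶ U.sch} (hf : f = 𝟙 _)
    (w : f ≫ U.str ≫ galAct X (ρ h) = U.str) (x : A.obj.obj (op U)) :
    D.pull h f w x = x := by
  subst hh hf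
  exact (D.res_eq_pull (𝟙 U) x).symm.trans (A.res_id x)

lemma res_pull_one {h : H} (hh : h = 1) {f : V.sch ⟶ U.sch}
    (w : f ≫ U.str ≫ galAct X (ρ h) = V.str)
    (φ : U ⟶ V) (hl : φ.hom.left ≫ f = 𝟙 _) (x : A.obj.obj (op U)) :
    A.res φ (D.pull h f w x) = x := by
  refine (D.res_pull w φ hl.symm ?_ x).trans (D.pull_one' hh rfl _ x)
  rw [hh]
  exact semilinear_one ρ (Category.id_comp _)

lemma naturality {h : H} {P Q : Ebar k E} {p : P.sch ⟶ U.sch}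
    (wp : p ≫ U.str ≫ galAct X (ρ h) = P.str) {q : Q.sch ⟶ V.sch}
    (wq : q ≫ V.str ≫ galAct X (ρ h) = Q.str) (f : U ⟶ V) (f' : P ⟶ Q)
    (hf : p ≫ f.hom.left = f'.hom.left ≫ q) (x : A.obj.obj (op V)) :
    D.pull h p wp (A.res f x) = A.res f' (D.pull h q wq x) := by
  rw [D.res_eq_pull, D.pull_pull, D.res_eq_pull, D.pull_pull]
  exact D.congr ((mul_one h).trans (one_mul h).symm) hf _ _ x

lemma comp {g h : H} {P Q R : Ebar k E} {p : P.sch ⟶ U.sch}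
    (wp : p ≫ U.str ≫ galAct X (ρ h) = P.str) {q : Q.sch ⟶ P.sch}
    (wq : q ≫ P.str ≫ galAct X (ρ g) = Q.str) (φ : R ⟶ Q) {l : R.sch ⟶ U.sch}
    (wl : l ≫ U.str ≫ galAct X (ρ (g * h)) = R.str) (hl : l = φ.hom.left ≫ q ≫ p)
    (x : A.obj.obj (op U)) :
    D.pull (g * h) l wl x = A.res φ (D.pull g q wq (D.pull h p wp x)) := by
  rw [D.pull_pull]
  exact (D.res_pull _ φ hl wl x).symm

/-- The action on a sheaf given by functorial maps along semilinear morphisms. -/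
def act (h : H) (U : Ebar k E) :
    A.obj.obj (op U) →+ A.obj.obj (op ((Ebar.twist (ρ h)).obj U)) :=
  D.pull h (V := (Ebar.twist (ρ h)).obj U) (𝟙 U.sch) (Category.id_comp _)

lemma act_naturality (h : H) (f : U ⟶ V) (x : A.obj.obj (op V)) :
    D.act h U (A.res f x) = A.res ((Ebar.twist (ρ h)).map f) (D.act h V x) :=
  D.naturality (P := (Ebar.twist (ρ h)).obj U) (Q := (Ebar.twist (ρ h)).obj V) _ _ f
    ((Ebar.twist (ρ h)).map f) ((Category.id_comp f.hom.left).trans (Category.comp_id _).symm) x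

lemma act_one (U : Ebar k E) (x : A.obj.obj (op U)) :
    A.res (Ebar.toTwistOne U (map_one ρ)) (D.act 1 U x) = x :=
  D.res_pull_one (V := (Ebar.twist (ρ 1)).obj U) rfl _ (Ebar.toTwistOne U (map_one ρ))
    (Category.comp_id (𝟙 U.sch)) x

lemma id_three (S : Scheme.{u}) : 𝟙 S = 𝟙 S ≫ 𝟙 S ≫ 𝟙 S := by simp

lemma act_mul (g h : H) (U : Ebar k E) (x : A.obj.obj (op U)) :
    D.act (g * h) U x =
      A.res (Ebar.twistMul U (map_mul ρ g h)) (D.act g _ (D.act h U x)) :=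
  D.comp (P := (Ebar.twist (ρ h)).obj U)
    (Q := (Ebar.twist (ρ g)).obj ((Ebar.twist (ρ h)).obj U))
    (R := (Ebar.twist (ρ (g * h))).obj U) (p := 𝟙 U.sch) (q := 𝟙 U.sch) (l := 𝟙 U.sch)
    (Category.id_comp _) (Category.id_comp _)
    (Ebar.twistMul U (map_mul ρ g h)) (Category.id_comp _) (id_three U.sch) x

end PullData

/-- An equivariant sheaf, given by its maps along semilinear morphisms. -/
def ofPull {A : AbSheaf k E} (D : PullData ρ A) : EquivSheaf E ρ where
  sheaf := A
  σ h :=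
    { app U := AddCommGrpCat.ofHom (D.act h U.unop)
      naturality U V f := AddCommGrpCat.hom_ext
        (AddMonoidHom.ext fun x => D.act_naturality h f.unop x) }
  σ_one U := AddCommGrpCat.hom_ext (AddMonoidHom.ext fun x => D.act_one U x)
  σ_mul g h U := AddCommGrpCat.hom_ext (AddMonoidHom.ext fun x => D.act_mul g h U x)

lemma ofPull_pull {A : AbSheaf k E} (D : PullData ρ A) {h : H} {f : V.sch ⟶ U.sch}
    (w : f ≫ U.str ≫ galAct X (ρ h) = V.str) (x : A.obj.obj (op U)) :
    (ofPull D).pull h f w x = D.pull h f w x :=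
  D.res_pull (V := (Ebar.twist (ρ h)).obj U) (Category.id_comp _)
    (Ebar.mkHom f w : V ⟶ (Ebar.twist (ρ h)).obj U) (Category.comp_id f).symm w x

/-- A morphism of equivariant sheaves, given by its effect on sections. -/
def homMk (a : 𝓕.sheaf ⟶ 𝓖.sheaf)
    (h : ∀ (h : H) (U : Ebar k E) (x : 𝓕.sec U),
      AbSheaf.app a _ (𝓕.act h U x) = 𝓖.act h U (AbSheaf.app a U x)) : 𝓕 ⟶ 𝓖 where
  hom := a
  comm g := NatTrans.ext (funext fun U => AddCommGrpCat.hom_ext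
    (AddMonoidHom.ext fun x => h g U.unop x))

end EquivSheaf

/-- A morphism of sheaves, given by its effect on sections. -/
def AbSheaf.homMk {A B : AbSheaf k E} (a : ∀ U : Ebar k E, A.obj.obj (op U) →+ B.obj.obj (op U))
    (h : ∀ {U V : Ebar k E} (f : U ⟶ V) (x), a U (A.res f x) = B.res f (a V x)) : A ⟶ B :=
  ⟨{ app U := AddCommGrpCat.ofHom (a U.unop)
     naturality U V f := AddCommGrpCat.hom_ext (AddMonoidHom.ext fun x => h f.unop x) }⟩

section Coinduced

variable {H : Type u} [Group H] (ρ : H →* Gal(k/F))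

namespace AbSheaf

/-- The restriction map `A(gU) → A(V)` along a semilinear morphism `V ⟶ U`. -/
def along (A : AbSheaf k E) {V U : Ebar k E} (g : Gal(k/F)) (f : V.sch ⟶ U.sch)
    (w : f ≫ U.str ≫ galAct X g = V.str) :
    A.obj.obj (op ((Ebar.twist g).obj U)) →+ A.obj.obj (op V) :=
  A.res (Ebar.mkHom f w : V ⟶ (Ebar.twist g).obj U)

variable (A : AbSheaf k E) {V U W : Ebar k E}

lemma along_self {g : Gal(k/F)} {f : U.sch ⟶ U.sch} (hf : f = 𝟙 _) (w)
    (x : A.obj.obj (op ((Ebar.twist g).obj U))) :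
    A.along (V := (Ebar.twist g).obj U) g f w x = x := by
  subst hf
  exact A.res_id x

lemma res_along (f' : W ⟶ V) {g : Gal(k/F)} (f : V.sch ⟶ U.sch)
    (w : f ≫ U.str ≫ galAct X g = V.str) (x : A.obj.obj (op ((Ebar.twist g).obj U))) :
    A.res f' (A.along g f w x) = A.along g (f'.hom.left ≫ f) (by
      rw [Category.assoc, w]
      exact Over.w f'.hom) x :=
  A.res_comp _ _ _

lemma semilinear_twist {h : Gal(k/F)} {f : V.sch ⟶ U.sch} (w : f ≫ U.str ≫ galAct X h = V.str)
    (g : Gal(k/F)) : f ≫ U.str ≫ galAct X (g * h) = ((Ebar.twist g).obj V).str := by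
  change _ = V.str ≫ galAct X g
  rw [← w, gal_mul_comm, galAct_mul]
  simp only [Category.assoc]

end AbSheaf

/-- The presheaf `U ↦ ∏_{g ∈ H} A(gU)`. -/
def coindPresheaf (A : AbSheaf k E) : (Ebar k E)ᵒᵖ ⥤ AddCommGrpCat.{u + 1} where
  obj U := AddCommGrpCat.of (∀ g : H, A.obj.obj (op ((Ebar.twist (ρ g)).obj U.unop)))
  map {U V} f := AddCommGrpCat.ofHom
    { toFun x g := A.res ((Ebar.twist (ρ g)).map f.unop) (x g)
      map_zero' := funext fun g => map_zero _
      map_add' x y := funext fun g => map_add _ _ _ }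
  map_id U := AddCommGrpCat.hom_ext (AddMonoidHom.ext fun x => funext fun g => A.res_id _)
  map_comp f f' := AddCommGrpCat.hom_ext (AddMonoidHom.ext fun x => funext fun g =>
    (A.res_comp ((Ebar.twist (ρ g)).map f'.unop) ((Ebar.twist (ρ g)).map f.unop) (x g)).symm)

lemma coindPresheaf_isSheaf (A : AbSheaf k E) :
    Presheaf.IsSheaf (Ebar.etaleTopology E) (coindPresheaf ρ A) := by
  have hA (g : H) := (Presheaf.isSheaf_iff_isSheaf_forget (Ebar.etaleTopology E) _
    (CategoryTheory.forget AddCommGrpCat)).1 (Ebar.twist_op_comp_isSheaf (ρ g) A)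
  simp_rw [isSheaf_iff_isSheaf_of_type] at hA
  rw [Presheaf.isSheaf_iff_isSheaf_forget (Ebar.etaleTopology E) _
    (CategoryTheory.forget AddCommGrpCat), isSheaf_iff_isSheaf_of_type]
  intro U S hS x hx
  have hx' (g : H) : Presieve.FamilyOfElements.Compatible (P :=
      ((Ebar.twist (ρ g)).op ⋙ A.obj) ⋙ CategoryTheory.forget AddCommGrpCat)
      (fun V f hf => x f hf g) := fun V W Z a b c d hc hd e => congrFun (hx a b hc hd e) g
  refine ⟨fun g => (hA g S hS).amalgamate _ (hx' g), fun V f hf => funext fun g =>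
    (hA g S hS).valid_glue (hx' g) f hf, fun y hy => funext fun g => ?_⟩
  exact (hA g).isSeparated S hS |>.ext fun V f hf =>
    (congrFun (hy f hf) g).trans ((hA g S hS).valid_glue (hx' g) f hf).symm

/-- The sheaf `U ↦ ∏_{g ∈ H} A(gU)`. -/
def coindSheaf (A : AbSheaf k E) : AbSheaf k E := ⟨coindPresheaf ρ A, coindPresheaf_isSheaf ρ A⟩

variable {ρ}

/-- A section of the coinduced sheaf as a family. -/
def coindFamily {A : AbSheaf k E} {U : Ebar k E} :
    (coindSheaf ρ A).obj.obj (op U) ≃+ ∀ g : H, A.obj.obj (op ((Ebar.twist (ρ g)).obj U)) :=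
  AddEquiv.refl _

lemma coindFamily_ext {A : AbSheaf k E} {U : Ebar k E} {x y : (coindSheaf ρ A).obj.obj (op U)}
    (h : ∀ g, coindFamily x g = coindFamily y g) : x = y := funext h

/-- The component of a section of the coinduced sheaf, restricted along a semilinear morphism. -/
def coindEval {A : AbSheaf k E} {U : Ebar k E} (g : H) {P : Ebar k E} (f : P.sch ⟶ U.sch)
    (w : f ≫ U.str ≫ galAct X (ρ g) = P.str) :
    (coindSheaf ρ A).obj.obj (op U) →+ A.obj.obj (op P) where
  toFun x := A.along (ρ g) f w (coindFamily x g)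
  map_zero' := (A.along (ρ g) f w).map_zero
  map_add' x y := (A.along (ρ g) f w).map_add (coindFamily x g) (coindFamily y g)

lemma coindEval_ext {A : AbSheaf k E} {U : Ebar k E} {x y : (coindSheaf ρ A).obj.obj (op U)}
    (h : ∀ (g : H) (P : Ebar k E) (f : P.sch ⟶ U.sch) (w), coindEval g f w x = coindEval g f w y) :
    x = y := coindFamily_ext fun g =>
  (A.along_self rfl (Category.id_comp _) _).symm.trans
    ((h g ((Ebar.twist (ρ g)).obj U) (𝟙 U.sch) (Category.id_comp _)).trans
      (A.along_self rfl (Category.id_comp _) _))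

section

variable {A : AbSheaf k E} {U V P Q : Ebar k E}

lemma coindEval_congr {g g' : H} (hg : g = g') {f f' : P.sch ⟶ U.sch} (hf : f = f')
    (w : f ≫ U.str ≫ galAct X (ρ g) = P.str) (x : (coindSheaf ρ A).obj.obj (op U)) :
    coindEval g f w x = coindEval g' f' (by rw [← hg, ← hf, w]) x := by
  subst hg hf
  rfl

lemma res_coindEval {g : H} {f : P.sch ⟶ U.sch} (w : f ≫ U.str ≫ galAct X (ρ g) = P.str)
    (φ : Q ⟶ P) (x : (coindSheaf ρ A).obj.obj (op U)) :
    A.res φ (coindEval g f w x) = coindEval g (φ.hom.left ≫ f) (by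
      rw [Category.assoc, w]
      exact Over.w φ.hom) x :=
  A.res_along φ f w _

lemma semilinear_comp_left {g : H} {f : P.sch ⟶ V.sch} (w : f ≫ V.str ≫ galAct X (ρ g) = P.str)
    (φ : V ⟶ U) : (f ≫ φ.hom.left) ≫ U.str ≫ galAct X (ρ g) = P.str := by
  have h : φ.hom.left ≫ U.str = V.str := Over.w φ.hom
  rw [Category.assoc, ← w, ← h, Category.assoc]

lemma coindEval_res {g : H} {f : P.sch ⟶ V.sch} (w : f ≫ V.str ≫ galAct X (ρ g) = P.str)
    (φ : V ⟶ U) (x : (coindSheaf ρ A).obj.obj (op U)) :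
    coindEval g f w ((coindSheaf ρ A).res φ x) =
      coindEval g (f ≫ φ.hom.left) (semilinear_comp_left w φ) x :=
  A.res_comp _ _ _

end

end Coinduced

end

end WeilEtale

namespace WeilEtale

noncomputable section

variable {F k : Type u} [Field F] [Fintype F] [Field k] [Algebra F k] [IsAlgClosure F k]
  {X : Over (Spec (.of F))} {E : SchemeSubcategory X}

section Coinduced

variable {H : Type u} [Group H] {ρ : H →* Gal(k/F)}

section

variable {A : AbSheaf k E} {U V P Q : Ebar k E}

lemma coindPull_aux {h : H} {f : V.sch ⟶ U.sch} (w : f ≫ U.str ≫ galAct X (ρ h) = V.str) (g : H) :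
    f ≫ U.str ≫ galAct X (ρ (g * h)) = ((Ebar.twist (ρ g)).obj V).str := by
  rw [map_mul]
  exact AbSheaf.semilinear_twist w _

/-- The map of coinduced sheaves along a semilinear morphism. -/
def coindPull (A : AbSheaf k E) (h : H) {U V : Ebar k E} (f : V.sch ⟶ U.sch)
    (w : f ≫ U.str ≫ galAct X (ρ h) = V.str) :
    (coindSheaf ρ A).obj.obj (op U) →+ (coindSheaf ρ A).obj.obj (op V) where
  toFun x := coindFamily.symm fun g => coindEval (P := (Ebar.twist (ρ g)).obj V) (g * h) f
    (coindPull_aux w g) x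
  map_zero' := coindFamily_ext fun g => (coindEval (P := (Ebar.twist (ρ g)).obj V) (g * h) f
    (coindPull_aux w g)).map_zero
  map_add' x y := coindFamily_ext fun g => (coindEval (P := (Ebar.twist (ρ g)).obj V) (g * h) f
    (coindPull_aux w g)).map_add x y

lemma coindEval_pull {g h : H} {f : V.sch ⟶ U.sch} (w : f ≫ U.str ≫ galAct X (ρ h) = V.str)
    {f' : P.sch ⟶ V.sch} (w' : f' ≫ V.str ≫ galAct X (ρ g) = P.str)
    (x : (coindSheaf ρ A).obj.obj (op U)) :
    coindEval g f' w' (coindPull A h f w x) =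
      coindEval (g * h) (f' ≫ f) (EquivSheaf.semilinear_comp' w w') x :=
  res_coindEval (P := (Ebar.twist (ρ g)).obj V) (coindPull_aux w g)
    (Ebar.mkHom f' w' : P ⟶ (Ebar.twist (ρ g)).obj V) x

end

/-- The maps of the coinduced sheaf along semilinear morphisms. -/
def coindData (ρ : H →* Gal(k/F)) (A : AbSheaf k E) :
    EquivSheaf.PullData ρ (coindSheaf ρ A) where
  pull h _ _ f w := coindPull A h f w
  pull_pull w f' w' x := coindEval_ext fun g P j wj => by
      rw [coindEval_pull, coindEval_pull, coindEval_pull]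
      exact coindEval_congr (mul_assoc _ _ _) (Category.assoc _ _ _) _ _
  res_eq_pull f x := coindEval_ext fun g P j wj => by
      rw [coindEval_res, coindEval_pull]
      exact coindEval_congr (mul_one g).symm rfl _ _

/-- The sheaf `U ↦ ∏_{g ∈ H} A(gU)` with its action of `H`. -/
def coind (ρ : H →* Gal(k/F)) (A : AbSheaf k E) : EquivSheaf E ρ := .ofPull (coindData ρ A)

namespace coind

variable {A B : AbSheaf k E} {U V P Q : Ebar k E}

/-- The component of a section of the coinduced sheaf, restricted along a semilinear morphism. -/
def eval (g : H) (f : P.sch ⟶ U.sch)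
    (w : f ≫ U.str ≫ galAct X (ρ g) = P.str) : (coind ρ A).sec U →+ A.obj.obj (op P) :=
  coindEval (ρ := ρ) (A := A) g f w

lemma ext {x y : (coind ρ A).sec U}
    (h : ∀ (g : H) (P : Ebar k E) (f : P.sch ⟶ U.sch) (w), eval g f w x = eval g f w y) : x = y :=
  coindEval_ext h

lemma eval_congr {g g' : H} (hg : g = g') {f f' : P.sch ⟶ U.sch} (hf : f = f')
    (w : f ≫ U.str ≫ galAct X (ρ g) = P.str) (x : (coind ρ A).sec U) :
    eval g f w x = eval g' f' (by rw [← hg, ← hf, w]) x :=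
  coindEval_congr hg hf w x

lemma res_eval {g : H} {f : P.sch ⟶ U.sch} (w : f ≫ U.str ≫ galAct X (ρ g) = P.str)
    (φ : Q ⟶ P) (x : (coind ρ A).sec U) :
    A.res φ (eval g f w x) = eval g (φ.hom.left ≫ f) (by
      rw [Category.assoc, w]
      exact Over.w φ.hom) x :=
  res_coindEval w φ x

lemma eval_res {g : H} {f : P.sch ⟶ V.sch} (w : f ≫ V.str ≫ galAct X (ρ g) = P.str)
    (φ : V ⟶ U) (x : (coind ρ A).sec U) :
    eval g f w ((coind ρ A).res φ x) = eval g (f ≫ φ.hom.left) (semilinear_comp_left w φ) x :=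
  coindEval_res w φ x

lemma eval_pull {g h : H} {f : V.sch ⟶ U.sch}
    (w : f ≫ U.str ≫ galAct X (ρ h) = V.str)
    {f' : P.sch ⟶ V.sch} (w' : f' ≫ V.str ≫ galAct X (ρ g) = P.str) (x : (coind ρ A).sec U) :
    eval g f' w' ((coind ρ A).pull h f w x) =
      eval (g * h) (f' ≫ f) (EquivSheaf.semilinear_comp' w w') x :=
  (congrArg (coindEval g f' w') (EquivSheaf.ofPull_pull (coindData ρ A) w x)).trans
    (coindEval_pull w w' x)

/-- A section of the coinduced sheaf, given by its components. -/
def mk (x : ∀ g : H, A.obj.obj (op ((Ebar.twist (ρ g)).obj U))) : (coind ρ A).sec U :=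
  (coindFamily (ρ := ρ) (A := A) (U := U)).symm x

lemma eval_mk (x : ∀ g : H, A.obj.obj (op ((Ebar.twist (ρ g)).obj U))) {g : H}
    {f : P.sch ⟶ U.sch} (w : f ≫ U.str ≫ galAct X (ρ g) = P.str) :
    eval g f w (mk x) = A.res (Ebar.mkHom f w : P ⟶ (Ebar.twist (ρ g)).obj U) (x g) := rfl

/-- The components of a section of the coinduced sheaf. -/
def comp (g : H) (U : Ebar k E) : (coind ρ A).sec U →+
    A.obj.obj (op ((Ebar.twist (ρ g)).obj U)) :=
  eval (P := (Ebar.twist (ρ g)).obj U) g (𝟙 U.sch) (Category.id_comp _)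

lemma comp_mk (x : ∀ g : H, A.obj.obj (op ((Ebar.twist (ρ g)).obj U))) (g : H) :
    comp g U (mk x) = x g :=
  A.res_id (x g)

lemma eval_eq_res_comp {g : H} {f : P.sch ⟶ U.sch} (w : f ≫ U.str ≫ galAct X (ρ g) = P.str)
    (x : (coind ρ A).sec U) :
    eval g f w x = A.res (Ebar.mkHom f w : P ⟶ (Ebar.twist (ρ g)).obj U) (comp g U x) :=
  ((res_eval (P := (Ebar.twist (ρ g)).obj U) (Category.id_comp _)
    (Ebar.mkHom f w : P ⟶ (Ebar.twist (ρ g)).obj U) x).trans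
      (eval_congr rfl (Category.comp_id f) _ x)).symm

lemma comp_ext {x y : (coind ρ A).sec U} (h : ∀ g, comp g U x = comp g U y) : x = y :=
  ext fun g P f w => by rw [eval_eq_res_comp, h, ← eval_eq_res_comp]

/-- The morphism of coinduced sheaves given by a morphism of sheaves. -/
def mapHom (a : A ⟶ B) : coindSheaf ρ A ⟶ coindSheaf ρ B :=
  AbSheaf.homMk (fun U =>
    { toFun x := coindFamily.symm fun g => AbSheaf.app a _ (coindFamily x g)
      map_zero' := coindFamily_ext fun g => (AbSheaf.app a _).map_zero
      map_add' x y := coindFamily_ext fun g =>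
        (AbSheaf.app a _).map_add (coindFamily x g) (coindFamily y g) })
    (fun f x => coindFamily_ext fun g => AbSheaf.app_res a _ _)

lemma eval_mapHom (a : A ⟶ B) {g : H} {f : P.sch ⟶ U.sch}
    (w : f ≫ U.str ≫ galAct X (ρ g) = P.str) (x : (coind ρ A).sec U) :
    eval (A := B) g f w (AbSheaf.app (mapHom a) U x) = AbSheaf.app a P (eval g f w x) :=
  (AbSheaf.app_res a (Ebar.mkHom f w : P ⟶ (Ebar.twist (ρ g)).obj U) _).symm

end coind

end Coinduced

end

end WeilEtale

namespace WeilEtale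

noncomputable section

variable {F k : Type u} [Field F] [Fintype F] [Field k] [Algebra F k] [IsAlgClosure F k]
  {X : Over (Spec (.of F))} {E : SchemeSubcategory X}

section Coinduced

variable {H : Type u} [Group H] {ρ : H →* Gal(k/F)}

namespace EquivSheaf

/-- A morphism of equivariant sheaves, given by its effect on sections. -/
def homOfPull {𝓕 𝓖 : EquivSheaf E ρ} (a : 𝓕.sheaf ⟶ 𝓖.sheaf)
    (ha : ∀ (h : H) {U V : Ebar k E} (f : V.sch ⟶ U.sch)
      (w : f ≫ U.str ≫ galAct X (ρ h) = V.str) (x : 𝓕.sec U),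
      AbSheaf.app a V (𝓕.pull h f w x) = 𝓖.pull h f w (AbSheaf.app a U x)) : 𝓕 ⟶ 𝓖 :=
  homMk a fun h U x =>
    (congrArg (AbSheaf.app a _) (𝓕.act_eq_pull h U x)).trans
      ((ha h (V := (Ebar.twist (ρ h)).obj U) (𝟙 U.sch) (Category.id_comp _) x).trans
        (𝓖.act_eq_pull h U _).symm)

end EquivSheaf

namespace coind

variable (ρ) in
/-- Coinduction as a functor. -/
def functor : AbSheaf k E ⥤ EquivSheaf E ρ where
  obj A := coind ρ A
  map a := EquivSheaf.homOfPull (mapHom a) fun h U V f w x => ext fun g P f' w' =>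
    (eval_mapHom a w' ((coind ρ _).pull h f w x)).trans
      ((congrArg (AbSheaf.app a P) (eval_pull w w' x)).trans
        ((eval_mapHom a _ x).symm.trans (eval_pull w w' _).symm))
  map_id A := EquivSheaf.hom_ext_app fun U x => ext fun g P f w => eval_mapHom (𝟙 A) w x
  map_comp a b := EquivSheaf.hom_ext_app fun U x => ext fun g P f w =>
    (eval_mapHom (a ≫ b) w x).trans
      ((eval_mapHom b w _).trans (congrArg _ (eval_mapHom a w x))).symm

lemma eval_map {A B : AbSheaf k E} (a : A ⟶ B) {U P : Ebar k E} {g : H} {f : P.sch ⟶ U.sch}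
    (w : f ≫ U.str ≫ galAct X (ρ g) = P.str) (x : (coind ρ A).sec U) :
    eval (A := B) g f w (EquivSheaf.app ((functor ρ).map a) U x) =
      AbSheaf.app a P (eval g f w x) :=
  eval_mapHom a w x

/-- The map `x ↦ (g x)_g`. -/
def unitFun (𝓕 : EquivSheaf E ρ) (U : Ebar k E) : 𝓕.sec U →+ (coind ρ 𝓕.sheaf).sec U where
  toFun x := mk fun g => 𝓕.act g U x
  map_zero' := comp_ext fun g => (comp_mk _ g).trans
    ((map_zero (𝓕.act g U)).trans (map_zero (comp g U)).symm)
  map_add' x y := comp_ext fun g => (comp_mk _ g).trans ((map_add (𝓕.act g U) x y).trans (by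
    rw [map_add, comp_mk, comp_mk]))

lemma eval_unitFun (𝓕 : EquivSheaf E ρ) {U P : Ebar k E} {g : H} {f : P.sch ⟶ U.sch}
    (w : f ≫ U.str ≫ galAct X (ρ g) = P.str) (x : 𝓕.sec U) :
    eval g f w (unitFun 𝓕 U x) = 𝓕.pull g f w x := rfl

/-- The morphism `𝓕 ⟶ ∏_g g^* 𝓕`, `x ↦ (g x)_g`. -/
def unit (𝓕 : EquivSheaf E ρ) : 𝓕 ⟶ coind ρ 𝓕.sheaf :=
  EquivSheaf.homOfPull (AbSheaf.homMk (unitFun 𝓕) fun f x => ext fun g P j w => by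
      refine (eval_unitFun 𝓕 w (𝓕.res f x)).trans (Eq.trans ?_ (eval_res w f _).symm)
      rw [eval_unitFun, 𝓕.res_eq_pull, 𝓕.pull_pull]
      exact 𝓕.pull_congr (mul_one g) rfl _ x)
    fun h U V f w x => ext fun g P f' w' => by
      refine (eval_unitFun 𝓕 w' (𝓕.pull h f w x)).trans
        (Eq.trans ?_ (eval_pull w w' (unitFun 𝓕 U x)).symm)
      rw [eval_unitFun, 𝓕.pull_pull]

lemma eval_unit (𝓕 : EquivSheaf E ρ) {U P : Ebar k E} {g : H} {f : P.sch ⟶ U.sch}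
    (w : f ≫ U.str ≫ galAct X (ρ g) = P.str) (x : 𝓕.sec U) :
    eval g f w (EquivSheaf.app (unit 𝓕) U x) = 𝓕.pull g f w x := rfl

/-- The projection to the component with index `1`. -/
def counit (A : AbSheaf k E) : coindSheaf ρ A ⟶ A :=
  AbSheaf.homMk (fun U => eval (ρ := ρ) 1 (𝟙 U.sch)
      (EquivSheaf.semilinear_one ρ (Category.id_comp _)))
    fun f x => (eval_res (EquivSheaf.semilinear_one ρ (Category.id_comp _)) f x).trans
      ((eval_congr rfl ((Category.id_comp f.hom.left).trans (Category.comp_id f.hom.left).symm)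
        _ x).trans (res_eval (EquivSheaf.semilinear_one ρ (Category.id_comp _)) f x).symm)

lemma app_counit (A : AbSheaf k E) (U : Ebar k E) (x : (coind ρ A).sec U) :
    AbSheaf.app (counit (ρ := ρ) A) U x = eval 1 (𝟙 U.sch)
      (EquivSheaf.semilinear_one ρ (Category.id_comp _)) x := rfl

variable (E ρ) in
/-- Coinduction is right adjoint to the functor forgetting the action. -/
def adjunction : EquivSheaf.forget (k := k) (E := E) ρ ⊣ functor ρ :=
  Adjunction.mkOfUnitCounit
    { unit :=
        { app 𝓕 := unit 𝓕
          naturality 𝓕 𝓖 a := EquivSheaf.hom_ext_app fun U x => ext fun g P f w =>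
            (eval_unit 𝓖 w (EquivSheaf.app a U x)).trans ((EquivSheaf.app_pull a w x).symm.trans
              (eval_map a.hom w (EquivSheaf.app (unit 𝓕) U x)).symm) }
      counit :=
        { app A := counit A
          naturality A B a := AbSheaf.hom_ext fun U x =>
            (eval_mapHom a (EquivSheaf.semilinear_one ρ (Category.id_comp U.str)) x) }
      left_triangle := NatTrans.ext (funext fun 𝓕 => AbSheaf.hom_ext fun U x =>
        𝓕.pull_one rfl rfl (EquivSheaf.semilinear_one ρ (Category.id_comp U.str)) x)
      right_triangle := NatTrans.ext (funext fun A => EquivSheaf.hom_ext_app fun U x =>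
        ext fun g P f w => by
          refine (eval_map (counit A) w (EquivSheaf.app (unit (coind ρ A)) U x)).trans ?_
          refine (app_counit A P ((coind ρ A).pull g f w x)).trans ((eval_pull _ _ _).trans ?_)
          exact eval_congr (one_mul g) (Category.id_comp f) _ x) }

end coind

instance : EnoughInjectives (EquivSheaf (k := k) E ρ) :=
  EnoughInjectives.of_adjunction (coind.adjunction E ρ)

end Coinduced

instance : EnoughInjectives (WeilSheaf k E) :=
  inferInstanceAs (EnoughInjectives (EquivSheaf E (weilGroup F k).subtype))

end

end WeilEtale

namespace WeilEtale

noncomputable section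

variable {F k : Type u} [Field F] [Fintype F] [Field k] [Algebra F k] [IsAlgClosure F k]
  {X : Over (Spec (.of F))} {E : SchemeSubcategory X}

section Coinduced

variable {H : Type u} [Group H] {ρ : H →* Gal(k/F)}

namespace EquivSheaf

variable {U V P : Ebar k E}

lemma semilinear_untwist (c : Gal(k/F)) (P : Ebar k E) :
    𝟙 P.sch ≫ ((Ebar.twist c⁻¹).obj P).str ≫ galAct X c = P.str :=
  (Category.id_comp _).trans (Ebar.str_comp_galAct_inv P c)

lemma semilinear_inv_mul {c g : H} {l : P.sch ⟶ U.sch}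
    (w : l ≫ U.str ≫ galAct X (ρ g) = P.str) :
    l ≫ U.str ≫ galAct X (ρ (c⁻¹ * g)) = ((Ebar.twist (ρ c)⁻¹).obj P).str := by
  rw [map_mul, map_inv]
  exact AbSheaf.semilinear_twist w _

lemma exists_twist (c : Gal(k/F)) (P : Ebar k E) : ∃ (Q : Ebar k E) (j : Q.sch ⟶ P.sch),
    IsIso j ∧ j ≫ P.str ≫ galAct X c = Q.str :=
  ⟨(Ebar.twist c).obj P, 𝟙 P.sch, inferInstanceAs (IsIso (𝟙 P.sch)), Category.id_comp _⟩

lemma pull_res (𝓕 : EquivSheaf E ρ) {h : H} {f : V.sch ⟶ U.sch}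
    (w : f ≫ U.str ≫ galAct X (ρ h) = V.str) (φ : U ⟶ P)
    (w' : (f ≫ φ.hom.left) ≫ P.str ≫ galAct X (ρ h) = V.str) (x : 𝓕.sec P) :
    𝓕.pull h f w (𝓕.res φ x) = 𝓕.pull h (f ≫ φ.hom.left) w' x := by
  rw [res_eq_pull, pull_pull]
  exact 𝓕.pull_congr (mul_one h) rfl _ x

lemma res_pull (𝓕 : EquivSheaf E ρ) {h : H} {f : V.sch ⟶ U.sch}
    (w : f ≫ U.str ≫ galAct X (ρ h) = V.str) (φ : P ⟶ V)
    (w' : (φ.hom.left ≫ f) ≫ U.str ≫ galAct X (ρ h) = P.str) (x : 𝓕.sec U) :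
    𝓕.res φ (𝓕.pull h f w x) = 𝓕.pull h (φ.hom.left ≫ f) w' x := by
  rw [res_eq_pull, pull_pull]
  exact 𝓕.pull_congr (one_mul h) rfl _ x

lemma pull_injective (𝓕 : EquivSheaf E ρ) {h : H} {f : V.sch ⟶ U.sch} (hf : IsIso f)
    (w : f ≫ U.str ≫ galAct X (ρ h) = V.str) : Function.Injective (𝓕.pull h f w) := by
  have w' : inv f ≫ V.str ≫ galAct X (ρ h⁻¹) = U.str := by
    rw [IsIso.inv_comp_eq, map_inv]
    exact (Ebar.eq_comp_galAct_inv w).symm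
  refine Function.LeftInverse.injective (g := 𝓕.pull h⁻¹ (inv f) w') fun x => ?_
  rw [pull_pull]
  exact 𝓕.pull_one (IsIso.inv_hom_id f) (inv_mul_cancel h) _ x

end EquivSheaf

namespace coind

variable {A : AbSheaf k E} {𝓕 : EquivSheaf E ρ} {U V P Q : Ebar k E}

lemma ext_mul (c : H) {x y : (coind ρ A).sec U}
    (h : ∀ (h : H) (P Q : Ebar k E) (j : P.sch ⟶ Q.sch) (wj : j ≫ Q.str ≫ galAct X (ρ c) = P.str)
      (f : Q.sch ⟶ U.sch) (wf : f ≫ U.str ≫ galAct X (ρ h) = Q.str),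
      eval (c * h) (j ≫ f) (EquivSheaf.semilinear_comp' wf wj) x =
        eval (c * h) (j ≫ f) (EquivSheaf.semilinear_comp' wf wj) y) : x = y :=
  ext fun g P l w => by
    have := h (c⁻¹ * g) P ((Ebar.twist (ρ c)⁻¹).obj P) (𝟙 P.sch)
      (EquivSheaf.semilinear_untwist (ρ c) P) l (EquivSheaf.semilinear_inv_mul w)
    exact (eval_congr (mul_inv_cancel_left c g).symm (Category.id_comp l).symm w x).trans
      (this.trans (eval_congr (mul_inv_cancel_left c g).symm (Category.id_comp l).symm w y).symm)

lemma semilinear_obj_twist {c h : H} {l : P.sch ⟶ U.sch}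
    (w : l ≫ U.str ≫ galAct X (ρ (c * h)) = P.str) :
    l ≫ ((Ebar.twist (ρ h)).obj U).str ≫ galAct X (ρ c) = P.str := by
  change l ≫ (U.str ≫ galAct X (ρ h)) ≫ galAct X (ρ c) = P.str
  rw [← w, map_mul, gal_mul_comm, galAct_mul]
  simp only [Category.assoc]

lemma pull_eval {c h : H} {j : P.sch ⟶ Q.sch} (wj : j ≫ Q.str ≫ galAct X (ρ c) = P.str)
    {f : Q.sch ⟶ U.sch} (wf : f ≫ U.str ≫ galAct X (ρ h) = Q.str)
    (x : (coind ρ 𝓕.sheaf).sec U) :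
    𝓕.pull c j wj (eval h f wf x) = 𝓕.pull (U := (Ebar.twist (ρ h)).obj U) c (j ≫ f)
      (semilinear_obj_twist (U := U) (c := c) (h := h) (l := j ≫ f) (P := P)
        (EquivSheaf.semilinear_comp' wf wj)) (comp h U x) := by
  exact (congrArg (𝓕.pull c j wj) (eval_eq_res_comp wf x)).trans
    (𝓕.pull_res (U := Q) (P := (Ebar.twist (ρ h)).obj U) wj
      (Ebar.mkHom f wf : Q ⟶ (Ebar.twist (ρ h)).obj U)
      _ (comp h U x))

lemma pull_comp_congr {c h h' : H} (e : h = h') {l l' : P.sch ⟶ U.sch} (el : l = l')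
    (w : l ≫ ((Ebar.twist (ρ h)).obj U).str ≫ galAct X (ρ c) = P.str)
    (w' : l' ≫ ((Ebar.twist (ρ h')).obj U).str ≫ galAct X (ρ c) = P.str)
    (x : (coind ρ 𝓕.sheaf).sec U) :
    𝓕.pull (U := (Ebar.twist (ρ h)).obj U) c l w (comp h U x) =
      𝓕.pull (U := (Ebar.twist (ρ h')).obj U) c l' w' (comp h' U x) := by
  subst e el
  rfl

lemma semilinear_mulLeft (c g : H) (U : Ebar k E) :
    𝟙 U.sch ≫ ((Ebar.twist (ρ (c⁻¹ * g))).obj U).str ≫ galAct X (ρ c) =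
      ((Ebar.twist (ρ g)).obj U).str :=
  semilinear_obj_twist (ρ := ρ) (c := c) (h := c⁻¹ * g) (U := U) (l := 𝟙 U.sch)
      (P := (Ebar.twist (ρ g)).obj U) (by
    rw [mul_inv_cancel_left]
    exact Category.id_comp _)

variable (𝓕) in
/-- Left translation by `c`: the map `x ↦ (c x_{c⁻¹ g})_g`. -/
def mulLeftFun (c : H) (U : Ebar k E) :
    (coind ρ 𝓕.sheaf).sec U →+ (coind ρ 𝓕.sheaf).sec U where
  toFun x := mk fun g => 𝓕.pull (U := (Ebar.twist (ρ (c⁻¹ * g))).obj U)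
    (V := (Ebar.twist (ρ g)).obj U) c (𝟙 U.sch) (semilinear_mulLeft c g U) (comp (c⁻¹ * g) U x)
  map_zero' := comp_ext fun g => (comp_mk _ g).trans
    ((congrArg _ (map_zero (comp (c⁻¹ * g) U))).trans ((map_zero _).trans
      (map_zero (comp g U)).symm))
  map_add' x y := comp_ext fun g => (comp_mk _ g).trans
    ((congrArg _ (map_add (comp (c⁻¹ * g) U) x y)).trans ((map_add _ _ _).trans (by
      rw [map_add, comp_mk, comp_mk])))

lemma eval_mulLeftFun {c h : H} {j : P.sch ⟶ Q.sch} (wj : j ≫ Q.str ≫ galAct X (ρ c) = P.str)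
    {f : Q.sch ⟶ U.sch} (wf : f ≫ U.str ≫ galAct X (ρ h) = Q.str)
    (x : (coind ρ 𝓕.sheaf).sec U) :
    eval (c * h) (j ≫ f) (EquivSheaf.semilinear_comp' wf wj) (mulLeftFun 𝓕 c U x) =
      𝓕.pull c j wj (eval h f wf x) := by
  rw [pull_eval]
  refine (eval_mk _ _).trans ?_
  refine (𝓕.res_pull (U := (Ebar.twist (ρ (c⁻¹ * (c * h)))).obj U)
    (V := (Ebar.twist (ρ (c * h))).obj U) (semilinear_mulLeft c (c * h) U)
    (Ebar.mkHom (j ≫ f) (EquivSheaf.semilinear_comp' wf wj) :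
      P ⟶ (Ebar.twist (ρ (c * h))).obj U) ?_ _).trans ?_
  · rw [inv_mul_cancel_left]
    exact (congrArg (· ≫ _) (Category.comp_id (j ≫ f))).trans
      (semilinear_obj_twist (EquivSheaf.semilinear_comp' wf wj))
  · exact pull_comp_congr (inv_mul_cancel_left c h) (Category.comp_id (j ≫ f)) _ _ x

variable (𝓕) in
/-- Left translation by `c`: the endomorphism `x ↦ (c x_{c⁻¹ g})_g`. -/
def mulLeft (c : H) : coind ρ 𝓕.sheaf ⟶ coind ρ 𝓕.sheaf :=
  EquivSheaf.homOfPull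
    (AbSheaf.homMk (mulLeftFun 𝓕 c) fun φ x => ext_mul c fun h P Q j wj f wf => by
      refine (eval_mulLeftFun wj wf ((coind ρ 𝓕.sheaf).res φ x)).trans ?_
      refine (congrArg _ (eval_res wf φ x)).trans ?_
      refine Eq.trans ?_ (eval_res _ φ (mulLeftFun 𝓕 c _ x)).symm
      refine (eval_mulLeftFun wj _ x).symm.trans ?_
      exact eval_congr rfl (Category.assoc _ _ _).symm _ _)
    fun h' U V φ w x => ext_mul c fun h P Q j wj f wf => by
      refine (eval_mulLeftFun wj wf ((coind ρ 𝓕.sheaf).pull h' φ w x)).trans ?_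
      refine (congrArg _ (eval_pull w wf x)).trans ?_
      refine Eq.trans ?_ (eval_pull w _ (mulLeftFun 𝓕 c _ x)).symm
      refine (eval_mulLeftFun wj _ x).symm.trans ?_
      exact eval_congr (mul_assoc _ _ _).symm (Category.assoc _ _ _).symm _ _

lemma eval_mulLeft {c h : H} {j : P.sch ⟶ Q.sch} (wj : j ≫ Q.str ≫ galAct X (ρ c) = P.str)
    {f : Q.sch ⟶ U.sch} (wf : f ≫ U.str ≫ galAct X (ρ h) = Q.str)
    (x : (coind ρ 𝓕.sheaf).sec U) :
    eval (c * h) (j ≫ f) (EquivSheaf.semilinear_comp' wf wj) (EquivSheaf.app (mulLeft 𝓕 c) U x) =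
      𝓕.pull c j wj (eval h f wf x) :=
  eval_mulLeftFun wj wf x

/-- Left translation is natural. -/
lemma map_comp_mulLeft {𝓖 : EquivSheaf E ρ} (a : 𝓕 ⟶ 𝓖) (c : H) :
    (functor ρ).map a.hom ≫ mulLeft 𝓖 c = mulLeft 𝓕 c ≫ (functor ρ).map a.hom :=
  EquivSheaf.hom_ext_app fun U x => ext_mul c fun h P Q j wj f wf => by
    refine (eval_mulLeft wj wf (EquivSheaf.app ((functor ρ).map a.hom) U x)).trans ?_
    refine (congrArg _ (eval_map a.hom wf x)).trans ?_
    refine Eq.trans ?_ (eval_map a.hom _ (EquivSheaf.app (mulLeft 𝓕 c) U x)).symm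
    exact (EquivSheaf.app_pull a wj _).symm.trans (congrArg _ (eval_mulLeft wj wf x).symm)

lemma unit_comp_mulLeft (c : H) : unit 𝓕 ≫ mulLeft 𝓕 c = unit 𝓕 :=
  EquivSheaf.hom_ext_app fun U x => ext_mul c fun h P Q j wj f wf => by
    refine (eval_mulLeft wj wf (EquivSheaf.app (unit 𝓕) U x)).trans ?_
    refine (congrArg _ (eval_unit 𝓕 wf x)).trans ?_
    exact 𝓕.pull_pull wf wj x

lemma app_unit_injective (U : Ebar k E) : Function.Injective (EquivSheaf.app (unit 𝓕) U) := by
  intro x y h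
  have := congrArg (eval 1 (𝟙 U.sch) (EquivSheaf.semilinear_one ρ (Category.id_comp U.str))) h
  rw [eval_unit, eval_unit] at this
  rwa [𝓕.pull_one rfl rfl, 𝓕.pull_one rfl rfl] at this

/-- A section invariant under left translation by a generator comes from a section of `𝓕`. -/
lemma exists_app_unit_eq {c : H} (hc : ∀ g : H, g ∈ Subgroup.zpowers c)
    (x : (coind ρ 𝓕.sheaf).sec U) (hx : EquivSheaf.app (mulLeft 𝓕 c) U x = x) :
    EquivSheaf.app (unit 𝓕) U
      (eval 1 (𝟙 U.sch) (EquivSheaf.semilinear_one ρ (Category.id_comp U.str)) x) = x := by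
  set x₀ := eval (A := 𝓕.sheaf) 1 (𝟙 U.sch)
    (EquivSheaf.semilinear_one ρ (Category.id_comp U.str)) x with hx₀
  have key {h : H} {P Q : Ebar k E} {j : P.sch ⟶ Q.sch}
      (wj : j ≫ Q.str ≫ galAct X (ρ c) = P.str) {f : Q.sch ⟶ U.sch}
      (wf : f ≫ U.str ≫ galAct X (ρ h) = Q.str) :
      eval (c * h) (j ≫ f) (EquivSheaf.semilinear_comp' wf wj) x =
        𝓕.pull c j wj (eval h f wf x) := by
    have := eval_mulLeft wj wf x
    rwa [hx] at this
  refine ext fun g => ?_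
  obtain ⟨n, hn⟩ := hc g
  obtain rfl : c ^ n = g := hn
  induction n with
  | zero =>
    intro P f w
    refine (eval_unit 𝓕 w x₀).trans ?_
    have w1 : f ≫ U.str ≫ galAct X (ρ 1) = P.str := by simpa using w
    have w2 : f ≫ U.str = P.str := by rwa [map_one, galAct_one, Category.comp_id] at w1
    refine (𝓕.pull_congr (zpow_zero c) rfl _ _).trans ?_
    refine (𝓕.res_eq_pull (Ebar.mkHom f w2 : P ⟶ U) x₀).symm.trans ?_
    refine (res_eval _ (Ebar.mkHom f w2 : P ⟶ U) x).trans ?_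
    exact eval_congr (zpow_zero c).symm (Category.comp_id f) _ x
  | succ n ih =>
    intro P l w
    have e : c ^ ((n : ℤ) + 1) = c * c ^ (n : ℤ) := by rw [add_comm, zpow_add, zpow_one]
    have wf : l ≫ U.str ≫ galAct X (ρ (c ^ (n : ℤ))) = ((Ebar.twist (ρ c)⁻¹).obj P).str := by
      have := EquivSheaf.semilinear_inv_mul (c := c) w
      rwa [e, inv_mul_cancel_left] at this
    have h1 := key (P := P) (EquivSheaf.semilinear_untwist (ρ c) P) wf
    refine Eq.trans ?_ (h1.symm.trans (eval_congr e.symm (Category.id_comp l) _ x))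
    rw [← ih ((Ebar.twist (ρ c)⁻¹).obj P) l wf]
    refine Eq.trans ?_ ((congrArg _ (eval_unit 𝓕 wf x₀)).trans (𝓕.pull_pull wf _ x₀)).symm
    exact (eval_unit 𝓕 w x₀).trans (𝓕.pull_congr e (Category.id_comp l).symm _ _)
  | pred n ih =>
    intro P l w
    have e : c ^ (-(n : ℤ)) = c * c ^ (-(n : ℤ) - 1) := by
      rw [zpow_sub_one, ← zpow_sub_one, ← zpow_one_add]; congr 1; ring
    obtain ⟨Q, j, hj, wj⟩ := EquivSheaf.exists_twist (ρ c) P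
    refine 𝓕.pull_injective hj wj ?_
    refine Eq.trans ?_ (key wj w)
    have w' : (j ≫ l) ≫ U.str ≫ galAct X (ρ (c ^ (-(n : ℤ)))) = Q.str := by
      rw [e]
      exact EquivSheaf.semilinear_comp' w wj
    refine Eq.trans ?_ ((ih Q (j ≫ l) w').trans (eval_congr e rfl w' x))
    refine (congrArg _ (eval_unit 𝓕 w x₀)).trans ((𝓕.pull_pull w wj x₀).trans ?_)
    exact (𝓕.pull_congr e.symm rfl _ _).trans (eval_unit 𝓕 w' x₀).symm

end coind

end Coinduced

end

end WeilEtale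

namespace WeilEtale

noncomputable section

variable {F k : Type u} [Field F] [Fintype F] [Field k] [Algebra F k] [IsAlgClosure F k]
  {X : Over (Spec (.of F))} {E : SchemeSubcategory X}

lemma frobPow_add (a b : ℤ) : frobPow F k (a + b) = frobPow F k a * frobPow F k b :=
  Subtype.ext (zpow_add _ _ _)

lemma frobPow_zero : frobPow F k 0 = 1 := Subtype.ext (zpow_zero _)

lemma semilinear_eq_comp_snd {U V : Ebar k E} {f : U.sch ⟶ V.sch} {g : Gal(k/F)}
    (w : f ≫ V.str ≫ galAct X g = U.str) :
    f ≫ V.str ≫ pullback.snd _ _ = (U.str ≫ pullback.snd _ _) ≫ galSpec g⁻¹ := by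
  rw [← Category.assoc, Ebar.eq_comp_galAct_inv w, Category.assoc, galAct_snd, Category.assoc]

namespace Model

variable {U V W : Ebar k E} {K K' : IntermediateField F k} (M : Model U K) (N : Model V K')

/-- A semilinear morphism commutes with the actions of a small subgroup of the Galois group given
by models of its source and its target. -/
lemma exists_act_comp_eq_comp_act [FiniteDimensional F K] [FiniteDimensional F K'] {f : U.sch ⟶ V.sch}
    {g : Gal(k/F)} (w : f ≫ V.str ≫ galAct X g = U.str) :
    ∃ (n : ℕ) (_ : 0 < n) (hn : frob F k ^ n ∈ K.fixingSubgroup)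
      (hn' : frob F k ^ n ∈ K'.fixingSubgroup),
      ∀ (y : Gal(k/F)) (hy : y ∈ (levelField F k n).fixingSubgroup),
        M.act y (fixingSubgroup_levelField_le hn hy) ≫ f =
          f ≫ N.act y (fixingSubgroup_levelField_le hn' hy) := by
  have := N.locallyOfFiniteType
  have : LocallyOfFiniteType (specBot F K') := by
    rw [HasRingHomProperty.Spec_iff (P := @LocallyOfFiniteType)]
    exact RingHom.finiteType_algebraMap.2 inferInstance
  have hf := semilinear_eq_comp_snd w
  obtain ⟨n, hn0, hn, h⟩ := M.exists_act_comp_eq (N.toField ≫ specBot F K') (f ≫ N.proj) (by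
    rw [Category.assoc, ← Category.assoc N.proj, N.isPullback.w, Category.assoc _ _ (specBot F K'),
      specTo_specBot, ← Category.assoc f, hf, Category.assoc,
      galSpec_specAlg])
  obtain ⟨n', hn0', hn'⟩ := exists_le_levelField K'
  refine ⟨n * n', Nat.mul_pos hn0 hn0', pow_mul_mem hn _, by
    rw [mul_comm]; exact pow_mul_mem hn' _, fun y hy => ?_⟩
  apply N.isPullback.hom_ext
  · rw [Category.assoc, Category.assoc, act_proj]
    exact h y (fixingSubgroup_levelField_le (pow_mul_mem (frob_pow_mem_levelField n) n') hy)
  · rw [Category.assoc, Category.assoc, act_snd, hf, ← Category.assoc f, hf, ← Category.assoc,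
      act_snd, Category.assoc _ (galSpec y), Category.assoc _ (galSpec g⁻¹), ← galSpec_mul,
      ← galSpec_mul, gal_mul_comm]

variable {M N} in
lemma act_congr {y y' : Gal(k/F)} (h : y = y') (hy : y ∈ K.fixingSubgroup)
    (hy' : y' ∈ K.fixingSubgroup) : M.act y hy = M.act y' hy' := by
  subst h
  rfl

lemma semilinear_act {f : V.sch ⟶ U.sch} {g h y : Gal(k/F)} (hy : y ∈ K.fixingSubgroup)
    (w : f ≫ U.str ≫ galAct X g = V.str) (e : g = y * h) :
    (f ≫ M.act y hy) ≫ U.str ≫ galAct X h = V.str := by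
  rw [← w, e, galAct_mul, Category.assoc, ← Category.assoc (M.act y hy), act_str, Category.assoc]

lemma semilinear_act_self {h y : Gal(k/F)} (hy : y ∈ K.fixingSubgroup) (e : y * h = 1) :
    M.act y hy ≫ U.str ≫ galAct X h = U.str := by
  rw [← Category.assoc, act_str, Category.assoc, ← galAct_mul, e, galAct_one, Category.comp_id]

end Model

namespace EquivSheaf

lemma pull_pull_eq {H : Type u} [Group H] {ρ : H →* Gal(k/F)} (𝓕 : EquivSheaf E ρ)
    {U V W : Ebar k E} {c g h : H} (hc : c = g * h) {f : V.sch ⟶ U.sch}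
    (w : f ≫ U.str ≫ galAct X (ρ h) = V.str) {f' : W.sch ⟶ V.sch}
    (w' : f' ≫ V.str ≫ galAct X (ρ g) = W.str) {f'' : W.sch ⟶ U.sch} (hf : f'' = f' ≫ f)
    (w'' : f'' ≫ U.str ≫ galAct X (ρ c) = W.str) (x : 𝓕.sec U) :
    𝓕.pull g f' w' (𝓕.pull h f w x) = 𝓕.pull c f'' w'' x := by
  subst hc hf
  exact 𝓕.pull_pull w w' x

variable (𝓕 : WeilSheaf k E) {U V W : Ebar k E}

/-- The map `𝓕(U) → 𝓕(V)` given by a `φ^b`-semilinear morphism `V ⟶ U`. -/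
def frobPull (b : ℤ) (f : V.sch ⟶ U.sch) (w : f ≫ U.str ≫ galAct X (frob F k ^ b) = V.str) :
    𝓕.sec U →+ 𝓕.sec V := 𝓕.pull (frobPow F k b) f w

lemma frobPull_congr {b b' : ℤ} {f f' : V.sch ⟶ U.sch} (hb : b = b') (hf : f = f')
    (w : f ≫ U.str ≫ galAct X (frob F k ^ b) = V.str)
    (w' : f' ≫ U.str ≫ galAct X (frob F k ^ b') = V.str) (x : 𝓕.sec U) :
    𝓕.frobPull b f w x = 𝓕.frobPull b' f' w' x := by
  subst hb hf
  rfl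

lemma semilinear_frob_comp {a b : ℤ} {f : V.sch ⟶ U.sch}
    (w : f ≫ U.str ≫ galAct X (frob F k ^ b) = V.str) {f' : W.sch ⟶ V.sch}
    (w' : f' ≫ V.str ≫ galAct X (frob F k ^ a) = W.str) :
    (f' ≫ f) ≫ U.str ≫ galAct X (frob F k ^ (a + b)) = W.str := by
  rw [zpow_add]
  exact semilinear_comp w w'

lemma frobPull_frobPull {a b c : ℤ} (hc : c = a + b) {f : V.sch ⟶ U.sch}
    (w : f ≫ U.str ≫ galAct X (frob F k ^ b) = V.str) {f' : W.sch ⟶ V.sch}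
    (w' : f' ≫ V.str ≫ galAct X (frob F k ^ a) = W.str) {f'' : W.sch ⟶ U.sch}
    (hf : f'' = f' ≫ f) (w'' : f'' ≫ U.str ≫ galAct X (frob F k ^ c) = W.str) (x : 𝓕.sec U) :
    𝓕.frobPull a f' w' (𝓕.frobPull b f w x) = 𝓕.frobPull c f'' w'' x := by
  exact 𝓕.pull_pull_eq (g := frobPow F k a) (h := frobPow F k b) (c := frobPow F k c)
    (by rw [hc, frobPow_add]) w w' hf w'' x

lemma frobPull_one {b : ℤ} (hb : b = 0) {f : U.sch ⟶ U.sch} (hf : f = 𝟙 _) (w) (x : 𝓕.sec U) :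
    𝓕.frobPull b f w x = x :=
  𝓕.pull_one hf (by rw [hb, frobPow_zero]) _ x

lemma semilinear_frob_zero {f : V.sch ⟶ U.sch} (w : f ≫ U.str = V.str) :
    f ≫ U.str ≫ galAct X (frob F k ^ (0 : ℤ)) = V.str := by
  rw [zpow_zero, galAct_one, Category.comp_id, w]

lemma res_eq_frobPull (f : V ⟶ U) (x : 𝓕.sec U) :
    𝓕.res f x = 𝓕.frobPull 0 f.hom.left (semilinear_frob_zero (Over.w f.hom)) x :=
  (𝓕.res_eq_pull f x).trans (𝓕.pull_congr frobPow_zero.symm rfl _ x)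

lemma app_frobPull {𝓕 𝓖 : WeilSheaf k E} (a : 𝓕 ⟶ 𝓖) {b : ℤ} {f : V.sch ⟶ U.sch}
    (w : f ≫ U.str ≫ galAct X (frob F k ^ b) = V.str) (x : 𝓕.sec U) :
    app a V (𝓕.frobPull b f w x) = 𝓖.frobPull b f w (app a U x) := app_pull a _ x

/-- The section `x` of `𝓕` over `U = U' ×_K k` is invariant under `φ^m`. -/
def FixedBy {K : IntermediateField F k} (M : Model U K) (m : ℕ) (x : 𝓕.sec U) : Prop :=
  ∃ hm : frob F k ^ m ∈ K.fixingSubgroup,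
    𝓕.frobPull m (M.act (frob F k ^ m)⁻¹ (inv_mem hm)) (M.semilinear_act_self _ (by simp)) x = x

variable {𝓕} {K K' : IntermediateField F k} {M : Model U K} {N : Model V K'} {m : ℕ}
  {x : 𝓕.sec U}

lemma FixedBy.mem (h : 𝓕.FixedBy M m x) : frob F k ^ m ∈ K.fixingSubgroup := h.1

/-- The group of periods of a section. -/
def periodGroup (M : Model U K) (x : 𝓕.sec U) : AddSubgroup ℤ where
  carrier := { b | ∃ hb : frob F k ^ b ∈ K.fixingSubgroup,
    𝓕.frobPull b (M.act (frob F k ^ b)⁻¹ (inv_mem hb)) (M.semilinear_act_self _ (by simp)) x = x }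
  zero_mem' := ⟨by simp, 𝓕.frobPull_one rfl
    ((Model.act_congr (by simp) _ (one_mem _)).trans (M.act_one (one_mem _))) _ x⟩
  add_mem' := by
    rintro a b ⟨ha, ha'⟩ ⟨hb, hb'⟩
    refine ⟨by rw [zpow_add]; exact mul_mem ha hb, ?_⟩
    conv_rhs => rw [← ha', ← hb']
    refine (𝓕.frobPull_frobPull rfl _ _ ?_ _ x).symm
    rw [← M.act_mul]
    exact Model.act_congr (by rw [zpow_add, mul_inv_rev, gal_mul_comm]) _ _
  neg_mem' := by
    rintro a ⟨ha, ha'⟩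
    refine ⟨by rw [zpow_neg]; exact inv_mem ha, ?_⟩
    conv_lhs => rw [← ha']
    rw [𝓕.frobPull_frobPull (neg_add_cancel a).symm _ _ rfl (by
      rw [← M.act_mul]; exact M.semilinear_act_self _ (by simp)) x]
    refine 𝓕.frobPull_one rfl ?_ _ x
    rw [← M.act_mul]
    exact (Model.act_congr (by simp) _ (one_mem _)).trans (M.act_one (one_mem _))

lemma FixedBy.mem_periodGroup (h : 𝓕.FixedBy M m x) : (m : ℤ) ∈ periodGroup M x := by
  obtain ⟨h1, h2⟩ := h
  exact ⟨by simpa using h1, (𝓕.frobPull_congr rfl (Model.act_congr (by simp) _ _) _ _ x).trans h2⟩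

lemma FixedBy.frobPull_eq (h : 𝓕.FixedBy M m x) {b : ℤ} (hb : (m : ℤ) ∣ b) {y : Gal(k/F)}
    (hy : y ∈ K.fixingSubgroup) (e : y * frob F k ^ b = 1) :
    𝓕.frobPull b (M.act y hy) (M.semilinear_act_self hy e) x = x := by
  obtain ⟨z, rfl⟩ := hb
  have := (periodGroup M x).zsmul_mem h.mem_periodGroup z
  rw [smul_eq_mul, mul_comm] at this
  obtain ⟨h1, h2⟩ := this
  exact (𝓕.frobPull_congr rfl (Model.act_congr (eq_inv_of_mul_eq_one_left e) _ _) _ _ x).trans h2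

lemma FixedBy.of_dvd (h : 𝓕.FixedBy M m x) {n : ℕ} (hn : m ∣ n) : 𝓕.FixedBy M n x := by
  obtain ⟨z, rfl⟩ := hn
  refine ⟨by rw [pow_mul]; exact pow_mem h.mem z, h.frobPull_eq (by simp) _
    (by rw [zpow_natCast, inv_mul_cancel])⟩

/-- Invariant sections are mapped to invariant sections by semilinear morphisms. -/
lemma FixedBy.pull (h : 𝓕.FixedBy M m x) {b : ℤ} {f : V.sch ⟶ U.sch}
    (w : f ≫ U.str ≫ galAct X (frob F k ^ b) = V.str) {n : ℕ}
    (hn : frob F k ^ n ∈ K.fixingSubgroup) (hn' : frob F k ^ n ∈ K'.fixingSubgroup) (hmn : m ∣ n)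
    (hf : N.act (frob F k ^ n)⁻¹ (inv_mem hn') ≫ f = f ≫ M.act (frob F k ^ n)⁻¹ (inv_mem hn)) :
    𝓕.FixedBy N n (𝓕.frobPull b f w x) := by
  refine ⟨hn', ?_⟩
  have h1 := (h.of_dvd hmn).frobPull_eq dvd_rfl (inv_mem hn) (by simp)
  have w' : (N.act (frob F k ^ n)⁻¹ (inv_mem hn') ≫ f) ≫ U.str ≫
      galAct X (frob F k ^ ((n : ℤ) + b)) = V.str :=
    semilinear_frob_comp w (N.semilinear_act_self _ (by simp))
  rw [𝓕.frobPull_frobPull rfl _ _ rfl w' x]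
  conv_rhs => rw [← h1]
  exact (𝓕.frobPull_frobPull (add_comm _ _) _ _ hf w' x).symm

end EquivSheaf

end

end WeilEtale

namespace WeilEtale

noncomputable section

variable {F k : Type u} [Field F] [Fintype F] [Field k] [Algebra F k] [IsAlgClosure F k]
  {X : Over (Spec (.of F))} {E : SchemeSubcategory X}

lemma exists_frob_factor (g : Gal(k/F)) {m : ℕ} (hm : 0 < m) :
    ∃ (b : ℤ) (y : Gal(k/F)), y ∈ (levelField F k m).fixingSubgroup ∧ g = y * frob F k ^ b := by
  obtain ⟨b, hb⟩ := exists_frob_zpow_mem g hm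
  exact ⟨b, _, hb, (inv_mul_cancel_right _ _).symm⟩

lemma fixingSubgroup_levelField_mono {m n : ℕ} (h : m ∣ n) :
    (levelField F k n).fixingSubgroup ≤ (levelField F k m).fixingSubgroup := by
  obtain ⟨z, rfl⟩ := h
  exact fun y hy => fixingSubgroup_levelField_le (pow_mul_mem (frob_pow_mem_levelField m) z) hy

namespace Model

variable {U V W : Ebar k E} {K K' : IntermediateField F k}

/-- A semilinear morphism commutes with the actions of a small subgroup of the Galois group given
by models of its source and its target. -/
lemma exists_forall_act_comm [FiniteDimensional F K] [FiniteDimensional F K'] (N : Model V K')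
    (M : Model U K) {f : V.sch ⟶ U.sch}
    {g : Gal(k/F)} (w : f ≫ U.str ≫ galAct X g = V.str) :
    ∃ n : ℕ, 0 < n ∧ frob F k ^ n ∈ K.fixingSubgroup ∧ frob F k ^ n ∈ K'.fixingSubgroup ∧
      ∀ (y : Gal(k/F)) (_ : y ∈ (levelField F k n).fixingSubgroup) (hy : y ∈ K.fixingSubgroup)
        (hy' : y ∈ K'.fixingSubgroup), N.act y hy' ≫ f = f ≫ M.act y hy := by
  obtain ⟨n, hn0, hn', hn, h⟩ := N.exists_act_comp_eq_comp_act M w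
  exact ⟨n, hn0, hn, hn', fun y hy _ _ => h y hy⟩

end Model

lemma frob_pow_inv_mem {m n : ℕ} (h : m ∣ n) :
    (frob F k ^ n)⁻¹ ∈ (levelField F k m).fixingSubgroup :=
  fixingSubgroup_levelField_mono h (inv_mem (frob_pow_mem_levelField n))

namespace EquivSheaf

variable {𝓕 : WeilSheaf k E} {U V W : Ebar k E}

/-- A section is smooth if it is invariant under some power of the Frobenius. -/
def IsSmooth (x : 𝓕.sec U) : Prop :=
  ∃ (K : IntermediateField F k) (_ : FiniteDimensional F K) (M : Model U K) (m : ℕ),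
    0 < m ∧ 𝓕.FixedBy M m x

variable {K K' : IntermediateField F k} {M : Model U K} {N : Model V K'} {m : ℕ} {x : 𝓕.sec U}

lemma FixedBy.isSmooth [FiniteDimensional F K] (hm : 0 < m) (h : 𝓕.FixedBy M m x) :
    IsSmooth x := ⟨K, ‹_›, M, m, hm, h⟩

lemma FixedBy.exists_frobPull [FiniteDimensional F K] [FiniteDimensional F K'] (hm : 0 < m)
    (h : 𝓕.FixedBy M m x) (N : Model V K') {b : ℤ} {f : V.sch ⟶ U.sch}
    (w : f ≫ U.str ≫ galAct X (frob F k ^ b) = V.str) :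
    ∃ n, 0 < n ∧ m ∣ n ∧ 𝓕.FixedBy N n (𝓕.frobPull b f w x) := by
  obtain ⟨n, hn0, hn, hn', hf⟩ := N.exists_forall_act_comm M w
  refine ⟨n * m, Nat.mul_pos hn0 hm, dvd_mul_left _ _, h.pull w (pow_mul_mem hn m)
    (pow_mul_mem hn' m) (dvd_mul_left _ _) (hf _ (frob_pow_inv_mem (dvd_mul_right _ _)) _ _)⟩

lemma IsSmooth.exists_fixedBy (h : IsSmooth x) {K : IntermediateField F k}
    [FiniteDimensional F K] (M : Model U K) : ∃ n, 0 < n ∧ 𝓕.FixedBy M n x := by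
  obtain ⟨K', _, M', m, hm, hx⟩ := h
  obtain ⟨n, hn0, -, hn⟩ := hx.exists_frobPull hm M (b := 0) (f := 𝟙 U.sch)
    (semilinear_frob_zero (Category.id_comp _))
  refine ⟨n, hn0, ?_⟩
  rwa [𝓕.frobPull_one rfl rfl] at hn

lemma IsSmooth.frobPull (h : IsSmooth x) {b : ℤ} {f : V.sch ⟶ U.sch}
    (w : f ≫ U.str ≫ galAct X (frob F k ^ b) = V.str) : IsSmooth (𝓕.frobPull b f w x) := by
  obtain ⟨K', _, M', m, hm, hx⟩ := h
  obtain ⟨K, _, ⟨N⟩⟩ := exists_model V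
  obtain ⟨n, hn0, -, hn⟩ := hx.exists_frobPull hm N w
  exact hn.isSmooth hn0

lemma IsSmooth.res (h : IsSmooth x) (f : V ⟶ U) : IsSmooth (𝓕.res f x) := by
  rw [res_eq_frobPull]
  exact h.frobPull _

lemma IsSmooth.app {𝓖 : WeilSheaf k E} (h : IsSmooth x) (a : 𝓕 ⟶ 𝓖) :
    IsSmooth (EquivSheaf.app a U x) := by
  obtain ⟨K', _, M', m, hm, hm', hx⟩ := h
  exact ⟨K', ‹_›, M', m, hm, hm', (app_frobPull a _ x).symm.trans (congrArg _ hx)⟩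

variable (𝓕 U) in
/-- The group of smooth sections. -/
def smooth : AddSubgroup (𝓕.sec U) where
  carrier := { x | IsSmooth x }
  zero_mem' := by
    obtain ⟨K, _, ⟨M⟩⟩ := exists_model U
    obtain ⟨m, hm, hm'⟩ := exists_le_levelField K
    exact ⟨K, ‹_›, M, m, hm, hm', map_zero _⟩
  add_mem' {x y} hx hy := by
    obtain ⟨K, _, ⟨M⟩⟩ := exists_model U
    obtain ⟨m, hm, hx⟩ := IsSmooth.exists_fixedBy hx M
    obtain ⟨n, hn, hy⟩ := IsSmooth.exists_fixedBy hy M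
    have h1 := hx.of_dvd (dvd_mul_right m n)
    have h2 := hy.of_dvd (dvd_mul_left n m)
    exact ⟨K, ‹_›, M, m * n, Nat.mul_pos hm hn, h1.1,
      (map_add _ x y).trans (congrArg₂ (· + ·) h1.2 h2.2)⟩
  neg_mem' {x} hx := by
    obtain ⟨K, _, M, m, hm, hm', hx⟩ := hx
    exact ⟨K, ‹_›, M, m, hm, hm', (map_neg _ x).trans (congrArg _ hx)⟩

/-- Two ways to write `g` as the product of a power of the Frobenius and an element of a small
subgroup give the same map on invariant sections. -/
lemma FixedBy.frobPull_act_eq (hm : 0 < m) (h : 𝓕.FixedBy M m x) {f : V.sch ⟶ U.sch}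
    {g : Gal(k/F)} (w : f ≫ U.str ≫ galAct X g = V.str) {b b' : ℤ} {y y' : Gal(k/F)}
    (hy : y ∈ (levelField F k m).fixingSubgroup) (hy' : y' ∈ (levelField F k m).fixingSubgroup)
    (hyK : y ∈ K.fixingSubgroup) (hyK' : y' ∈ K.fixingSubgroup)
    (e : g = y * frob F k ^ b) (e' : g = y' * frob F k ^ b') :
    𝓕.frobPull b (f ≫ M.act y hyK) (M.semilinear_act _ w e) x =
      𝓕.frobPull b' (f ≫ M.act y' hyK') (M.semilinear_act _ w e') x := by
  have h1 : frob F k ^ (b - b') = y⁻¹ * y' := by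
    rw [zpow_sub, mul_inv_eq_iff_eq_mul, mul_assoc, ← e', e, inv_mul_cancel_left]
  have h2 : (m : ℤ) ∣ b' - b := by
    rw [← Int.dvd_neg, neg_sub]
    exact dvd_of_frob_zpow_mem hm (by rw [h1]; exact mul_mem (inv_mem hy) hy')
  have h3 := h.frobPull_eq h2 (mul_mem (inv_mem hyK) hyK')
    (by rw [← h1, ← zpow_add]; simp)
  conv_lhs => rw [← h3]
  refine 𝓕.frobPull_frobPull (by ring) _ _ ?_ _ x
  rw [Category.assoc, ← M.act_mul]
  congr 1
  exact Model.act_congr (by rw [mul_inv_cancel_left]) _ _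

lemma IsSmooth.exists_galPull (h : IsSmooth x) {f : V.sch ⟶ U.sch}
    {g : Gal(k/F)} (w : f ≫ U.str ≫ galAct X g = V.str) :
    ∃ z : 𝓕.sec V, ∀ (K : IntermediateField F k) [FiniteDimensional F K] (M : Model U K) (m : ℕ)
      (_ : 0 < m) (_ : 𝓕.FixedBy M m x) (b : ℤ) (y : Gal(k/F))
      (_ : y ∈ (levelField F k m).fixingSubgroup) (hyK : y ∈ K.fixingSubgroup)
      (e : g = y * frob F k ^ b),
      z = 𝓕.frobPull b (f ≫ M.act y hyK) (M.semilinear_act hyK w e) x := by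
  obtain ⟨K₀, _, M₀, m₀, hm₀, h₀⟩ := h
  obtain ⟨b₀, y₀, hy₀, e₀⟩ := exists_frob_factor g hm₀
  have hyK₀ := fixingSubgroup_levelField_le h₀.mem hy₀
  refine ⟨𝓕.frobPull b₀ (f ≫ M₀.act y₀ hyK₀) (M₀.semilinear_act hyK₀ w e₀) x,
    fun K _ M m hm h b y hy hyK e => ?_⟩
  obtain ⟨n, hn0, hn, hn', hf⟩ := M₀.exists_forall_act_comm M
    (semilinear_frob_zero (Category.id_comp U.str))
  have hN : 0 < n * (m₀ * m) := Nat.mul_pos hn0 (Nat.mul_pos hm₀ hm)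
  obtain ⟨c, z, hz, ez⟩ := exists_frob_factor g hN
  have hz0 := fixingSubgroup_levelField_mono (dvd_mul_of_dvd_right (dvd_mul_right m₀ m) n) hz
  have hz1 := fixingSubgroup_levelField_mono (dvd_mul_of_dvd_right (dvd_mul_left m m₀) n) hz
  have hz2 := fixingSubgroup_levelField_mono (dvd_mul_right n (m₀ * m)) hz
  have hzK := fixingSubgroup_levelField_le h.mem hz1
  have hzK₀ := fixingSubgroup_levelField_le h₀.mem hz0
  rw [h.frobPull_act_eq hm w hy hz1 hyK hzK e ez,
    h₀.frobPull_act_eq hm₀ w hy₀ hz0 hyK₀ hzK₀ e₀ ez]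
  refine 𝓕.frobPull_congr rfl ?_ _ _ x
  have := hf z hz2 hzK hzK₀
  rw [Category.comp_id, Category.id_comp] at this
  rw [this]

/-- The image of a smooth section under a semilinear morphism. -/
def galPull (x : 𝓕.sec U) (h : IsSmooth x) {g : Gal(k/F)} (f : V.sch ⟶ U.sch)
    (w : f ≫ U.str ≫ galAct X g = V.str) : 𝓕.sec V := (h.exists_galPull w).choose

lemma galPull_eq (h : IsSmooth x) {g : Gal(k/F)} {f : V.sch ⟶ U.sch}
    (w : f ≫ U.str ≫ galAct X g = V.str) [FiniteDimensional F K] (hm : 0 < m)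
    (hx : 𝓕.FixedBy M m x) {b : ℤ} {y : Gal(k/F)} (hy : y ∈ (levelField F k m).fixingSubgroup)
    (hyK : y ∈ K.fixingSubgroup) (e : g = y * frob F k ^ b) :
    galPull x h f w = 𝓕.frobPull b (f ≫ M.act y hyK) (M.semilinear_act hyK w e) x :=
  (h.exists_galPull w).choose_spec K M m hm hx b y hy hyK e

lemma isSmooth_galPull (h : IsSmooth x) {g : Gal(k/F)} {f : V.sch ⟶ U.sch}
    (w : f ≫ U.str ≫ galAct X g = V.str) : IsSmooth (galPull x h f w) := by
  obtain ⟨K, _, M, m, hm, hx⟩ := id h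
  obtain ⟨b, y, hy, e⟩ := exists_frob_factor g hm
  rw [galPull_eq h w hm hx hy (fixingSubgroup_levelField_le hx.mem hy) e]
  exact h.frobPull _

lemma galPull_add {x' : 𝓕.sec U} (h : IsSmooth x) (h' : IsSmooth x') (h'' : IsSmooth (x + x'))
    {g : Gal(k/F)} {f : V.sch ⟶ U.sch} (w : f ≫ U.str ≫ galAct X g = V.str) :
    galPull (x + x') h'' f w = galPull x h f w + galPull x' h' f w := by
  obtain ⟨K, _, M, m, hm, hx⟩ := id h
  obtain ⟨m', hm', hx'⟩ := h'.exists_fixedBy M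
  obtain ⟨m'', hm'', hx''⟩ := h''.exists_fixedBy M
  have hn : 0 < m * (m' * m'') := by positivity
  obtain ⟨b, y, hy, e⟩ := exists_frob_factor g hn
  have k1 := hx.of_dvd (n := m * (m' * m'')) (dvd_mul_right _ _)
  have k2 := hx'.of_dvd (n := m * (m' * m'')) (dvd_mul_of_dvd_right (dvd_mul_right _ _) _)
  have k3 := hx''.of_dvd (n := m * (m' * m'')) (dvd_mul_of_dvd_right (dvd_mul_left _ _) _)
  have hyK := fixingSubgroup_levelField_le k1.mem hy
  rw [galPull_eq h w hn k1 hy hyK e, galPull_eq h' w hn k2 hy hyK e,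
    galPull_eq h'' w hn k3 hy hyK e, map_add]

lemma galPull_galPull (h : IsSmooth x) {g : Gal(k/F)} {f : V.sch ⟶ U.sch}
    (w : f ≫ U.str ≫ galAct X g = V.str) (h' : IsSmooth (galPull x h f w)) {g' : Gal(k/F)}
    {f' : W.sch ⟶ V.sch} (w' : f' ≫ V.str ≫ galAct X g' = W.str)
    (w'' : (f' ≫ f) ≫ U.str ≫ galAct X (g' * g) = W.str) :
    galPull (galPull x h f w) h' f' w' = galPull x h (f' ≫ f) w'' := by
  obtain ⟨K, _, M, m, hm, hx⟩ := id h
  obtain ⟨K', _, N, m', hm', hx'⟩ := id h'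
  obtain ⟨n, hn0, hn, hn', hf⟩ := N.exists_forall_act_comm M w
  have hd1 : m ∣ n * (m * m') := dvd_mul_of_dvd_right (dvd_mul_right _ _) _
  have hd2 : m' ∣ n * (m * m') := dvd_mul_of_dvd_right (dvd_mul_left _ _) _
  have hN : 0 < n * (m * m') := by positivity
  obtain ⟨b, y, hy, e⟩ := exists_frob_factor g hN
  obtain ⟨b', y', hy', e'⟩ := exists_frob_factor g' hN
  have hyK := fixingSubgroup_levelField_le (hx.of_dvd hd1).mem hy
  have hyK' := fixingSubgroup_levelField_le (hx.of_dvd hd1).mem hy'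
  have hyN := fixingSubgroup_levelField_le (hx'.of_dvd hd2).mem hy'
  rw [galPull_eq h' w' hN (hx'.of_dvd hd2) hy' hyN e']
  have h1 := galPull_eq h w hN (hx.of_dvd hd1) hy hyK e
  rw [galPull_eq h w'' hN (hx.of_dvd hd1) (mul_mem hy' hy) (mul_mem hyK' hyK)
    (b := b' + b) (by rw [e, e', zpow_add, mul_assoc, mul_assoc, gal_mul_comm (frob F k ^ b'),
      gal_mul_comm (frob F k ^ b'), mul_assoc])]
  refine (congrArg _ h1).trans (𝓕.frobPull_frobPull rfl _ _ ?_ _ x)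
  have := hf y' (fixingSubgroup_levelField_mono (dvd_mul_right _ _) hy') hyK' hyN
  rw [M.act_mul _ _ hyK' hyK, Category.assoc, Category.assoc, reassoc_of% this]

lemma galPull_of_eq_frob_zpow (h : IsSmooth x) {g : Gal(k/F)} {f : V.sch ⟶ U.sch}
    (w : f ≫ U.str ≫ galAct X g = V.str) {b : ℤ} (e : g = frob F k ^ b)
    (w' : f ≫ U.str ≫ galAct X (frob F k ^ b) = V.str) :
    galPull x h f w = 𝓕.frobPull b f w' x := by
  obtain ⟨K, _, M, m, hm, hx⟩ := id h
  rw [galPull_eq h w hm hx (one_mem _) (one_mem _) (b := b) (by rw [e, one_mul])]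
  exact 𝓕.frobPull_congr rfl (by rw [M.act_one, Category.comp_id]) _ _ x

lemma app_galPull {𝓖 : WeilSheaf k E} (a : 𝓕 ⟶ 𝓖) (h : IsSmooth x) {g : Gal(k/F)}
    {f : V.sch ⟶ U.sch} (w : f ≫ U.str ≫ galAct X g = V.str) :
    EquivSheaf.app a V (galPull x h f w) = galPull (EquivSheaf.app a U x) (h.app a) f w := by
  obtain ⟨K, _, M, m, hm, hx⟩ := id h
  obtain ⟨b, y, hy, e⟩ := exists_frob_factor g hm
  have hyK := fixingSubgroup_levelField_le hx.mem hy
  rw [galPull_eq h w hm hx hy hyK e, galPull_eq (h.app a) w hm (M := M) ⟨hx.mem, ?_⟩ hy hyK e]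
  · exact app_frobPull a _ x
  · exact (app_frobPull a _ x).symm.trans (congrArg _ hx.2)

lemma galPull_congr (h : IsSmooth x) {x' : 𝓕.sec U} (hx : x = x') (h' : IsSmooth x')
    {g g' : Gal(k/F)} (hg : g = g') {f f' : V.sch ⟶ U.sch} (hf : f = f')
    (w : f ≫ U.str ≫ galAct X g = V.str) (w' : f' ≫ U.str ≫ galAct X g' = V.str) :
    galPull x h f w = galPull x' h' f' w' := by
  subst hx hg hf
  rfl

end EquivSheaf

end

end WeilEtale

namespace WeilEtale

noncomputable section

variable {F k : Type u} [Field F] [Fintype F] [Field k] [Algebra F k] [IsAlgClosure F k]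
  {X : Over (Spec (.of F))} {E : SchemeSubcategory X}

/-- A covering sieve contains a finite jointly surjective family of étale morphisms. -/
lemma Ebar.exists_finite_cover {U : Ebar k E} {S : Sieve U} (hS : S ∈ etaleTopology E U) :
    ∃ (n : ℕ) (V : Fin n → Ebar k E) (f : ∀ i, V i ⟶ U), (∀ i, S (f i)) ∧
      (∀ i, Etale (f i).hom.left) ∧ ∀ u : U.sch, ∃ (i : Fin n) (v : (V i).sch),
        (f i).hom.left v = u := by
  choose W h w h1 h2 h3 using fun u : U.sch => hS (𝟙 U) u
  have hopen (u : U.sch) : IsOpen (Set.range (h u).hom.left) := by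
    have := h2 u
    exact (h u).hom.left.isOpenMap.isOpen_range
  obtain ⟨t, ht⟩ := isCompact_univ.elim_finite_subcover (fun u => Set.range (h u).hom.left) hopen
    (fun u _ => Set.mem_iUnion.2 ⟨u, w u, h3 u⟩)
  refine ⟨t.card, fun i => W (t.equivFin.symm i), fun i => h (t.equivFin.symm i),
    fun i => by simpa using h1 _, fun i => h2 _, fun u => ?_⟩
  obtain ⟨u', hu'⟩ := Set.mem_iUnion.1 (ht (Set.mem_univ u))
  obtain ⟨hu't, v, hv⟩ := Set.mem_iUnion.1 hu'
  obtain ⟨i, hi⟩ := t.equivFin.symm.surjective ⟨u', hu't⟩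
  refine ⟨i, ?_⟩
  change ∃ v : (W (t.equivFin.symm i)).sch, (h (t.equivFin.symm i)).hom.left v = u
  rw [hi]
  exact ⟨v, hv⟩

/-- A sieve containing a jointly surjective family of étale morphisms is covering. -/
lemma Ebar.mem_of_cover {U : Ebar k E} {S : Sieve U} {ι : Type*} {V : ι → Ebar k E}
    {f : ∀ i, V i ⟶ U} (hf : ∀ i, S (f i)) (he : ∀ i, Etale (f i).hom.left)
    (hs : ∀ u : U.sch, ∃ (i : ι) (v : (V i).sch), (f i).hom.left v = u) :
    S ∈ etaleTopology E U := by
  intro W g w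
  obtain ⟨i, v, hv⟩ := hs (g.hom.left w)
  obtain ⟨Z, a, b, z, ha, hz, hab⟩ := exists_etale_lift g (f i) (he i) w v hv.symm
  refine ⟨Z, a, z, ?_, ha, hz⟩
  rw [hab]
  exact S.downward_closed (hf i) b

namespace EquivSheaf

variable {𝓕 : WeilSheaf k E} {U V W : Ebar k E}

/-- Smoothness is local for the étale topology. -/
lemma isSmooth_of_locally {S : Sieve U} (hS : S ∈ Ebar.etaleTopology E U) {x : 𝓕.sec U}
    (h : ∀ (V : Ebar k E) (f : V ⟶ U), S f → IsSmooth (𝓕.res f x)) : IsSmooth x := by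
  obtain ⟨K, _, ⟨M⟩⟩ := exists_model U
  obtain ⟨r, V, f, hf, he, hs⟩ := Ebar.exists_finite_cover hS
  choose K' hK' N m hm hN using fun i => h (V i) (f i) (hf i)
  have w (i : Fin r) : (f i).hom.left ≫ U.str ≫ galAct X (frob F k ^ (0 : ℤ)) = (V i).str :=
    semilinear_frob_zero (Over.w (f i).hom)
  choose n hn0 hn hn' hc using fun i =>
    have := hK' i
    (N i).exists_forall_act_comm M (w i)
  obtain ⟨m₀, hm₀, hK⟩ := exists_le_levelField K
  let l : ℕ := m₀ * ∏ i, n i * m i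
  have hl : 0 < l := Nat.mul_pos hm₀ (Finset.prod_pos fun i _ => Nat.mul_pos (hn0 i) (hm i))
  have hdvd (i : Fin r) : n i * m i ∣ l :=
    dvd_mul_of_dvd_right (Finset.dvd_prod_of_mem (fun i => n i * m i) (Finset.mem_univ i)) m₀
  have hlK : frob F k ^ l ∈ K.fixingSubgroup := pow_mul_mem hK _
  refine ⟨K, ‹_›, M, l, hl, hlK, ?_⟩
  refine AbSheaf.eq_of_locally_eq 𝓕.sheaf (S := Sieve.generate (Presieve.ofArrows V f))
    (Ebar.mem_of_cover (fun i => Sieve.le_generate _ _ _ (Presieve.ofArrows.mk i)) he hs) ?_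
  rintro Z _ ⟨_, g, _, ⟨i⟩, rfl⟩
  refine (AbSheaf.res_comp _ _ _ _).symm.trans (Eq.trans ?_ (AbSheaf.res_comp _ _ _ _))
  refine congrArg _ ?_
  change 𝓕.res (f i) _ = 𝓕.res (f i) x
  have hx := (hN i).of_dvd (dvd_of_mul_left_dvd (hdvd i))
  rw [res_eq_frobPull, res_eq_frobPull] at *
  have h2 := hx.2
  have e := hc i (frob F k ^ l)⁻¹ (frob_pow_inv_mem (dvd_of_mul_right_dvd (hdvd i)))
    (inv_mem hlK) (inv_mem hx.1)
  have w' : ((N i).act (frob F k ^ l)⁻¹ (inv_mem hx.1) ≫ (f i).hom.left) ≫ U.str ≫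
      galAct X (frob F k ^ (l : ℤ)) = (V i).str :=  by
    have := semilinear_frob_comp (w i) ((N i).semilinear_act_self (h := frob F k ^ (l : ℤ))
      (inv_mem hx.1) (by simp))
    rwa [add_zero] at this
  rw [𝓕.frobPull_frobPull (zero_add _).symm _ _ e w']
  rw [𝓕.frobPull_frobPull (add_zero _).symm _ _ rfl w'] at h2
  exact h2

end EquivSheaf

section Smooth

open EquivSheaf

variable (𝓕 : WeilSheaf k E)

/-- The presheaf of smooth sections. -/
def smoothPresheaf : (Ebar k E)ᵒᵖ ⥤ AddCommGrpCat.{u + 1} where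
  obj U := AddCommGrpCat.of (smooth 𝓕 U.unop)
  map {U V} f := AddCommGrpCat.ofHom
    (((𝓕.res f.unop).comp (smooth 𝓕 U.unop).subtype).codRestrict (smooth 𝓕 V.unop)
      fun x => IsSmooth.res x.2 f.unop)
  map_id U := AddCommGrpCat.hom_ext (AddMonoidHom.ext fun x => Subtype.ext (𝓕.res_id x.1))
  map_comp f g := AddCommGrpCat.hom_ext (AddMonoidHom.ext fun x => Subtype.ext
    (𝓕.res_comp g.unop f.unop x.1).symm)

lemma smoothPresheaf_isSheaf : Presheaf.IsSheaf (Ebar.etaleTopology E) (smoothPresheaf 𝓕) := by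
  have hA := (Presheaf.isSheaf_iff_isSheaf_forget (Ebar.etaleTopology E) _
    (CategoryTheory.forget AddCommGrpCat)).1 𝓕.sheaf.property
  rw [isSheaf_iff_isSheaf_of_type] at hA
  rw [Presheaf.isSheaf_iff_isSheaf_forget (Ebar.etaleTopology E) _
    (CategoryTheory.forget AddCommGrpCat), isSheaf_iff_isSheaf_of_type]
  intro U S hS x hx
  have hx' : Presieve.FamilyOfElements.Compatible
      (P := 𝓕.sheaf.obj ⋙ CategoryTheory.forget AddCommGrpCat)
      (fun V f hf => (x f hf).1) :=
    fun V W Z a b c d hc hd e => congrArg Subtype.val (hx a b hc hd e)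
  have hv {V : Ebar k E} (f : V ⟶ U) (hf : S f) := (hA S hS).valid_glue hx' f hf
  refine ⟨⟨(hA S hS).amalgamate _ hx', isSmooth_of_locally hS fun V f hf => ?_⟩,
    fun V f hf => Subtype.ext (hv f hf), fun y hy => Subtype.ext ?_⟩
  · have : 𝓕.res f ((hA S hS).amalgamate _ hx') = (x f hf).1 := hv f hf
    rw [this]
    exact (x f hf).2
  · exact (hA.isSeparated S hS).ext fun V f hf =>
      (congrArg Subtype.val (hy f hf)).trans (hv f hf).symm

/-- The sheaf of smooth sections. -/
def smoothSheaf : AbSheaf k E := ⟨smoothPresheaf 𝓕, smoothPresheaf_isSheaf 𝓕⟩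

/-- The section of `𝓕` given by a section of the sheaf of smooth sections. -/
def smoothVal (U : Ebar k E) : (smoothSheaf 𝓕).obj.obj (op U) →+ 𝓕.sec U := (smooth 𝓕 U).subtype

variable {𝓕} {U V W : Ebar k E}

lemma isSmooth_smoothVal (x : (smoothSheaf 𝓕).obj.obj (op U)) : IsSmooth (smoothVal 𝓕 U x) := x.2

lemma smoothVal_injective : Function.Injective (smoothVal 𝓕 U) := Subtype.val_injective

lemma smoothVal_res (f : V ⟶ U) (x : (smoothSheaf 𝓕).obj.obj (op U)) :
    smoothVal 𝓕 V ((smoothSheaf 𝓕).res f x) = 𝓕.res f (smoothVal 𝓕 U x) := rfl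

/-- A smooth section as a section of the sheaf of smooth sections. -/
def smoothMk (x : 𝓕.sec U) (hx : IsSmooth x) : (smoothSheaf 𝓕).obj.obj (op U) := ⟨x, hx⟩

/-- The map of smooth sections along a semilinear morphism. -/
def smoothPull (g : Gal(k/F)) (f : V.sch ⟶ U.sch) (w : f ≫ U.str ≫ galAct X g = V.str) :
    (smoothSheaf 𝓕).obj.obj (op U) →+ (smoothSheaf 𝓕).obj.obj (op V) :=
  AddMonoidHom.mk' (fun x => smoothMk (galPull (smoothVal 𝓕 U x) (isSmooth_smoothVal x) f w)
      (isSmooth_galPull _ w))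
    fun x y => smoothVal_injective
      ((galPull_congr (isSmooth_smoothVal (x + y)) (map_add _ x y)
          (by rw [← map_add]; exact isSmooth_smoothVal _) rfl rfl w w).trans
        (galPull_add (isSmooth_smoothVal x) (isSmooth_smoothVal y) _ w))

lemma smoothVal_pull {g : Gal(k/F)} {f : V.sch ⟶ U.sch} (w : f ≫ U.str ≫ galAct X g = V.str)
    (x : (smoothSheaf 𝓕).obj.obj (op U)) :
    smoothVal 𝓕 V (smoothPull g f w x) = galPull (smoothVal 𝓕 U x) (isSmooth_smoothVal x) f w := rfl

variable (𝓕) in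
/-- The maps of the sheaf of smooth sections along semilinear morphisms. -/
def smoothData : PullData (MonoidHom.id Gal(k/F)) (smoothSheaf 𝓕) where
  pull g _ _ f w := smoothPull g f w
  pull_pull w f' w' x := smoothVal_injective <|
    galPull_galPull (isSmooth_smoothVal x) w (isSmooth_galPull _ _) w' (semilinear_comp w w')
  res_eq_pull f x := smoothVal_injective <| by
    rw [smoothVal_pull, smoothVal_res, res_eq_frobPull]
    exact (galPull_of_eq_frob_zpow (isSmooth_smoothVal x) _ (zpow_zero _).symm _).symm

variable (𝓕) in
/-- The sheaf of smooth sections with its action of the Galois group. -/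
def smoothObj : EquivSheaf E (MonoidHom.id Gal(k/F)) := .ofPull (smoothData 𝓕)

end Smooth

end

end WeilEtale

namespace WeilEtale

noncomputable section

variable {F k : Type u} [Field F] [Fintype F] [Field k] [Algebra F k] [IsAlgClosure F k]
  {X : Over (Spec (.of F))} {E : SchemeSubcategory X}

open EquivSheaf

namespace smoothObj

variable {𝓕 𝓖 : WeilSheaf k E} {U V W : Ebar k E}

/-- The section of `𝓕` given by a section of the sheaf of smooth sections. -/
def val (U : Ebar k E) : (smoothObj 𝓕).sec U →+ 𝓕.sec U := smoothVal 𝓕 U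

lemma isSmooth_val (x : (smoothObj 𝓕).sec U) : IsSmooth (val U x) := isSmooth_smoothVal x

lemma val_injective : Function.Injective (val (𝓕 := 𝓕) U) := smoothVal_injective

/-- A smooth section as a section of the sheaf of smooth sections. -/
def mk (x : 𝓕.sec U) (hx : IsSmooth x) : (smoothObj 𝓕).sec U := smoothMk x hx

lemma val_pull {g : Gal(k/F)} {f : V.sch ⟶ U.sch} (w : f ≫ U.str ≫ galAct X g = V.str)
    (x : (smoothObj 𝓕).sec U) :
    val V ((smoothObj 𝓕).pull g f w x) = galPull (val U x) (isSmooth_val x) f w :=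
  congrArg (smoothVal 𝓕 V) (ofPull_pull (smoothData 𝓕) w x)

/-- The morphism of sheaves of smooth sections given by an equivariant morphism. -/
def mapHom (a : 𝓕 ⟶ 𝓖) : smoothSheaf 𝓕 ⟶ smoothSheaf 𝓖 :=
  AbSheaf.homMk (fun U => ((app a U).comp (smoothVal 𝓕 U)).codRestrict (smooth 𝓖 U)
      fun x => (isSmooth_smoothVal x).app a)
    fun f x => smoothVal_injective (app_res a f (smoothVal 𝓕 _ x))

/-- The morphism of sheaves of smooth sections given by an equivariant morphism. -/
def map (a : 𝓕 ⟶ 𝓖) : smoothObj 𝓕 ⟶ smoothObj 𝓖 :=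
  homOfPull (mapHom a) fun g U V f w x => val_injective <|
    (congrArg (app a V) (val_pull w x)).trans ((app_galPull a _ w).trans
      (val_pull w (AbSheaf.app (mapHom a) U x)).symm)

lemma pull_eq_self {K : IntermediateField F k} [FiniteDimensional F K] {M : Model U K} {m : ℕ}
    (hm : 0 < m) {x : (smoothObj 𝓕).sec U} (hx : 𝓕.FixedBy M m (val U x)) {g : Gal(k/F)}
    (hg : g ∈ (levelField F k m).fixingSubgroup) (hgK : g⁻¹ ∈ K.fixingSubgroup) :
    (smoothObj 𝓕).pull g (M.act g⁻¹ hgK) (M.semilinear_act_self hgK (inv_mul_cancel g)) x = x :=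
  val_injective <| by
    rw [val_pull (g := g) (M.semilinear_act_self hgK (inv_mul_cancel g)),
      galPull_eq (g := g) (isSmooth_val x) _ hm hx hg (inv_mem_iff.1 hgK) (b := 0) (by simp)]
    refine 𝓕.frobPull_one rfl ?_ _ _
    rw [← M.act_mul]
    exact (Model.act_congr (inv_mul_cancel g) _ (one_mem _)).trans (M.act_one _)

lemma isContinuousAction (𝓕 : WeilSheaf k E) : IsContinuousAction k E (smoothObj 𝓕) := by
  intro U K _ M
  let _ : TopologicalSpace ((smoothObj 𝓕).sec U) := ⊥
  have : DiscreteTopology ((smoothObj 𝓕).sec U) := ⟨rfl⟩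
  rw [continuous_iff_continuousAt]
  rintro ⟨g₀, x⟩
  obtain ⟨m, hm, hx⟩ := (isSmooth_val x).exists_fixedBy M
  have := finiteDimensional_levelField (F := F) (k := k) hm
  have hopen : IsOpen {g : K.fixingSubgroup |
      ((g₀⁻¹ * g : K.fixingSubgroup) : Gal(k/F)) ∈ (levelField F k m).fixingSubgroup} :=
    (IntermediateField.fixingSubgroup_isOpen (levelField F k m)).preimage
      (continuous_subtype_val.comp (continuous_const.mul continuous_id))
  have h1 : ∀ᶠ g in nhds g₀,
      ((g₀⁻¹ * g : K.fixingSubgroup) : Gal(k/F)) ∈ (levelField F k m).fixingSubgroup :=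
    hopen.mem_nhds (by
      change ((g₀⁻¹ * g₀ : K.fixingSubgroup) : Gal(k/F)) ∈ (levelField F k m).fixingSubgroup
      rw [inv_mul_cancel]
      exact one_mem _)
  have h2 : ∀ᶠ x' in nhds x, x' = x := by rw [nhds_discrete]; exact Filter.eventually_pure.2 rfl
  rw [ContinuousAt, nhds_discrete ((smoothObj 𝓕).sec U), Filter.tendsto_pure,
    nhds_prod_eq]
  filter_upwards [h1.prod_mk h2]
  rintro ⟨g, x'⟩ ⟨hg, rfl⟩
  have h3 := pull_eq_self hm hx hg (inv_mem (g₀⁻¹ * g : K.fixingSubgroup).2)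
  refine Eq.trans ?_ (congrArg (M.galSec (smoothObj 𝓕) g₀) h3)
  refine ((smoothObj 𝓕).pull_pull_eq ?_ _ _ ?_ _ _).symm
  · change (g : Gal(k/F)) = g₀ * (g₀⁻¹ * g)
    exact (mul_inv_cancel_left (g₀ : Gal(k/F)) (g : Gal(k/F))).symm
  · rw [← M.act_mul]
    refine Model.act_congr ?_ _ _
    change (g : Gal(k/F))⁻¹ = (g₀ : Gal(k/F))⁻¹ * ((g₀ : Gal(k/F))⁻¹ * (g : Gal(k/F)))⁻¹
    rw [mul_inv_rev, inv_inv, gal_mul_comm, mul_assoc, mul_inv_cancel, mul_one]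

end smoothObj

variable (k E) in
/-- The functor `γ_*`: the sheaf of smooth sections. -/
def smoothFunctor : WeilSheaf k E ⥤ GaloisSheaf k E where
  obj 𝓕 := ⟨smoothObj 𝓕, smoothObj.isContinuousAction 𝓕⟩
  map a := ObjectProperty.homMk (smoothObj.map a)
  map_id _ := rfl
  map_comp _ _ := rfl

end

end WeilEtale

namespace WeilEtale

noncomputable section

variable {F k : Type u} [Field F] [Fintype F] [Field k] [Algebra F k] [IsAlgClosure F k]
  {X : Over (Spec (.of F))} {E : SchemeSubcategory X}

open EquivSheaf

variable {𝓖 : GaloisSheaf k E} {U V : Ebar k E}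

lemma exists_levelField_fixingSubgroup_subset {s : Set Gal(k/F)} (hs : s ∈ nhds 1) :
    ∃ m, 0 < m ∧ ((levelField F k m).fixingSubgroup : Set Gal(k/F)) ⊆ s := by
  obtain ⟨L, _, hL⟩ := (krullTopology_mem_nhds_one_iff F k s).1 hs
  obtain ⟨m, hm, h⟩ := exists_le_levelField L
  exact ⟨m, hm, fun y hy => hL (fixingSubgroup_levelField_le h hy)⟩

lemma galSec_eq_pull {K : IntermediateField F k} (M : Model U K) (x : 𝓖.obj.sec U)
    (g : K.fixingSubgroup) : M.galSec 𝓖.obj g x =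
      𝓖.obj.pull (g : Gal(k/F)) (M.act (g : Gal(k/F))⁻¹ (inv_mem g.2))
        (M.semilinear_act_self _ (inv_mul_cancel (g : Gal(k/F)))) x := rfl

lemma galSec_one {K : IntermediateField F k} (M : Model U K) (x : 𝓖.obj.sec U) :
    M.galSec 𝓖.obj 1 x = x := by
  have key (g : Gal(k/F)) (hg : g⁻¹ ∈ K.fixingSubgroup) (h : g = 1) (w) :
      𝓖.obj.pull g (M.act g⁻¹ hg) w x = x := by
    have h' : M.act g⁻¹ hg = 𝟙 _ :=
      (Model.act_congr (by rw [h, inv_one]) _ (one_mem _)).trans (M.act_one (one_mem _))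
    exact 𝓖.obj.pull_one h' h w x
  rw [galSec_eq_pull]
  exact key _ _ (OneMemClass.coe_one _) _

/-- In a sheaf with continuous action, every section is fixed by a small subgroup. -/
lemma exists_pull_eq_self (x : 𝓖.obj.sec U) {K : IntermediateField F k} [FiniteDimensional F K]
    (M : Model U K) :
    ∃ m, 0 < m ∧ frob F k ^ m ∈ K.fixingSubgroup ∧
      ∀ y ∈ (levelField F k m).fixingSubgroup, ∀ hy : y⁻¹ ∈ K.fixingSubgroup,
        𝓖.obj.pull y (M.act y⁻¹ hy) (M.semilinear_act_self hy (inv_mul_cancel y)) x = x := by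
  let _ : TopologicalSpace (𝓖.obj.sec U) := ⊥
  have : DiscreteTopology (𝓖.obj.sec U) := ⟨rfl⟩
  have hc : Continuous fun g : K.fixingSubgroup => M.galSec 𝓖.obj g x :=
    Continuous.comp (g := fun p : K.fixingSubgroup × 𝓖.obj.sec U => M.galSec 𝓖.obj p.1 p.2)
      (f := fun g => (g, x)) (𝓖.property U K M) (Continuous.prodMk_left x)
  have h1 : M.galSec 𝓖.obj 1 x = x := galSec_one M x
  have h2 : {g : K.fixingSubgroup | M.galSec 𝓖.obj g x = x} ∈ nhds 1 :=
    ((isOpen_discrete {x}).preimage hc).mem_nhds h1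
  obtain ⟨s, hs, hs'⟩ := (mem_nhds_subtype _ _ _).1 h2
  obtain ⟨m, hm, hm'⟩ := exists_levelField_fixingSubgroup_subset hs
  obtain ⟨n, hn, hn'⟩ := exists_le_levelField K
  refine ⟨n * m, Nat.mul_pos hn hm, pow_mul_mem hn' m, fun y hy hyK => ?_⟩
  exact hs' (a := (⟨y, inv_mem_iff.1 hyK⟩ : K.fixingSubgroup))
    (hm' (fixingSubgroup_levelField_mono (dvd_mul_left m n) hy))

lemma gammaPullback_frobPull {b : ℤ} {f : V.sch ⟶ U.sch}
    (w : f ≫ U.str ≫ galAct X (frob F k ^ b) = V.str) (x : 𝓖.obj.sec U) :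
    ((gammaPullback k E).obj 𝓖).frobPull b f w x = 𝓖.obj.pull (frob F k ^ b) f w x := rfl

lemma exists_fixedBy (x : 𝓖.obj.sec U) {K : IntermediateField F k} [FiniteDimensional F K]
    (M : Model U K) : ∃ m, 0 < m ∧ ((gammaPullback k E).obj 𝓖).FixedBy M m x ∧
      ∀ y ∈ (levelField F k m).fixingSubgroup, ∀ hy : y⁻¹ ∈ K.fixingSubgroup,
        𝓖.obj.pull y (M.act y⁻¹ hy) (M.semilinear_act_self hy (inv_mul_cancel y)) x = x := by
  obtain ⟨m, hm, hmK, h⟩ := exists_pull_eq_self x M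
  refine ⟨m, hm, ⟨hmK, ?_⟩, h⟩
  refine (gammaPullback_frobPull _ x).trans (Eq.trans ?_
    (h (frob F k ^ m) (frob_pow_mem_levelField m) (inv_mem hmK)))
  exact 𝓖.obj.pull_congr (zpow_natCast _ m) rfl _ x

/-- All sections of a sheaf with continuous action are smooth. -/
lemma isSmooth_gammaPullback (x : 𝓖.obj.sec U) :
    IsSmooth (𝓕 := (gammaPullback k E).obj 𝓖) x := by
  obtain ⟨K, _, ⟨M⟩⟩ := exists_model U
  obtain ⟨m, hm, h, -⟩ := exists_fixedBy x M
  exact h.isSmooth hm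

lemma galPull_gammaPullback (x : 𝓖.obj.sec U) {g : Gal(k/F)} {f : V.sch ⟶ U.sch}
    (w : f ≫ U.str ≫ galAct X g = V.str) :
    galPull (𝓕 := (gammaPullback k E).obj 𝓖) x (isSmooth_gammaPullback x) f w =
      𝓖.obj.pull g f w x := by
  obtain ⟨K, _, ⟨M⟩⟩ := exists_model U
  obtain ⟨m, hm, h, h'⟩ := exists_fixedBy x M
  obtain ⟨b, y, hy, e⟩ := exists_frob_factor g hm
  have hyK := fixingSubgroup_levelField_le h.mem hy
  rw [galPull_eq (isSmooth_gammaPullback x) w hm h hy hyK e]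
  refine (gammaPullback_frobPull _ x).trans ?_
  have h1 := congrArg (𝓖.obj.pull g f w)
    (h' y⁻¹ (inv_mem hy) (by rw [inv_inv]; exact hyK))
  refine Eq.trans (Eq.symm ?_) h1
  refine 𝓖.obj.pull_pull_eq ?_ _ w ?_ _ x
  · rw [e, mul_assoc, gal_mul_comm (frob F k ^ b), mul_inv_cancel_left]
  · exact congrArg (f ≫ ·) (Model.act_congr (inv_inv y).symm _ _)

variable (𝓖) in
/-- The unit of the adjunction between restriction and smooth sections. -/
def gammaUnit : 𝓖.obj ⟶ smoothObj ((gammaPullback k E).obj 𝓖) :=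
  homOfPull (AbSheaf.homMk (fun U => AddMonoidHom.mk' (fun x => smoothObj.mk
      (𝓕 := (gammaPullback k E).obj 𝓖) x (isSmooth_gammaPullback x)) fun _ _ => rfl)
      fun f x => rfl)
    fun g U V f w x => smoothObj.val_injective <|
      (galPull_gammaPullback x w).symm.trans (smoothObj.val_pull (𝓕 := (gammaPullback k E).obj 𝓖) (g := g) w
        (smoothObj.mk x (isSmooth_gammaPullback x))).symm

/-- The counit of the adjunction between restriction and smooth sections. -/
def gammaCounit (𝓕 : WeilSheaf k E) :
    (gammaPullback k E).obj ((smoothFunctor k E).obj 𝓕) ⟶ 𝓕 :=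
  homOfPull (AbSheaf.homMk (fun U => smoothObj.val U) fun f x => rfl)
    fun h U V f w x => by
      obtain ⟨b, hb⟩ := h.2
      have hb : frobPow F k b = h := Subtype.ext hb
      subst hb
      exact (smoothObj.val_pull w x).trans (galPull_of_eq_frob_zpow _ w rfl w)

variable (k E) in
/-- The functor of smooth sections is right adjoint to `γ^*`. -/
def gammaAdjunction : gammaPullback k E ⊣ smoothFunctor k E :=
  Adjunction.mkOfUnitCounit
    { unit :=
        { app 𝓖 := ObjectProperty.homMk (gammaUnit 𝓖)
          naturality _ _ _ := rfl }
      counit :=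
        { app 𝓕 := gammaCounit 𝓕
          naturality _ _ _ := rfl }
      left_triangle := rfl
      right_triangle := rfl }

end

end WeilEtale

namespace WeilEtale

noncomputable section

variable {F k : Type u} [Field F] [Fintype F] [Field k] [Algebra F k] [IsAlgClosure F k]
  {X : Over (Spec (.of F))} {E : SchemeSubcategory X}

open EquivSheaf

lemma frobPow_bijective : Function.Bijective (frobPow F k) := by
  refine ⟨fun i j h => frob_zpow_injective (congrArg Subtype.val h), fun g => ?_⟩
  obtain ⟨n, hn⟩ := g.2
  exact ⟨n, Subtype.ext hn⟩

variable (F k) in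
/-- The Weil group is infinite cyclic, generated by the Frobenius. -/
def frobEquiv : ℤ ≃ weilGroup F k := Equiv.ofBijective _ frobPow_bijective

namespace coind

variable {A : AbSheaf k E} {U V P : Ebar k E}

/-- The component with index `φ^i` of a section of the coinduced sheaf. -/
def fam (i : ℤ) (U : Ebar k E) :
    (coind (weilGroup F k).subtype A).sec U →+ A.obj.obj (op (phi i U)) :=
  comp (frobPow F k i) U

lemma eval_eq_res_fam {i : ℤ} {f : P.sch ⟶ U.sch}
    (w : f ≫ U.str ≫ galAct X (frob F k ^ i) = P.str)
    (x : (coind (weilGroup F k).subtype A).sec U) :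
    eval (ρ := (weilGroup F k).subtype) (frobPow F k i) f w x =
      A.res (Ebar.mkHom f w : P ⟶ phi i U) (fam i U x) :=
  eval_eq_res_comp (ρ := (weilGroup F k).subtype) (g := frobPow F k i) (U := U) (P := P)
    (f := f) w x

lemma fam_ext {x y : (coind (weilGroup F k).subtype A).sec U}
    (h : ∀ i, fam i U x = fam i U y) : x = y :=
  comp_ext fun g => by
    obtain ⟨i, rfl⟩ := frobPow_bijective.2 g
    exact h i

/-- A section of the coinduced sheaf with given components. -/
def ofFam (x : ∀ i : ℤ, A.obj.obj (op (phi i U))) : (coind (weilGroup F k).subtype A).sec U :=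
  mk (Equiv.piCongrLeft (fun g : weilGroup F k => A.obj.obj (op ((Ebar.twist (g : Gal(k/F))).obj U)))
    (frobEquiv F k) x)

lemma fam_ofFam (x : ∀ i : ℤ, A.obj.obj (op (phi i U))) (i : ℤ) : fam i U (ofFam x) = x i :=
  (comp_mk (ρ := (weilGroup F k).subtype) _ (frobPow F k i)).trans
    (Equiv.piCongrLeft_apply_apply (fun g : weilGroup F k =>
      A.obj.obj (op ((Ebar.twist (g : Gal(k/F))).obj U))) (frobEquiv F k) x i)

lemma eval_frobPull {a b c : ℤ} (hc : c = a + b) {f : V.sch ⟶ U.sch}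
    (w : f ≫ U.str ≫ galAct X (frob F k ^ b) = V.str)
    {f' : P.sch ⟶ V.sch} (w' : f' ≫ V.str ≫ galAct X (frob F k ^ a) = P.str)
    {f'' : P.sch ⟶ U.sch} (hf : f'' = f' ≫ f)
    (w'' : f'' ≫ U.str ≫ galAct X (frob F k ^ c) = P.str)
    (x : (coind (weilGroup F k).subtype A).sec U) :
    eval (ρ := (weilGroup F k).subtype) (frobPow F k a) f' w'
      ((coind (weilGroup F k).subtype A).frobPull b f w x) =
      eval (ρ := (weilGroup F k).subtype) (frobPow F k c) f'' w'' x :=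
  (eval_pull (ρ := (weilGroup F k).subtype) (U := U) (V := V) (P := P) (f := f) (f' := f')
    (h := frobPow F k b) (g := frobPow F k a) w w' x).trans
    (eval_congr (ρ := (weilGroup F k).subtype) (U := U) (P := P) (f := f' ≫ f) (f' := f'')
      (g := frobPow F k a * frobPow F k b) (g' := frobPow F k c)
      (by rw [hc, frobPow_add]) hf.symm _ x)

lemma fam_frobPull {i b c : ℤ} (hc : c = i + b) {f : V.sch ⟶ U.sch}
    (w : f ≫ U.str ≫ galAct X (frob F k ^ b) = V.str)
    (w' : f ≫ U.str ≫ galAct X (frob F k ^ c) = (phi i V).str)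
    (x : (coind (weilGroup F k).subtype A).sec U) :
    fam i V ((coind (weilGroup F k).subtype A).frobPull b f w x) =
      A.res (Ebar.mkHom f w' : phi i V ⟶ phi c U) (fam c U x) :=
  (eval_frobPull (P := phi i V) hc w (Category.id_comp _) (Category.id_comp f).symm w' x).trans
    (eval_eq_res_fam (P := phi i V) w' x)

lemma fam_res (f : V ⟶ U) (x : (coind (weilGroup F k).subtype A).sec U) (i : ℤ) :
    fam i V ((coind (weilGroup F k).subtype A).res f x) =
      A.res ((Ebar.twist (frob F k ^ i)).map f) (fam i U x) := by
  have w : f.hom.left ≫ U.str ≫ galAct X (frob F k ^ i) = (phi i V).str :=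
    Over.w ((Ebar.twist (frob F k ^ i)).map f).hom
  refine (eval_res (ρ := (weilGroup F k).subtype) (P := phi i V) (g := frobPow F k i)
    (f := 𝟙 V.sch) (Category.id_comp _) f x).trans ?_
  refine (eval_congr (ρ := (weilGroup F k).subtype) (U := U) (P := phi i V)
    (f := 𝟙 V.sch ≫ f.hom.left) (f' := f.hom.left) (g := frobPow F k i) (g' := frobPow F k i)
    rfl (Category.id_comp f.hom.left) _ x).trans ?_
  exact eval_eq_res_fam (P := phi i V) w x

variable {𝓕 : WeilSheaf k E}

lemma fam_mulLeft {i j : ℤ} (hj : j = 1 + i) (w : 𝟙 U.sch ≫ (phi i U).str ≫ galAct X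
      (frob F k ^ (1 : ℤ)) = (phi j U).str)
    (x : (coind (weilGroup F k).subtype 𝓕.sheaf).sec U) :
    fam j U (app (mulLeft 𝓕 (frobPow F k 1)) U x) =
      𝓕.frobPull (U := phi i U) (V := phi j U) 1 (𝟙 U.sch) w (fam i U x) := by
  subst hj
  refine Eq.trans ?_ (eval_mulLeft (ρ := (weilGroup F k).subtype) (U := U) (c := frobPow F k 1) (h := frobPow F k i) (P := phi (1 + i) U)
    (Q := phi i U) (j := 𝟙 U.sch) w (f := 𝟙 U.sch) (Category.id_comp _) x)
  exact eval_congr (ρ := (weilGroup F k).subtype) (U := U) (P := phi (1 + i) U)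
    (f := 𝟙 U.sch) (f' := 𝟙 U.sch ≫ 𝟙 U.sch) (g := frobPow F k (1 + i))
    (g' := frobPow F k 1 * frobPow F k i) (frobPow_add 1 i) (Category.id_comp (𝟙 U.sch)).symm _ _

/-- A section of the coinduced sheaf is invariant under `φ^m` if its family of components is
`m`-periodic. -/
lemma fixedBy_iff {K : IntermediateField F k} (M : Model U K) (m : ℕ)
    (x : (coind (weilGroup F k).subtype 𝓕.sheaf).sec U) :
    (coind (weilGroup F k).subtype 𝓕.sheaf).FixedBy M m x ↔
      ∃ hm : frob F k ^ m ∈ K.fixingSubgroup, (fun i => fam i U x) ∈ periodic 𝓕 M m hm := by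
  refine exists_congr fun hm => ?_
  have w (i : ℤ) : M.act (frob F k ^ m)⁻¹ (inv_mem hm) ≫ U.str ≫
      galAct X (frob F k ^ (i + (m : ℤ))) = (phi i U).str := by
    rw [zpow_add, zpow_natCast, gal_mul_comm, galAct_mul, ← Category.assoc U.str,
      ← Category.assoc (M.act _ _), M.semilinear_act_self _ (inv_mul_cancel _)]
    rfl
  have e (i : ℤ) : frob F k ^ i = (frob F k ^ m)⁻¹ * frob F k ^ (i + (m : ℤ)) := by
    rw [frob_zpow_add, inv_mul_cancel_left]
  have h1 (i : ℤ) := fam_frobPull (A := 𝓕.sheaf) (i := i) (c := i + m) rfl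
    (M.semilinear_act_self (h := frob F k ^ (m : ℤ)) (inv_mem hm) (by simp)) (w i) x
  have hs (i : ℤ) (z : 𝓕.sec (phi (i + m) U)) :
      𝓕.res (M.shift (frob F k ^ m) hm (frob_zpow_add i m)) (𝓕.res
        (M.shift (frob F k ^ m)⁻¹ (inv_mem hm) (e i)) z) = z := by
    rw [EquivSheaf.res_comp, M.shift_comp]
    refine (EquivSheaf.res_congr (g := 𝟙 _) ?_ z).trans (𝓕.res_id z)
    exact (Model.act_congr (mul_inv_cancel _) (mul_mem hm (inv_mem hm)) (one_mem _)).trans (M.act_one (one_mem _))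
  have hs' (i : ℤ) (z : 𝓕.sec (phi i U)) :
      𝓕.res (M.shift (frob F k ^ m)⁻¹ (inv_mem hm) (e i)) (𝓕.res
        (M.shift (frob F k ^ m) hm (frob_zpow_add i m)) z) = z := by
    rw [EquivSheaf.res_comp, M.shift_comp]
    refine (EquivSheaf.res_congr (g := 𝟙 _) ?_ z).trans (𝓕.res_id z)
    exact (Model.act_congr (inv_mul_cancel _) (mul_mem (inv_mem hm) hm) (one_mem _)).trans (M.act_one (one_mem _))
  constructor
  · intro h i
    have h2 := (h1 i).symm.trans (congrArg (fam i U) h)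
    exact (hs i _).symm.trans (congrArg _ h2)
  · intro h
    refine fam_ext fun i => (h1 i).trans ?_
    have h2 : fam (i + m) U x = 𝓕.res (M.shift (frob F k ^ m) hm (frob_zpow_add i m))
      (fam i U x) := h i
    rw [h2]
    exact hs' i _

end coind

end

end WeilEtale

namespace WeilEtale

noncomputable section

variable {F k : Type u} [Field F] [Fintype F] [Field k] [Algebra F k] [IsAlgClosure F k]
  {X : Over (Spec (.of F))} {E : SchemeSubcategory X}

open EquivSheaf

/-- The sheaf `∏_i (φ^i)^* 𝓕`. -/
abbrev induced (𝓕 : WeilSheaf k E) : WeilSheaf k E := coind (weilGroup F k).subtype 𝓕.sheaf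

/-- The operator `(x_i)_i ↦ (φ x_{i-1})_i`. -/
abbrev shift (𝓕 : WeilSheaf k E) : induced 𝓕 ⟶ induced 𝓕 := coind.mulLeft 𝓕 (frobPow F k 1)

variable {𝓕 : WeilSheaf k E} {U V : Ebar k E}

variable (𝓕 U) in
/-- The family of components of a smooth section of the induced sheaf. -/
def xiFamily : (smoothObj (induced 𝓕)).sec U →+ ∀ i : ℤ, 𝓕.sec (phi i U) where
  toFun x i := coind.fam i U (smoothObj.val U x)
  map_zero' := funext fun i => map_zero ((coind.fam i U).comp (smoothObj.val U))
  map_add' := fun x y => funext fun i => map_add ((coind.fam i U).comp (smoothObj.val U)) x y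

lemma xiFamily_injective : Function.Injective (xiFamily 𝓕 U) := fun _ _ h =>
  smoothObj.val_injective (coind.fam_ext fun i => congrFun h i)

lemma range_xiFamily : Set.range (xiFamily 𝓕 U) = xiSections 𝓕 U := by
  ext f
  constructor
  · rintro ⟨x, rfl⟩
    obtain ⟨K, _, M, m, hm, hx⟩ := smoothObj.isSmooth_val x
    obtain ⟨hmK, h⟩ := (coind.fixedBy_iff M m _).1 hx
    exact ⟨K, ‹_›, M, m, hm, hmK, h⟩
  · rintro ⟨K, _, M, m, hm, hmK, h⟩
    have hf : (fun i => coind.fam i U (coind.ofFam (A := 𝓕.sheaf) f)) = f :=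
      funext fun i => coind.fam_ofFam f i
    refine ⟨smoothObj.mk (𝓕 := induced 𝓕) (coind.ofFam f) ⟨K, ‹_›, M, m, hm,
      (coind.fixedBy_iff M m _).2 ⟨hmK, by rwa [hf]⟩⟩, hf⟩

lemma xiFamily_shift (x : (smoothObj (induced 𝓕)).sec U) (i : ℤ) :
    xiFamily 𝓕 U (app (smoothObj.map (shift 𝓕)) U x) i =
      𝓕.res (Ebar.twistMul U (x := frob F k ^ i) (g := frob F k ^ (1 : ℤ))
          (h := frob F k ^ (i - 1)) (by rw [← zpow_add]; congr 1; ring))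
        (𝓕.act (frobPow F k 1) (phi (i - 1) U) (xiFamily 𝓕 U x (i - 1))) :=
  coind.fam_mulLeft (i := i - 1) (j := i) (by ring)
    (Over.w (Ebar.twistMul U (x := frob F k ^ i) (g := frob F k ^ (1 : ℤ))
          (h := frob F k ^ (i - 1)) (by rw [← zpow_add]; congr 1; ring)).hom) (smoothObj.val U x)

lemma xiFamily_act (x : (smoothObj (induced 𝓕)).sec U) {K : IntermediateField F k}
    [FiniteDimensional F K] (M : Model U K) (m : ℕ) (hm0 : 0 < m)
    (hm : frob F k ^ m ∈ K.fixingSubgroup) (hx : xiFamily 𝓕 U x ∈ periodic 𝓕 M m hm)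
    (g : Gal(k/F)) (a : ℤ) (hg : g * (frob F k ^ a)⁻¹ ∈ (levelField F k m).fixingSubgroup) (i : ℤ) :
    xiFamily 𝓕 ((Ebar.twist g).obj U) ((smoothObj (induced 𝓕)).act g U x) i =
      𝓕.res (M.shiftTwist (g * (frob F k ^ a)⁻¹)
          (IntermediateField.fixingSubgroup_antitone (le_levelField hm) hg)
          (by rw [mul_assoc, zpow_add, gal_mul_comm (frob F k ^ i), inv_mul_cancel_left]))
        (xiFamily 𝓕 U x (i + a)) := by
  have hgK := IntermediateField.fixingSubgroup_antitone (le_levelField hm) hg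
  have e : g = g * (frob F k ^ a)⁻¹ * frob F k ^ a := (inv_mul_cancel_right _ _).symm
  have h1 : smoothObj.val ((Ebar.twist g).obj U) ((smoothObj (induced 𝓕)).act g U x) =
      (induced 𝓕).frobPull (V := (Ebar.twist g).obj U) a (𝟙 U.sch ≫ M.act _ hgK)
        (M.semilinear_act (V := (Ebar.twist g).obj U) hgK (Category.id_comp _) e)
        (smoothObj.val U x) :=
    (congrArg _ (act_eq_pull _ g U x)).trans
      ((smoothObj.val_pull (V := (Ebar.twist g).obj U) (g := g) (Category.id_comp _) x).trans
        (galPull_eq _ _ hm0 ((coind.fixedBy_iff M m _).2 ⟨hm, hx⟩) hg hgK e))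
  refine (congrArg (coind.fam i _) h1).trans ?_
  refine (coind.fam_frobPull (A := 𝓕.sheaf) (V := (Ebar.twist g).obj U) (U := U) rfl _ ?_ _).trans ?_
  · refine (congrArg (· ≫ U.str ≫ galAct X (frob F k ^ (i + a)))
      (Category.id_comp (M.act (g * (frob F k ^ a)⁻¹) hgK))).trans ?_
    exact Over.w (M.shiftTwist (g * (frob F k ^ a)⁻¹) hgK (x := frob F k ^ i)
      (w := frob F k ^ (i + a))
      (by rw [mul_assoc, zpow_add, gal_mul_comm (frob F k ^ i), inv_mul_cancel_left])).hom
  · exact EquivSheaf.res_congr (Category.id_comp _) _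

variable (𝓕) in
/-- The sheaf `Ξ(𝓕)` with its operator. -/
def xiStructure : XiStructure 𝓕 ((smoothFunctor k E).obj (induced 𝓕))
    ((smoothFunctor k E).map (shift 𝓕)) where
  family U := xiFamily 𝓕 U
  injective _ := xiFamily_injective
  range _ := range_xiFamily
  res f x i := coind.fam_res f (smoothObj.val _ x) i
  t_apply _ x i := xiFamily_shift x i
  act_apply x _ _ M m hm0 hm hx g a hg i := xiFamily_act x M m hm0 hm hx g a hg i

end

end WeilEtale

namespace WeilEtale

noncomputable section

/-- The sum of the values `a 0, …, a (n - 1)`, for an integer `n`: a primitive of `a`. -/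
def intSum {B : Type*} [AddCommGroup B] (a : ℤ → B) : ℤ → B
  | Int.ofNat n => ∑ k ∈ Finset.range n, a k
  | Int.negSucc n => -∑ k ∈ Finset.range (n + 1), a (Int.negSucc k)

lemma intSum_add_one {B : Type*} [AddCommGroup B] (a : ℤ → B) (n : ℤ) :
    intSum a (n + 1) = intSum a n + a n := by
  obtain n | n := n
  · exact Finset.sum_range_succ _ _
  · obtain _ | n := n
    · change (0 : B) = -∑ k ∈ Finset.range 1, a (Int.negSucc k) + a (Int.negSucc 0)
      simp
    · change -∑ k ∈ Finset.range (n + 1), a (Int.negSucc k) =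
        -∑ k ∈ Finset.range (n + 1 + 1), a (Int.negSucc k) + a (Int.negSucc (n + 1))
      rw [Finset.sum_range_succ _ (n + 1)]
      abel

lemma map_intSum {B C : Type*} [AddCommGroup B] [AddCommGroup C] (f : B →+ C) (a : ℤ → B) (n : ℤ) :
    f (intSum a n) = intSum (fun k => f (a k)) n := by
  obtain n | n := n
  · exact map_sum f _ _
  · exact (map_neg f _).trans (congrArg _ (map_sum f _ _))

variable {F k : Type u} [Field F] [Fintype F] [Field k] [Algebra F k] [IsAlgClosure F k]
  {X : Over (Spec (.of F))} {E : SchemeSubcategory X}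

open EquivSheaf

variable {U V P Q : Ebar k E}

/-- `shift - 1` is surjective. -/
lemma exists_shift_sub (𝓕 : WeilSheaf k E) (y : (induced 𝓕).sec U) :
    ∃ x : (induced 𝓕).sec U, app (shift 𝓕) U x - x = y := by
  have w (i : ℤ) : 𝟙 U.sch ≫ U.str ≫ galAct X (frob F k ^ i) = (phi i U).str := Category.id_comp _
  have w' (i : ℤ) : 𝟙 U.sch ≫ (phi i U).str ≫ galAct X (frob F k ^ (-i)) = U.str := by
    change 𝟙 U.sch ≫ (U.str ≫ galAct X (frob F k ^ i)) ≫ galAct X (frob F k ^ (-i)) = U.str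
    rw [Category.id_comp, Category.assoc, ← galAct_mul, ← zpow_add, add_neg_cancel, zpow_zero,
      galAct_one, Category.comp_id]
  let y' (i : ℤ) : 𝓕.sec U := 𝓕.frobPull (U := phi i U) (-i) (𝟙 U.sch) (w' i) (coind.fam i U y)
  have hy' (i : ℤ) : 𝓕.frobPull (V := phi i U) i (𝟙 U.sch) (w i) (y' i) = coind.fam i U y :=
    (𝓕.frobPull_frobPull (U := phi i U) (V := U) (W := phi i U) (c := 0) (add_neg_cancel i).symm
      (w' i) (w i) (f'' := 𝟙 U.sch) (Category.comp_id _).symm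
      (semilinear_frob_zero (U := phi i U) (V := phi i U) (Category.id_comp (phi i U).str)) _).trans
      (𝓕.frobPull_one (U := phi i U) rfl rfl _ _)
  let x' : ℤ → 𝓕.sec U := fun i => -intSum (fun k => y' (k + 1)) i
  have hx' (i : ℤ) : x' i = x' (1 + i) + y' (1 + i) := by
    change -intSum (fun k => y' (k + 1)) i = -intSum (fun k => y' (k + 1)) (1 + i) + y' (1 + i)
    rw [add_comm 1 i, intSum_add_one]
    abel
  let x : (induced 𝓕).sec U := coind.ofFam (A := 𝓕.sheaf)
    fun i => 𝓕.frobPull (V := phi i U) i (𝟙 U.sch) (w i) (x' i)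
  have hx (i : ℤ) : coind.fam i U x = 𝓕.frobPull (V := phi i U) i (𝟙 U.sch) (w i) (x' i) :=
    coind.fam_ofFam (A := 𝓕.sheaf) _ i
  refine ⟨x, sub_eq_iff_eq_add'.2 (coind.fam_ext fun j => ?_)⟩
  obtain ⟨i, rfl⟩ : ∃ i, j = 1 + i := ⟨j - 1, by ring⟩
  have w1 : 𝟙 U.sch ≫ (phi i U).str ≫ galAct X (frob F k ^ (1 : ℤ)) = (phi (1 + i) U).str := by
    change 𝟙 U.sch ≫ (U.str ≫ galAct X (frob F k ^ i)) ≫ galAct X (frob F k ^ (1 : ℤ)) =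
      U.str ≫ galAct X (frob F k ^ (1 + i))
    rw [Category.id_comp, Category.assoc, ← galAct_mul, ← zpow_add, add_comm i]
  refine (coind.fam_mulLeft (i := i) (j := 1 + i) rfl w1 x).trans ?_
  refine (congrArg _ (hx i)).trans ?_
  refine (𝓕.frobPull_frobPull (U := U) (V := phi i U) (W := phi (1 + i) U) (c := 1 + i) rfl
    (w i) w1 (f'' := 𝟙 U.sch) (Category.comp_id _).symm (w (1 + i)) (x' i)).trans ?_
  refine Eq.trans ?_ (map_add (coind.fam (1 + i) U) x y).symm
  rw [hx' i, hx, ← hy', map_add]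

end

end WeilEtale

namespace WeilEtale

noncomputable section

variable {F k : Type u} [Field F] [Fintype F] [Field k] [Algebra F k] [IsAlgClosure F k]
  {X : Over (Spec (.of F))} {E : SchemeSubcategory X}

open EquivSheaf

namespace coind

variable {A : AbSheaf k E} {U V P Q : Ebar k E}

lemma semilinear_phi {i j c : ℤ} (hc : c = i + j) {f : P.sch ⟶ U.sch}
    (w : f ≫ U.str ≫ galAct X (frob F k ^ c) = P.str) :
    f ≫ (phi i U).str ≫ galAct X (frob F k ^ j) = P.str := by
  change f ≫ (U.str ≫ galAct X (frob F k ^ i)) ≫ galAct X (frob F k ^ j) = P.str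
  rw [← w, hc, zpow_add, galAct_mul, Category.assoc]

/-- The components of a section of a doubly coinduced sheaf. -/
def eval₂ (i j : ℤ) {c : ℤ} (hc : c = i + j) (f : P.sch ⟶ U.sch)
    (w : f ≫ U.str ≫ galAct X (frob F k ^ c) = P.str) :
    (induced (coind (weilGroup F k).subtype A)).sec U →+ A.obj.obj (op P) :=
  (eval (ρ := (weilGroup F k).subtype) (U := phi i U) (P := P) (frobPow F k j) f
    (semilinear_phi hc w)).comp (fam (A := (coind (weilGroup F k).subtype A).sheaf) i U)

variable {y z : (induced (coind (weilGroup F k).subtype A)).sec U}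

lemma eval₂_congr {i i' j c c' : ℤ} (hi : i = i') (hc : c = i + j) (hc' : c' = i' + j)
    {f f' : P.sch ⟶ U.sch} (hf : f = f') (w : f ≫ U.str ≫ galAct X (frob F k ^ c) = P.str)
    (w' : f' ≫ U.str ≫ galAct X (frob F k ^ c') = P.str)
    (y : (induced (coind (weilGroup F k).subtype A)).sec U) :
    eval₂ i j hc f w y = eval₂ i' j hc' f' w' y := by
  subst hi hf hc hc'
  rfl

lemma ext₂ (h : ∀ (i j c : ℤ) (hc : c = i + j) (P : Ebar k E) (f : P.sch ⟶ U.sch) (w),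
    eval₂ i j hc f w y = eval₂ i j hc f w z) : y = z :=
  fam_ext (A := (coind (weilGroup F k).subtype A).sheaf) fun i =>
    ext (ρ := (weilGroup F k).subtype) (U := phi i U) fun g P f w => by
      obtain ⟨j, rfl⟩ := frobPow_bijective.2 g
      refine h i j (i + j) rfl P f ?_
      refine Eq.trans ?_ w
      change _ = (show P.sch ⟶ U.sch from f) ≫ (U.str ≫ galAct X (frob F k ^ i)) ≫
        galAct X (frob F k ^ j)
      rw [zpow_add, galAct_mul, Category.assoc]

lemma res_eval₂ {i j c : ℤ} (hc : c = i + j) {f : P.sch ⟶ U.sch}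
    (w : f ≫ U.str ≫ galAct X (frob F k ^ c) = P.str) (φ : Q ⟶ P)
    (w' : (φ.hom.left ≫ f) ≫ U.str ≫ galAct X (frob F k ^ c) = Q.str)
    (y : (induced (coind (weilGroup F k).subtype A)).sec U) :
    A.res φ (eval₂ i j hc f w y) = eval₂ i j hc (φ.hom.left ≫ f) w' y :=
  res_eval (ρ := (weilGroup F k).subtype) (U := phi i U) (P := P) (Q := Q) (g := frobPow F k j)
    (f := f) (semilinear_phi hc w) φ (fam (A := (coind (weilGroup F k).subtype A).sheaf) i U y)

lemma eval₂_frobPull {i j b c d : ℤ} (hc : c = i + j) (hd : d = i + b + j) {g : V.sch ⟶ U.sch}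
    (w : g ≫ U.str ≫ galAct X (frob F k ^ b) = V.str) {f : P.sch ⟶ V.sch}
    (w' : f ≫ V.str ≫ galAct X (frob F k ^ c) = P.str)
    (w'' : (f ≫ g) ≫ U.str ≫ galAct X (frob F k ^ d) = P.str)
    (y : (induced (coind (weilGroup F k).subtype A)).sec U) :
    eval₂ i j hc f w' ((induced (coind (weilGroup F k).subtype A)).frobPull b g w y) =
      eval₂ (i + b) j hd (f ≫ g) w'' y := by
  have w1 : g ≫ U.str ≫ galAct X (frob F k ^ (i + b)) = (phi i V).str := by
    rw [add_comm, zpow_add, galAct_mul, ← Category.assoc U.str, ← Category.assoc g, w]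
    rfl
  refine (congrArg (eval (ρ := (weilGroup F k).subtype) (U := phi i V) (P := P) (frobPow F k j) f
    (semilinear_phi hc w')) (fam_frobPull (A := (coind (weilGroup F k).subtype A).sheaf)
      (i := i) (b := b) (c := i + b) rfl w w1 y)).trans ?_
  exact eval_res (ρ := (weilGroup F k).subtype) (V := phi i V) (U := phi (i + b) U) (P := P)
    (g := frobPow F k j) (f := f) (semilinear_phi hc w') (Ebar.mkHom g w1 : phi i V ⟶ phi (i + b) U) _

lemma eval₂_shift {i j c : ℤ} (hc : c = i + 1 + j) (hc' : c = i + (j + 1)) {f : P.sch ⟶ U.sch}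
    (w : f ≫ U.str ≫ galAct X (frob F k ^ c) = P.str)
    (y : (induced (coind (weilGroup F k).subtype A)).sec U) :
    eval₂ (i + 1) j hc f w (app (shift (coind (weilGroup F k).subtype A)) U y) =
      eval₂ i (j + 1) hc' f w y := by
  have w1 : 𝟙 U.sch ≫ (phi i U).str ≫ galAct X (frob F k ^ (1 : ℤ)) = (phi (i + 1) U).str := by
    change 𝟙 U.sch ≫ (U.str ≫ galAct X (frob F k ^ i)) ≫ galAct X (frob F k ^ (1 : ℤ)) =
      U.str ≫ galAct X (frob F k ^ (i + 1))
    rw [Category.id_comp, Category.assoc, ← galAct_mul, ← zpow_add]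
  refine (congrArg (eval (ρ := (weilGroup F k).subtype) (U := phi (i + 1) U) (P := P)
    (frobPow F k j) f (semilinear_phi hc w))
    (fam_mulLeft (𝓕 := coind (weilGroup F k).subtype A) (add_comm i 1) w1 y)).trans ?_
  exact eval_frobPull (U := phi i U) (V := phi (i + 1) U) (P := P) (a := j) (b := 1)
    (c := j + 1) (f := 𝟙 U.sch) (f' := f) (f'' := f) rfl w1 (semilinear_phi hc w) (Category.comp_id f).symm (semilinear_phi hc' w) _

/-- The map underlying a right inverse of `shift - 1` on the sheaf induced from a coinduced
sheaf. -/
def primitive (y : (induced (coind (weilGroup F k).subtype A)).sec U) :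
    (induced (coind (weilGroup F k).subtype A)).sec U :=
  ofFam (A := (coind (weilGroup F k).subtype A).sheaf) fun i => ofFam (U := phi i U) fun n =>
    intSum (fun l => eval₂ (P := phi n (phi i U)) (i + n - l) l (c := i + n) (by ring) (𝟙 U.sch)
      (by
        change 𝟙 U.sch ≫ U.str ≫ galAct X (frob F k ^ (i + n)) =
          (U.str ≫ galAct X (frob F k ^ i)) ≫ galAct X (frob F k ^ n)
        rw [zpow_add, galAct_mul, Category.id_comp, Category.assoc]) y) n

lemma eval₂_primitive {i n c : ℤ} (hc : c = i + n) {f : P.sch ⟶ U.sch}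
    (w : f ≫ U.str ≫ galAct X (frob F k ^ c) = P.str)
    (y : (induced (coind (weilGroup F k).subtype A)).sec U) :
    eval₂ i n hc f w (primitive y) =
      intSum (fun l => eval₂ (c - l) l (c := c) (by ring) f w y) n := by
  subst hc
  refine (congrArg (eval (ρ := (weilGroup F k).subtype) (U := phi i U) (P := P) (frobPow F k n) f
    (semilinear_phi rfl w)) (fam_ofFam (A := (coind (weilGroup F k).subtype A).sheaf) _ i)).trans ?_
  refine (eval_eq_res_fam (U := phi i U) (P := P) (i := n) (f := f) (semilinear_phi rfl w) _).trans ?_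
  refine (congrArg _ (fam_ofFam (U := phi i U) (A := A) _ n)).trans ?_
  refine (map_intSum (AbSheaf.res A _) _ n).trans ?_
  refine congrArg (intSum · n) (funext fun l => ?_)
  refine (res_eval₂ (P := phi n (phi i U)) (Q := P) _ _
    (Ebar.mkHom f (semilinear_phi rfl w) : P ⟶ phi n (phi i U))
    (((congrArg (· ≫ U.str ≫ galAct X (frob F k ^ (i + n))) (Category.comp_id f))).trans w)
    y).trans ?_
  exact eval₂_congr rfl _ _ (Category.comp_id f) _ _ y

lemma primitive_frobPull {b : ℤ} {g : V.sch ⟶ U.sch}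
    (w : g ≫ U.str ≫ galAct X (frob F k ^ b) = V.str)
    (y : (induced (coind (weilGroup F k).subtype A)).sec U) :
    primitive ((induced (coind (weilGroup F k).subtype A)).frobPull b g w y) =
      (induced (coind (weilGroup F k).subtype A)).frobPull b g w (primitive y) :=
  ext₂ fun i j c hc P f wf => by
    have w'' : (f ≫ g) ≫ U.str ≫ galAct X (frob F k ^ (c + b)) = P.str := semilinear_frob_comp w wf
    have e1 : c + b = i + b + j := by rw [hc]; ring
    refine (eval₂_primitive hc wf _).trans (Eq.trans ?_ (eval₂_frobPull hc e1 w wf w'' _).symm)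
    refine Eq.trans ?_ (eval₂_primitive e1 w'' y).symm
    refine congrArg (intSum · j) (funext fun l => ?_)
    refine (eval₂_frobPull (d := c + b) _ (by ring) w wf w'' y).trans ?_
    exact eval₂_congr (by ring) _ _ rfl _ _ y

lemma primitive_add (y z : (induced (coind (weilGroup F k).subtype A)).sec U) :
    primitive (y + z) = primitive y + primitive z :=
  ext₂ fun i j c hc P f w => by
    have h (x : (induced (coind (weilGroup F k).subtype A)).sec U) :
        eval₂ i j hc f w (primitive x) =
          intSum (fun l => eval₂ (c - l) l (c := c) (by ring) f w) j x :=
      (eval₂_primitive hc w x).trans (map_intSum (AddMonoidHom.eval x)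
        (fun l => eval₂ (c - l) l (c := c) (by ring) f w) j).symm
    refine (h (y + z)).trans ((map_add _ y z).trans ?_)
    exact (congrArg₂ (· + ·) (h y) (h z)).symm.trans (map_add _ _ _).symm

variable (A) in
/-- A right inverse of `shift - 1` on the sheaf induced from a coinduced sheaf. -/
def primitiveHom : induced (coind (weilGroup F k).subtype A) ⟶
    induced (coind (weilGroup F k).subtype A) :=
  homOfPull (AbSheaf.homMk (fun U => AddMonoidHom.mk' primitive primitive_add) fun f x =>
      (congrArg primitive (res_eq_frobPull _ f x)).trans
        ((primitive_frobPull _ x).trans (res_eq_frobPull _ f _).symm))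
    fun h U V f w x => by
      obtain ⟨b, rfl⟩ := frobPow_bijective.2 h
      exact primitive_frobPull w x

lemma app_shift_primitive (y : (induced (coind (weilGroup F k).subtype A)).sec U) :
    app (shift (coind (weilGroup F k).subtype A)) U (primitive y) = primitive y + y :=
  ext₂ fun i j c hc P f w => by
    obtain ⟨i, rfl⟩ : ∃ i', i = i' + 1 := ⟨i - 1, by ring⟩
    have hc' : c = i + (j + 1) := by rw [hc]; ring
    refine (eval₂_shift hc hc' w _).trans ((eval₂_primitive hc' w y).trans ?_)
    rw [intSum_add_one, map_add, eval₂_primitive hc w y]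
    exact congrArg _ (eval₂_congr (by rw [hc]; ring) _ _ rfl _ _ y)

variable (A) in
lemma primitiveHom_comp : primitiveHom A ≫ (shift (coind (weilGroup F k).subtype A) - 𝟙 _) =
    𝟙 _ := by
  rw [Preadditive.comp_sub, Category.comp_id, sub_eq_iff_eq_add']
  exact hom_ext_app fun U y => app_shift_primitive y

end coind

end

end WeilEtale

namespace WeilEtale

noncomputable section

variable {F k : Type u} [Field F] [Fintype F] [Field k] [Algebra F k] [IsAlgClosure F k]
  {X : Over (Spec (.of F))} {E : SchemeSubcategory X}

namespace AbSheaf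

variable {A B C : AbSheaf k E} {U V : Ebar k E}

/-- The sieve of morphisms on which a section lifts along a morphism of sheaves. -/
def liftSieve (a : A ⟶ B) (y : B.obj.obj (op U)) : Sieve U := Presheaf.imageSieve a.hom y

lemma epi_iff {a : A ⟶ B} :
    Epi a ↔ ∀ (U : Ebar k E) (y : B.obj.obj (op U)), liftSieve a y ∈ Ebar.etaleTopology E U := by
  rw [← Sheaf.isLocallySurjective_iff_epi']
  exact ⟨fun h U y => h.imageSieve_mem y, fun h => ⟨fun y => h _ y⟩⟩

lemma app_injective (a : A ⟶ B) [Mono a] (U : Ebar k E) : Function.Injective (app a U) := by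
  have : Mono (a.hom.app (op U)) := inferInstanceAs (Mono ((sheafToPresheaf _ _ ⋙
    (evaluation _ _).obj (op U)).map a))
  exact (AddCommGrpCat.mono_iff_injective _).1 this

lemma mono_of_injective {a : A ⟶ B} (h : ∀ U, Function.Injective (app a U)) : Mono a where
  right_cancellation b c e := hom_ext fun U x => h U
    (congrArg (fun φ : _ ⟶ B => app φ U x) e)

lemma exists_app_eq {S : ShortComplex (AbSheaf k E)} (hS : S.Exact) [Mono S.f]
    {x : S.X₂.obj.obj (op U)} (hx : app S.g U x = 0) : ∃ y, app S.f U y = x := by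
  let Γ : AbSheaf k E ⥤ AddCommGrpCat := sheafToPresheaf _ _ ⋙ (evaluation _ _).obj (op U)
  have h : (S.map Γ).Exact := hS.map_of_mono_of_preservesKernel Γ inferInstance inferInstance
  exact ((S.map Γ).ab_exact_iff.1 h) x hx

/-- Exactness of sheaves in terms of sections. -/
lemma exact_iff (S : ShortComplex (AbSheaf k E)) :
    S.Exact ↔ ∀ (U : Ebar k E) (x : S.X₂.obj.obj (op U)), app S.g U x = 0 →
      liftSieve S.f x ∈ Ebar.etaleTopology E U := by
  have hι : app (kernel.lift S.g S.f S.zero ≫ kernel.ι S.g) = app S.f := by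
    rw [kernel.lift_ι]
  have hι' (U : Ebar k E) (x) : app (kernel.ι S.g) U (app (kernel.lift S.g S.f S.zero) U x) =
      app S.f U x := DFunLike.congr_fun (congrFun hι U) x
  rw [ShortComplex.exact_iff_epi_kernel_lift, epi_iff]
  constructor
  · intro h U x hx
    let T := ShortComplex.mk (kernel.ι S.g) S.g (kernel.condition S.g)
    have hT : T.Exact := ShortComplex.exact_of_f_is_kernel _ (kernelIsKernel S.g)
    have : Mono T.f := inferInstanceAs (Mono (kernel.ι S.g))
    obtain ⟨y, rfl⟩ := exists_app_eq hT hx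
    refine GrothendieckTopology.superset_covering _ ?_ (h U y)
    rintro V f ⟨z, hz⟩
    exact ⟨z, (hι' V z).symm.trans ((congrArg (app (kernel.ι S.g) V) hz).trans (app_res _ f y))⟩
  · intro h U y
    refine GrothendieckTopology.superset_covering _ ?_ (h U (app (kernel.ι S.g) U y)
      (DFunLike.congr_fun (congrFun (congrArg app (kernel.condition S.g)) U) y))
    rintro V f ⟨z, hz⟩
    exact ⟨z, app_injective (kernel.ι S.g) V ((hι' V z).trans (hz.trans (app_res _ f y).symm))⟩

lemma exact_of_lift {S : ShortComplex (AbSheaf k E)}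
    (h : ∀ (U : Ebar k E) (x : S.X₂.obj.obj (op U)), app S.g U x = 0 → ∃ y, app S.f U y = x) :
    S.Exact := by
  rw [exact_iff]
  intro U x hx
  obtain ⟨y, rfl⟩ := h U x hx
  refine GrothendieckTopology.superset_covering _ (fun V f _ => ?_)
    (GrothendieckTopology.top_mem _ U)
  exact ⟨S.X₁.res f y, app_res S.f f y⟩

end AbSheaf

namespace EquivSheaf

variable {H : Type u} [Group H] {ρ : H →* Gal(k/F)} {𝓕 𝓖 𝓗 : EquivSheaf E ρ} {U : Ebar k E}

lemma app_injective (a : 𝓕 ⟶ 𝓖) [Mono a] (U : Ebar k E) : Function.Injective (app a U) :=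
  have := mono_hom a
  AbSheaf.app_injective a.hom U

lemma mono_of_injective {a : 𝓕 ⟶ 𝓖} (h : ∀ U, Function.Injective (app a U)) : Mono a :=
  (forget ρ).mono_of_mono_map (AbSheaf.mono_of_injective h)

lemma exact_map_forget {S : ShortComplex (EquivSheaf E ρ)} (hS : S.Exact) :
    (S.map (forget ρ)).Exact := hS.map (forget ρ)

lemma exact_of_exact_map_forget {S : ShortComplex (EquivSheaf E ρ)}
    (hS : (S.map (forget ρ)).Exact) : S.Exact :=
  (S.exact_map_iff_of_faithful (forget ρ)).1 hS

lemma liftSieve_mem {S : ShortComplex (EquivSheaf E ρ)} (hS : S.Exact) {x : S.X₂.sec U}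
    (hx : app S.g U x = 0) : AbSheaf.liftSieve S.f.hom x ∈ Ebar.etaleTopology E U :=
  (AbSheaf.exact_iff _).1 (exact_map_forget hS) U x hx

lemma exists_app_eq {S : ShortComplex (EquivSheaf E ρ)} (hS : S.Exact) [Mono S.f] {x : S.X₂.sec U}
    (hx : app S.g U x = 0) : ∃ y, app S.f U y = x :=
  have : Mono (S.map (forget ρ)).f := mono_hom S.f
  AbSheaf.exists_app_eq (exact_map_forget hS) hx

lemma exact_of_lift {S : ShortComplex (EquivSheaf E ρ)}
    (h : ∀ (U : Ebar k E) (x : S.X₂.sec U), app S.g U x = 0 → ∃ y, app S.f U y = x) :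
    S.Exact := exact_of_exact_map_forget (AbSheaf.exact_of_lift h)

lemma isSmooth_of_app {𝓕 𝓖 : WeilSheaf k E} {a : 𝓕 ⟶ 𝓖} (ha : Function.Injective (app a U))
    {x : 𝓕.sec U} (hx : IsSmooth (app a U x)) : IsSmooth x := by
  obtain ⟨K, hK, M, m, hm, h1, h2⟩ := hx
  exact ⟨K, hK, M, m, hm, h1, ha ((app_frobPull a _ x).trans h2)⟩

end EquivSheaf

open EquivSheaf

variable (k E) in
/-- The functor sending a Weil-étale sheaf to its sheaf of smooth sections. -/
abbrev smoothSections : WeilSheaf k E ⥤ AbSheaf k E := smoothFunctor k E ⋙ underlying k E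

instance : (smoothFunctor k E).Additive where
  map_add := rfl

lemma exists_smoothSections_eq {S : ShortComplex (WeilSheaf k E)}
    (h : ∀ (U : Ebar k E) (x : S.X₂.sec U), app S.g U x = 0 → ∃ y, app S.f U y = x)
    (hi : ∀ U, Function.Injective (app S.f U)) : (S.map (smoothSections k E)).Exact :=
  AbSheaf.exact_of_lift fun U x hx => by
    obtain ⟨y, hy⟩ := h U (smoothObj.val U x) (congrArg (smoothObj.val U) hx)
    have hy' : IsSmooth y := isSmooth_of_app (hi U) (hy ▸ smoothObj.isSmooth_val x)
    exact ⟨smoothObj.mk y hy', smoothObj.val_injective hy⟩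

/-- Taking smooth sections is left exact. -/
lemma exact_smoothSections {S : ShortComplex (WeilSheaf k E)} (hS : S.Exact) [Mono S.f] :
    (S.map (smoothSections k E)).Exact :=
  exists_smoothSections_eq (fun _ _ hx => exists_app_eq hS hx) (app_injective S.f)

instance : (smoothSections k E).PreservesMonomorphisms where
  preserves a _ := AbSheaf.mono_of_injective fun U x y h => smoothObj.val_injective
    (app_injective a U (congrArg (smoothObj.val U) h))

end

end WeilEtale

namespace WeilEtale

noncomputable section

variable {F k : Type u} [Field F] [Fintype F] [Field k] [Algebra F k] [IsAlgClosure F k]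
  {X : Over (Spec (.of F))} {E : SchemeSubcategory X}

open EquivSheaf

namespace Ebar

variable {U V W : Ebar k E}

/-- Finitely many covering sieves contain a common covering sieve. -/
lemma exists_covering_forall_lt {C : ℕ → Sieve U} (hC : ∀ i, C i ∈ etaleTopology E U) (n : ℕ) :
    ∃ T ∈ etaleTopology E U, ∀ i < n, T ≤ C i := by
  induction n with
  | zero => exact ⟨⊤, GrothendieckTopology.top_mem _ _, fun i hi => (Nat.not_lt_zero i hi).elim⟩
  | succ n ih =>
    obtain ⟨T, hT, h⟩ := ih
    refine ⟨T ⊓ C n, GrothendieckTopology.intersection_covering _ hT (hC n), fun i hi => ?_⟩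
    obtain hi | rfl := Nat.lt_succ_iff_lt_or_eq.1 hi
    · exact inf_le_left.trans (h i hi)
    · exact inf_le_right

/-- A covering sieve can be refined to one that is carried into it by all powers of an automorphism
given by an element of the Galois group acting through a model. -/
lemma exists_refinement {K : IntermediateField F k} [FiniteDimensional F K] (M : Model U K) {m : ℕ}
    (hm : frob F k ^ m ∈ K.fixingSubgroup) {S : Sieve U} (hS : S ∈ etaleTopology E U) :
    ∃ T ∈ etaleTopology E U, ∀ (V : Ebar k E) (g : V ⟶ U), T g → ∀ z : ℤ,
      ∃ (W : Ebar k E) (f : W ⟶ U) (h : V.sch ⟶ W.sch), S f ∧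
        h ≫ f.hom.left = g.hom.left ≫ M.act ((frob F k ^ m) ^ z) (zpow_mem hm z) := by
  obtain ⟨r, W, f, hf, he, hs⟩ := exists_finite_cover hS
  choose K' hK' N using fun i => exists_model (W i)
  have w (i : Fin r) : (f i).hom.left ≫ U.str ≫ galAct X (1 : Gal(k/F)) = (W i).str := by
    rw [galAct_one, Category.comp_id]
    exact Over.w (f i).hom
  choose n hn0 hn hn' hc using fun i =>
    have := hK' i
    (N i).some.exists_forall_act_comm M (w i)
  let l : ℕ := ∏ i, n i
  have hl : 0 < l := Finset.prod_pos fun i _ => hn0 i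
  let S₀ : Sieve U := Sieve.generate (Presieve.ofArrows W f)
  have hS₀ : S₀ ∈ etaleTopology E U :=
    mem_of_cover (fun i => Sieve.le_generate _ _ _ (Presieve.ofArrows.mk i)) he hs
  let c (z : ℤ) : (twist ((frob F k ^ m) ^ z)).obj U ⟶ U :=
    mkHom (U := (twist ((frob F k ^ m) ^ z)).obj U) (M.act _ (zpow_mem hm z)) (M.act_str _ _)
  let C (z : ℤ) : Sieve U := (S₀.pullback (c z)).functorPullback (twist ((frob F k ^ m) ^ z))
  have hC (z : ℤ) : C z ∈ etaleTopology E U :=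
    functorPullback_twist_mem _ (GrothendieckTopology.pullback_stable _ (c z) hS₀)
  obtain ⟨T, hT, hTC⟩ := exists_covering_forall_lt (fun i : ℕ => hC i) l
  refine ⟨T, hT, fun V g hg z => ?_⟩
  have h1 := Int.emod_nonneg z (b := l) (by omega)
  have h2 := Int.emod_lt_of_pos z (b := l) (by omega)
  obtain ⟨i, hi⟩ := Int.eq_ofNat_of_zero_le h1
  obtain ⟨Z, h, _, ⟨a⟩, e⟩ := hTC i (by omega) _ hg
  have e' : h.hom.left ≫ (f a).hom.left = g.hom.left ≫ M.act ((frob F k ^ m) ^ (i : ℤ))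
    (zpow_mem hm i) := congrArg (fun φ => φ.hom.left) e
  have hy (N' : ℕ) (hN : N' ∣ l) : (frob F k ^ m) ^ ((l : ℤ) * (z / l)) ∈
      (levelField F k N').fixingSubgroup := by
    rw [zpow_mul, zpow_natCast, ← pow_mul, mul_comm, pow_mul]
    exact zpow_mem (pow_mem (fixingSubgroup_levelField_mono hN (frob_pow_mem_levelField l)) m) _
  have hya := hy (n a) (Finset.dvd_prod_of_mem n (Finset.mem_univ a))
  have hyK := zpow_mem hm ((l : ℤ) * (z / l))
  have hyK' := fixingSubgroup_levelField_le (hn' a) hya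
  refine ⟨W a, f a, h.hom.left ≫ (N a).some.act _ hyK', hf a, ?_⟩
  refine (Category.assoc _ _ _).trans ((congrArg (h.hom.left ≫ ·) (hc a _ hya hyK hyK')).trans ?_)
  refine (Category.assoc _ _ _).symm.trans ((congrArg (· ≫ M.act _ hyK) e').trans ?_)
  refine (Category.assoc _ _ _).trans (congrArg (g.hom.left ≫ ·) ((M.act_mul _ _ _ hyK).symm.trans
    (Model.act_congr ?_ _ _)))
  rw [← zpow_add, ← hi, Int.emod_add_mul_ediv]

end Ebar

end

end WeilEtale

namespace WeilEtale

noncomputable section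

variable {F k : Type u} [Field F] [Fintype F] [Field k] [Algebra F k] [IsAlgClosure F k]
  {X : Over (Spec (.of F))} {E : SchemeSubcategory X}

open EquivSheaf

variable {U V W P : Ebar k E}

namespace coind

variable {A B : AbSheaf k E}

lemma fam_map (a : A ⟶ B) (i : ℤ) (x : (coind (weilGroup F k).subtype A).sec U) :
    fam i U (app ((functor (weilGroup F k).subtype).map a) U x) =
      AbSheaf.app a (phi i U) (fam i U x) :=
  eval_map (ρ := (weilGroup F k).subtype) (P := phi i U) (g := frobPow F k i) (f := 𝟙 U.sch) a _ x

instance : (functor (k := k) (E := E) (weilGroup F k).subtype).Additive :=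
  (adjunction E (weilGroup F k).subtype).right_adjoint_additive

/-- Componentwise lifts of a smooth section give a smooth lift. -/
lemma exists_isSmooth_lift {𝓕 𝓖 : WeilSheaf k E} (a : 𝓕 ⟶ 𝓖) {y : (induced 𝓖).sec V}
    (hy : IsSmooth y) (h : ∀ j : ℤ, ∃ z, app a (phi j V) z = fam j V y) :
    ∃ x : (induced 𝓕).sec V, IsSmooth x ∧
      app ((functor (weilGroup F k).subtype).map a.hom) V x = y := by
  obtain ⟨K, _, N, n, hn, hy⟩ := hy
  obtain ⟨hnK, hper⟩ := (fixedBy_iff N n y).1 hy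
  choose z hz using h
  obtain ⟨x', hx'⟩ := (periodicToPi_bijective 𝓕 N n hn hnK).2 fun i => z ((i : ℕ) : ℤ)
  let x : (induced 𝓕).sec V := ofFam (A := 𝓕.sheaf) x'.1
  have hfx (j : ℤ) : fam j V x = x'.1 j := fam_ofFam (A := 𝓕.sheaf) _ j
  have hx : (induced 𝓕).FixedBy N n x :=
    (fixedBy_iff N n x).2 ⟨hnK, (funext hfx : (fun j => fam j V x) = x'.1) ▸ x'.2⟩
  let b : induced 𝓕 ⟶ induced 𝓖 := (functor (weilGroup F k).subtype).map a.hom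
  have hbx : (induced 𝓖).FixedBy N n (app b V x) :=
    ⟨hnK, (app_frobPull b _ x).symm.trans (congrArg _ hx.2)⟩
  refine ⟨x, hx.isSmooth hn, ?_⟩
  obtain ⟨_, hper'⟩ := (fixedBy_iff N n (app b V x)).1 hbx
  have key : (⟨_, hper'⟩ : periodic 𝓖 N n hnK) = ⟨_, hper⟩ := by
    refine (periodicToPi_bijective 𝓖 N n hn hnK).1 (funext fun i => ?_)
    refine (fam_map a.hom ((i : ℕ) : ℤ) x).trans ((congrArg _ (hfx _)).trans ?_)
    exact (congrArg (app a (phi ((i : ℕ) : ℤ) V)) (congrFun hx' i)).trans (hz _)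
  exact fam_ext fun j => congrFun (congrArg Subtype.val key) j

end coind

variable (k E) in
/-- The functor `𝓕 ↦ ∏_i (φ^i)^* 𝓕`. -/
abbrev inducedFunctor : WeilSheaf k E ⥤ WeilSheaf k E :=
  EquivSheaf.forget _ ⋙ coind.functor (weilGroup F k).subtype

/-- The components of a section that is invariant under `φ^m` are determined by those with index
in `0, …, m - 1`. -/
lemma EquivSheaf.FixedBy.eval_eq {A : AbSheaf k E} {K : IntermediateField F k} {M : Model U K} {m : ℕ}
    {y : (coind (weilGroup F k).subtype A).sec U}
    (hy : (coind (weilGroup F k).subtype A).FixedBy M m y) {r z j : ℤ} (hj : j = r + m * z)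
    {g : P.sch ⟶ U.sch} (w : g ≫ U.str ≫ galAct X (frob F k ^ j) = P.str)
    (w' : (g ≫ M.act ((frob F k ^ m) ^ z) (zpow_mem hy.mem z)) ≫ U.str ≫
      galAct X (frob F k ^ r) = P.str) :
    coind.eval (ρ := (weilGroup F k).subtype) (frobPow F k r)
      (g ≫ M.act ((frob F k ^ m) ^ z) (zpow_mem hy.mem z)) w' y =
      coind.eval (ρ := (weilGroup F k).subtype) (frobPow F k j) g w y := by
  have hz : ((frob F k ^ m) ^ z)⁻¹ * frob F k ^ ((m : ℤ) * z) = 1 := by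
    rw [zpow_mul, zpow_natCast, inv_mul_cancel]
  have h1 := hy.frobPull_eq (dvd_mul_right (m : ℤ) z) (inv_mem (zpow_mem hy.mem z)) hz
  refine (congrArg _ h1.symm).trans ?_
  refine coind.eval_frobPull hj _ w' (f'' := g) ?_ w y
  rw [Category.assoc, ← M.act_mul]
  refine (Category.comp_id g).symm.trans (congrArg (g ≫ ·) ?_)
  exact ((Model.act_congr (mul_inv_cancel _) _ (one_mem _)).trans (M.act_one _)).symm

/-- The functor of smooth sections of the induced sheaf is exact. -/
lemma exact_smoothSections_induced {S : ShortComplex (WeilSheaf k E)} (hS : S.Exact) :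
    (S.map (inducedFunctor k E ⋙ smoothSections k E)).Exact := by
  rw [AbSheaf.exact_iff]
  intro U x hx
  let y : (induced S.X₂).sec U := smoothObj.val (𝓕 := induced S.X₂) U x
  have hgy : app ((inducedFunctor k E).map S.g) U y = 0 :=
    congrArg (smoothObj.val (𝓕 := induced S.X₃) U) hx
  obtain ⟨K, _, M, m, hm, hy⟩ := smoothObj.isSmooth_val (𝓕 := induced S.X₂) x
  have hgy' (j : ℤ) : app S.g (phi j U) (coind.fam j U y) = 0 :=
    (coind.fam_map S.g.hom j y).symm.trans ((congrArg _ hgy).trans (map_zero _))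
  have hS' (i : ℕ) : (AbSheaf.liftSieve S.f.hom (coind.fam i U y)).functorPullback
      (Ebar.twist (frob F k ^ (i : ℤ))) ∈ Ebar.etaleTopology E U :=
    Ebar.functorPullback_twist_mem _ (liftSieve_mem hS (hgy' i))
  obtain ⟨T₀, hT₀, h₀⟩ := Ebar.exists_covering_forall_lt hS' m
  obtain ⟨T, hT, h⟩ := Ebar.exists_refinement M hy.mem hT₀
  refine GrothendieckTopology.superset_covering _ (fun V g hg => ?_) hT
  have hsm : IsSmooth ((induced S.X₂).res g y) :=
    IsSmooth.res (smoothObj.isSmooth_val (𝓕 := induced S.X₂) x) g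
  suffices hl : ∀ j : ℤ, ∃ z, app S.f (phi j V) z = coind.fam j V ((induced S.X₂).res g y) by
    obtain ⟨z, hz, hz'⟩ := coind.exists_isSmooth_lift S.f hsm hl
    exact ⟨smoothObj.mk (𝓕 := induced S.X₁) z hz, smoothObj.val_injective (𝓕 := induced S.X₂) hz'⟩
  intro j
  have h1 := Int.emod_nonneg j (b := m) (by omega)
  have h2 := Int.emod_lt_of_pos j (b := m) (by omega)
  obtain ⟨r, hr⟩ := Int.eq_ofNat_of_zero_le h1
  obtain ⟨q, hj⟩ : ∃ q : ℤ, j = r + m * q := ⟨j / m, by rw [← hr, Int.emod_add_mul_ediv]⟩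
  obtain ⟨W, f, l, hf, hl⟩ := h V g hg q
  obtain ⟨z, hz⟩ := h₀ r (by omega) _ hf
  have wg : g.hom.left ≫ U.str = V.str := Over.w g.hom
  have wf : f.hom.left ≫ U.str = W.str := Over.w f.hom
  have wl : l ≫ W.str ≫ galAct X (frob F k ^ (r : ℤ)) = (phi j V).str := by
    change _ = V.str ≫ galAct X (frob F k ^ j)
    rw [← wf, Category.assoc, ← Category.assoc l, hl, Category.assoc, ← Category.assoc (M.act _ _),
      M.act_str, Category.assoc, ← galAct_mul, ← Category.assoc, wg, hj, zpow_add, zpow_mul,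
      zpow_natCast, zpow_natCast, gal_mul_comm]
  have wgj : g.hom.left ≫ U.str ≫ galAct X (frob F k ^ j) = (phi j V).str := by
    rw [← Category.assoc, wg]
    rfl
  have wlf : (l ≫ f.hom.left) ≫ U.str ≫ galAct X (frob F k ^ (r : ℤ)) = (phi j V).str := by
    rw [Category.assoc, ← Category.assoc f.hom.left, wf, wl]
  refine ⟨S.X₁.res (Ebar.mkHom l wl : phi j V ⟶ phi r W) z, ?_⟩
  refine (app_res S.f _ z).trans ((congrArg _ (hz.trans
    (coind.fam_res f y r).symm)).trans ?_)
  refine (coind.eval_eq_res_fam (U := W) (P := phi j V) (i := (r : ℤ)) (f := l) wl _).symm.trans ?_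
  refine (coind.eval_res (ρ := (weilGroup F k).subtype) (V := W) (U := U) (P := phi j V)
    (g := frobPow F k r) (f := l) wl f y).trans ?_
  refine (coind.eval_congr (ρ := (weilGroup F k).subtype) (U := U) (P := phi j V)
    (g := frobPow F k r) (g' := frobPow F k r) rfl hl wlf y).trans ?_
  refine (hy.eval_eq (P := phi j V) (r := r) (j := j) (g := g.hom.left) hj wgj
    ((congrArg (· ≫ U.str ≫ galAct X (frob F k ^ (r : ℤ))) hl.symm).trans wlf)).trans ?_
  refine Eq.trans ?_ (coind.fam_res g y j).symm
  exact coind.eval_eq_res_fam (U := U) (P := phi j V) (i := j) (f := g.hom.left) wgj y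

end

end WeilEtale

namespace WeilEtale

noncomputable section

/-- Exactness of the invariants of a complex with an operator. -/
lemma exact_of_exact_resolution {𝒜 : Type*} [Category 𝒜] [Abelian 𝒜] {P' K' L' M' K L M : 𝒜}
    {d₁ : P' ⟶ K'} {d₂ : K' ⟶ L'} {d₃ : L' ⟶ M'} {e₂ : K ⟶ L} {e₃ : L ⟶ M} {ηK : K ⟶ K'}
    {ηL : L ⟶ L'} {ηM : M ⟶ M'} {tP : P' ⟶ P'} {tK : K' ⟶ K'} {tL : L' ⟶ L'}
    {z₁ : d₁ ≫ d₂ = 0} {z₂ : d₂ ≫ d₃ = 0} {z : e₂ ≫ e₃ = 0} {zη : ηK ≫ tK = 0}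
    (h₁ : (ShortComplex.mk d₁ d₂ z₁).Exact) (h₂ : (ShortComplex.mk d₂ d₃ z₂).Exact)
    (hη : (ShortComplex.mk ηK tK zη).Exact) [Mono ηL] [Epi tP] (hL : ηL ≫ tL = 0)
    (c₁ : tP ≫ d₁ = d₁ ≫ tK) (c₂ : tK ≫ d₂ = d₂ ≫ tL) (n₂ : ηK ≫ d₂ = e₂ ≫ ηL)
    (n₃ : ηL ≫ d₃ = e₃ ≫ ηM) : (ShortComplex.mk e₂ e₃ z).Exact := by
  rw [ShortComplex.exact_iff_exact_up_to_refinements] at h₁ h₂ hη ⊢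
  intro A l hl
  have hl' : (l ≫ ηL) ≫ d₃ = 0 := by rw [Category.assoc, n₃, reassoc_of% hl, zero_comp]
  obtain ⟨A₁, π₁, _, k', hk'⟩ := h₂ (l ≫ ηL) hl'
  dsimp only at l hl k' hk'
  have hk'' : (k' ≫ tK) ≫ d₂ = 0 := by
    rw [Category.assoc, c₂, ← Category.assoc, ← hk', Category.assoc, Category.assoc, hL,
      comp_zero, comp_zero]
  obtain ⟨A₂, π₂, _, p', hp'⟩ := h₁ (k' ≫ tK) hk''
  obtain ⟨A₃, π₃, _, p'', hp''⟩ := surjective_up_to_refinements_of_epi tP p'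
  dsimp only at p' hp'
  have hk : ((π₃ ≫ π₂) ≫ k' - p'' ≫ d₁) ≫ tK = 0 := by
    rw [Preadditive.sub_comp, Category.assoc, Category.assoc, hp', Category.assoc, ← c₁,
      ← Category.assoc, hp'', Category.assoc, sub_self]
  obtain ⟨A₄, π₄, _, κ, hκ⟩ := hη _ hk
  dsimp only at κ hκ
  refine ⟨A₄, π₄ ≫ π₃ ≫ π₂ ≫ π₁, inferInstance, κ, ?_⟩
  rw [← cancel_mono ηL]
  simp only [Category.assoc]
  rw [← n₂, ← Category.assoc κ, ← hκ, hk']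
  simp only [Category.assoc, Preadditive.comp_sub, Preadditive.sub_comp, z₁, comp_zero, sub_zero]

/-- A left exact functor `Λ` preserves exactness at the third term of an exact complex that starts
with an object `P` for which `t P` remains an epimorphism, if there are copresentations
`0 ⟶ X ⟶ D X ⟶ D X` such that `Λ ∘ D` is exact. -/
lemma exact_map_of_exact_resolution {𝒞 𝒜 : Type*} [Category 𝒞] [Category 𝒜] [Preadditive 𝒞]
    [Abelian 𝒜] {D : 𝒞 ⥤ 𝒞} {Λ : 𝒞 ⥤ 𝒜} [D.PreservesZeroMorphisms] [Λ.PreservesZeroMorphisms]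
    {η : ∀ Y, Y ⟶ D.obj Y} {t : ∀ Y, D.obj Y ⟶ D.obj Y} {z : ∀ Y, η Y ≫ t Y = 0}
    (hΛ : ∀ S : ShortComplex 𝒞, S.Exact → (S.map (D ⋙ Λ)).Exact)
    (hη : ∀ Y, ((ShortComplex.mk (η Y) (t Y) (z Y)).map Λ).Exact) (hm : ∀ Y, Mono (Λ.map (η Y)))
    (nη : ∀ {Y Z} (a : Y ⟶ Z), η Y ≫ D.map a = a ≫ η Z)
    (nt : ∀ {Y Z} (a : Y ⟶ Z), t Y ≫ D.map a = D.map a ≫ t Z) {P K L M : 𝒞}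
    {e₁ : P ⟶ K} {e₂ : K ⟶ L} {e₃ : L ⟶ M} {z₁ : e₁ ≫ e₂ = 0} {z₂ : e₂ ≫ e₃ = 0}
    (h₁ : (ShortComplex.mk e₁ e₂ z₁).Exact) (h₂ : (ShortComplex.mk e₂ e₃ z₂).Exact)
    (hP : Epi (Λ.map (t P))) : ((ShortComplex.mk e₂ e₃ z₂).map Λ).Exact := by
  have := hm L
  refine exact_of_exact_resolution (hΛ _ h₁) (hΛ _ h₂) (hη K) (ηL := Λ.map (η L))
    (ηM := Λ.map (η M)) (tP := Λ.map (t P)) (tL := Λ.map (t L)) ?_ ?_ ?_ ?_ ?_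
  · rw [← Λ.map_comp, z, Λ.map_zero]
  all_goals simp only [Functor.comp_map, ← Λ.map_comp, nη, nt]

lemma sub_id_comp_eq {𝒞 : Type*} [Category 𝒞] [Preadditive 𝒞] {Y Z : 𝒞} {s : Y ⟶ Y} {t : Z ⟶ Z}
    {a : Y ⟶ Z} (h : a ≫ t = s ≫ a) : (s - 𝟙 Y) ≫ a = a ≫ (t - 𝟙 Z) := by
  rw [Preadditive.sub_comp, Preadditive.comp_sub, Category.comp_id, Category.id_comp, h]

variable {F k : Type u} [Field F] [Fintype F] [Field k] [Algebra F k] [IsAlgClosure F k]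
  {X : Over (Spec (.of F))} {E : SchemeSubcategory X}

open EquivSheaf

variable {𝓕 𝓖 : WeilSheaf k E}

/-- The natural embedding of a sheaf into its induced sheaf. -/
def toInduced (𝓕 : WeilSheaf k E) : 𝓕 ⟶ (inducedFunctor k E).obj 𝓕 := coind.unit 𝓕

/-- The endomorphism `shift - 1` of the induced sheaf. -/
def shiftSub (𝓕 : WeilSheaf k E) : (inducedFunctor k E).obj 𝓕 ⟶ (inducedFunctor k E).obj 𝓕 :=
  shift 𝓕 - 𝟙 (induced 𝓕)

lemma app_shiftSub {U : Ebar k E} (x : (induced 𝓕).sec U) :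
    app (shiftSub 𝓕) U x = app (shift 𝓕) U x - x := by
  refine eq_sub_of_add_eq ?_
  change app (shift 𝓕 - 𝟙 (induced 𝓕) + 𝟙 (induced 𝓕)) U x = _
  rw [sub_add_cancel]

instance : Mono (toInduced 𝓕) := mono_of_injective coind.app_unit_injective

lemma toInduced_naturality (a : 𝓕 ⟶ 𝓖) :
    toInduced 𝓕 ≫ (inducedFunctor k E).map a = a ≫ toInduced 𝓖 :=
  ((coind.adjunction E (weilGroup F k).subtype).unit.naturality a).symm

lemma toInduced_shiftSub (𝓕 : WeilSheaf k E) : toInduced 𝓕 ≫ shiftSub 𝓕 = 0 :=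
  (Preadditive.comp_sub _ _ _).trans (sub_eq_zero.2
    ((coind.unit_comp_mulLeft _).trans (Category.comp_id _).symm))

lemma shiftSub_naturality (a : 𝓕 ⟶ 𝓖) :
    shiftSub 𝓕 ≫ (inducedFunctor k E).map a = (inducedFunctor k E).map a ≫ shiftSub 𝓖 :=
  sub_id_comp_eq (Y := induced 𝓕) (Z := induced 𝓖) (coind.map_comp_mulLeft a (frobPow F k 1))

lemma exists_toInduced_eq {U : Ebar k E} {x : (induced 𝓕).sec U}
    (hx : app (shiftSub 𝓕) U x = 0) : ∃ y, app (toInduced 𝓕) U y = x := by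
  refine ⟨_, coind.exists_app_unit_eq (ρ := (weilGroup F k).subtype) (c := frobPow F k 1)
    (fun g => ?_) x (sub_eq_zero.1 ((app_shiftSub x).symm.trans hx))⟩
  obtain ⟨n, rfl⟩ := frobPow_bijective.2 g
  exact ⟨n, Subtype.ext (by simp [frobPow])⟩

/-- The resolution of a sheaf by induced sheaves. -/
lemma exact_toInduced (𝓕 : WeilSheaf k E) :
    (ShortComplex.mk (toInduced 𝓕) (shiftSub 𝓕) (toInduced_shiftSub 𝓕)).Exact :=
  exact_of_lift fun _ _ hx => exists_toInduced_eq hx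

instance : Epi (shiftSub 𝓕) := by
  refine (EquivSheaf.forget _).epi_of_epi_map (AbSheaf.epi_iff.2 fun U y => ?_)
  obtain ⟨x, hx⟩ := exists_shift_sub 𝓕 y
  refine GrothendieckTopology.superset_covering _ (fun V f _ => ?_)
    (GrothendieckTopology.top_mem _ U)
  exact ⟨(induced 𝓕).res f x, (app_res (shiftSub 𝓕) f x).trans
    (congrArg ((induced 𝓕).res f) ((app_shiftSub x).trans hx))⟩

lemma epi_map_shiftSub_coind (A : AbSheaf k E) : Epi ((smoothSections k E).map
    (shiftSub (coind (weilGroup F k).subtype A))) :=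
  (SplitEpi.mk ((smoothSections k E).map (coind.primitiveHom A))
    (((smoothSections k E).map_comp _ _).symm.trans
      ((congrArg _ (coind.primitiveHom_comp A)).trans ((smoothSections k E).map_id _)))).epi

lemma epi_map_shiftSub_of_isSplitEpi (r : 𝓖 ⟶ 𝓕) [IsSplitEpi r]
    (h : Epi ((smoothSections k E).map (shiftSub 𝓖))) :
    Epi ((smoothSections k E).map (shiftSub 𝓕)) := by
  have : Epi ((smoothSections k E).map ((inducedFunctor k E).map r) ≫
      (smoothSections k E).map (shiftSub 𝓕)) := by
    rw [← Functor.map_comp, ← shiftSub_naturality, Functor.map_comp]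
    exact epi_comp _ _
  exact epi_of_epi ((smoothSections k E).map ((inducedFunctor k E).map r)) _

lemma epi_map_shiftSub_of_injective (𝓘 : WeilSheaf k E) [Injective 𝓘] :
    Epi ((smoothSections k E).map (shiftSub 𝓘)) :=
  have : IsSplitEpi (Injective.factorThru (𝟙 𝓘) (toInduced 𝓘)) :=
    ⟨⟨⟨toInduced 𝓘, Injective.comp_factorThru _ _⟩⟩⟩
  epi_map_shiftSub_of_isSplitEpi (Injective.factorThru (𝟙 𝓘) (toInduced 𝓘))
    (epi_map_shiftSub_coind _)

/-- Taking smooth sections preserves exactness at the third term of an exact complex that starts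
with a sheaf whose induced sheaf has enough smooth sections. -/
lemma exact_map_smoothSections {P K L M : WeilSheaf k E} {e₁ : P ⟶ K} {e₂ : K ⟶ L} {e₃ : L ⟶ M}
    {z₁ : e₁ ≫ e₂ = 0} {z₂ : e₂ ≫ e₃ = 0} (h₁ : (ShortComplex.mk e₁ e₂ z₁).Exact)
    (h₂ : (ShortComplex.mk e₂ e₃ z₂).Exact)
    (hP : Epi ((smoothSections k E).map (shiftSub P))) :
    ((ShortComplex.mk e₂ e₃ z₂).map (smoothSections k E)).Exact := by
  exact exact_map_of_exact_resolution (D := inducedFunctor k E) (Λ := smoothSections k E)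
    (η := toInduced) (t := shiftSub) (z := toInduced_shiftSub)
    (fun _ hS => exact_smoothSections_induced hS) (fun K =>
      have : Mono (ShortComplex.mk _ _ (toInduced_shiftSub K)).f :=
        inferInstanceAs (Mono (toInduced K))
      exact_smoothSections (exact_toInduced K)) (fun _ => inferInstance) toInduced_naturality
    shiftSub_naturality h₁ h₂ hP

end

end WeilEtale

namespace WeilEtale

noncomputable section

section Abelian

variable {𝒜 : Type*} [Category 𝒜] [Abelian 𝒜]

/-- A morphism from a complex `P₀ ⟶ P₁` in degrees `0` and `1` to `K` is a quasi-isomorphism if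
its cone is exact. -/
lemma quasiIso_of_exact {C K : CochainComplex 𝒜 ℕ} (f : C ⟶ K) {P₀ P₁ : 𝒜} (e₀ : C.X 0 ≅ P₀)
    (e₁ : C.X 1 ≅ P₁) {t : P₀ ⟶ P₁} {g₀ : P₀ ⟶ K.X 0} {g₁ : P₁ ⟶ K.X 1}
    (ht : C.d 0 1 = e₀.hom ≫ t ≫ e₁.inv) (hf₀ : f.f 0 = e₀.hom ≫ g₀) (hf₁ : f.f 1 = e₁.hom ≫ g₁)
    (hC : ∀ i, 2 ≤ i → IsZero (C.X i)) (hK : ∀ i, 2 ≤ i → K.ExactAt i)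
    {B : BinaryBicone P₁ (K.X 0)}
    {l : P₀ ⟶ B.pt} {m : B.pt ⟶ K.X 1} (hl : l = t ≫ B.inl + g₀ ≫ B.inr)
    (hm : m = B.fst ≫ g₁ - B.snd ≫ K.d 0 1) {z : l ≫ m = 0} {z' : m ≫ K.d 1 2 = 0} (_ : Mono l)
    (h₁ : (ShortComplex.mk l m z).Exact) (h₂ : (ShortComplex.mk m (K.d 1 2) z').Exact) :
    QuasiIso f := by
  rw [ShortComplex.exact_iff_exact_up_to_refinements] at h₁ h₂
  dsimp only at h₁ h₂
  have hd : e₀.hom ≫ t = C.d 0 1 ≫ e₁.hom := by simp [ht]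
  have lift {A : 𝒜} (x : A ⟶ C.X 1) (w : A ⟶ K.X 0) (h : x ≫ f.f 1 = w ≫ K.d 0 1) :
      ∃ (A' : 𝒜) (π : A' ⟶ A) (_ : Epi π) (c : A' ⟶ C.X 0), π ≫ x = c ≫ C.d 0 1 ∧
        π ≫ w = c ≫ f.f 0 := by
    obtain ⟨A', π, hπ, c, hc⟩ := h₁ (x ≫ e₁.hom ≫ B.inl + w ≫ B.inr) (by
      simp [hm, Preadditive.comp_sub, ← hf₁, h])
    refine ⟨A', π, hπ, c ≫ e₀.inv, ?_, ?_⟩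
    · have := congrArg (· ≫ B.fst) hc
      simp only [hl, Preadditive.comp_add, Preadditive.add_comp, Category.assoc, B.inl_fst,
        B.inr_fst, Category.comp_id, comp_zero, add_zero] at this
      rw [← cancel_mono e₁.hom, Category.assoc, this, Category.assoc, Category.assoc, ← hd,
        e₀.inv_hom_id_assoc]
    · have := congrArg (· ≫ B.snd) hc
      simp only [hl, Preadditive.comp_add, Preadditive.add_comp, Category.assoc, B.inl_snd,
        B.inr_snd, Category.comp_id, comp_zero, zero_add] at this
      rw [this, hf₀, Category.assoc, e₀.inv_hom_id_assoc]
  have hC2 {A : 𝒜} (x : A ⟶ C.X 1) : x ≫ C.d 1 2 = 0 := (hC 2 le_rfl).eq_of_tgt _ _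
  refine ⟨fun i => ?_⟩
  rw [quasiIsoAt_iff_isIso_homologyMap]
  have hmono : Mono (HomologicalComplex.homologyMap f i) := by
    match i with
    | 0 =>
      rw [HomologicalComplex.mono_homologyMap_iff_up_to_refinements f 0 0 1 (by simp) (by simp)]
      intro A x hx y hxy
      refine ⟨A, 𝟙 A, inferInstance, 0, ?_⟩
      rw [K.shape 0 0 (by simp), comp_zero] at hxy
      have h0 : (x ≫ e₀.hom) ≫ l = 0 := by
        rw [hl, Preadditive.comp_add, Category.assoc, Category.assoc, ← Category.assoc e₀.hom t,
          hd, ← Category.assoc e₀.hom g₀, ← hf₀, Category.assoc, reassoc_of% hx, reassoc_of% hxy]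
        simp
      have h1 : x ≫ e₀.hom = 0 := by rw [← cancel_mono l, h0, zero_comp]
      have : x = 0 := by rw [← cancel_mono e₀.hom, h1, zero_comp]
      simp [this]
    | 1 =>
      rw [HomologicalComplex.mono_homologyMap_iff_up_to_refinements f 0 1 2 (by simp) (by simp)]
      intro A x hx y hxy
      obtain ⟨A', π, hπ, c, hc, -⟩ := lift x y hxy
      exact ⟨A', π, hπ, c, hc⟩
    | i + 2 =>
      have h : IsZero (C.homology (i + 2)) :=
        HomologicalComplex.ExactAt.isZero_homology ((C.exactAt_iff _).2
          (ShortComplex.exact_of_isZero_X₂ _ (hC (i + 2) (by omega))))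
      exact ⟨fun a b _ => h.eq_of_tgt a b⟩
  have hepi : Epi (HomologicalComplex.homologyMap f i) := by
    match i with
    | 0 =>
      rw [HomologicalComplex.epi_homologyMap_iff_up_to_refinements f 0 0 1 (by simp) (by simp)]
      intro A y hy
      obtain ⟨A', π, hπ, c, hc, hc'⟩ := lift (0 : A ⟶ C.X 1) y (by rw [zero_comp, hy])
      exact ⟨A', π, hπ, c, by rw [← hc, comp_zero], 0, by rw [hc', zero_comp, add_zero]⟩
    | 1 =>
      rw [HomologicalComplex.epi_homologyMap_iff_up_to_refinements f 0 1 2 (by simp) (by simp)]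
      intro A y hy
      obtain ⟨A', π, hπ, β, hβ⟩ := h₂ y hy
      refine ⟨A', π, hπ, β ≫ B.fst ≫ e₁.inv, hC2 _, -(β ≫ B.snd), ?_⟩
      rw [hβ, hm, hf₁]
      simp [sub_eq_add_neg]
    | i + 2 =>
      have h : IsZero (K.homology (i + 2)) := (hK (i + 2) (by omega)).isZero_homology
      exact ⟨fun a b _ => h.eq_of_src a b⟩
  exact isIso_of_mono_of_epi _

variable {F D I₀ I₁ I₂ : 𝒜} {η : F ⟶ D} {s : D ⟶ D} {ι : F ⟶ I₀} {d₀ : I₀ ⟶ I₁} {d₁ : I₁ ⟶ I₂}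
  {b₀ : D ⟶ I₀} {b₁ : D ⟶ I₁} {B : BinaryBicone D I₀} {zs : η ≫ s = 0} {zι : ι ≫ d₀ = 0}
  {zd : d₀ ≫ d₁ = 0}

lemma mono_coneMap (hs : (ShortComplex.mk η s zs).Exact) [Mono ι] (hb₀ : η ≫ b₀ = ι) :
    Mono (s ≫ B.inl + b₀ ≫ B.inr) := by
  rw [ShortComplex.exact_iff_exact_up_to_refinements] at hs
  refine Preadditive.mono_of_cancel_zero _ fun {A} x hx => ?_
  have h1 := congrArg (· ≫ B.fst) hx
  have h2 := congrArg (· ≫ B.snd) hx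
  simp only [Preadditive.comp_add, Preadditive.add_comp, Category.assoc, B.inl_fst, B.inr_fst,
    B.inl_snd, B.inr_snd, Category.comp_id, comp_zero, add_zero, zero_add, zero_comp] at h1 h2
  obtain ⟨A', π, hπ, c, hc⟩ := hs x h1
  dsimp only at c hc
  have : c = 0 := by
    rw [← cancel_mono ι, ← hb₀, ← Category.assoc, ← hc, Category.assoc, h2, comp_zero, zero_comp]
  rw [← cancel_epi π, hc, this, zero_comp, comp_zero]

lemma coneMap_comp (hb₁ : s ≫ b₁ = b₀ ≫ d₀) :
    (s ≫ B.inl + b₀ ≫ B.inr) ≫ (B.fst ≫ b₁ - B.snd ≫ d₀) = 0 := by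
  simp [Preadditive.comp_sub, hb₁]

lemma coneMap_comp' [Epi s] (zd : d₀ ≫ d₁ = 0) (hb₁ : s ≫ b₁ = b₀ ≫ d₀) :
    (B.fst ≫ b₁ - B.snd ≫ d₀) ≫ d₁ = 0 := by
  have : b₁ ≫ d₁ = 0 := by
    rw [← cancel_epi s, reassoc_of% hb₁, zd, comp_zero, comp_zero]
  simp [Preadditive.sub_comp, this, zd]

lemma exact_coneMap [Epi s] (hι : (ShortComplex.mk ι d₀ zι).Exact)
    (hb₀ : η ≫ b₀ = ι) (hb₁ : s ≫ b₁ = b₀ ≫ d₀) (zs : η ≫ s = 0)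
    (hB : B.fst ≫ B.inl + B.snd ≫ B.inr = 𝟙 B.pt) :
    (ShortComplex.mk _ _ (coneMap_comp (B := B) hb₁)).Exact := by
  rw [ShortComplex.exact_iff_exact_up_to_refinements] at hι ⊢
  dsimp only at hι ⊢
  intro A β hβ
  obtain ⟨A₁, π₁, _, x, hx⟩ := surjective_up_to_refinements_of_epi s (β ≫ B.fst)
  have hβ' : (β ≫ B.fst) ≫ b₁ = (β ≫ B.snd) ≫ d₀ := by
    simpa [Preadditive.comp_sub, sub_eq_zero] using hβ
  obtain ⟨A₂, π₂, _, c, hc⟩ := hι (π₁ ≫ β ≫ B.snd - x ≫ b₀) (by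
    rw [Preadditive.sub_comp, Category.assoc, ← hβ', ← Category.assoc, hx, Category.assoc,
      Category.assoc, hb₁, sub_self])
  refine ⟨A₂, π₂ ≫ π₁, inferInstance, π₂ ≫ x + c ≫ η, ?_⟩
  have e1 : (π₂ ≫ x + c ≫ η) ≫ s = (π₂ ≫ π₁) ≫ β ≫ B.fst := by
    rw [Preadditive.add_comp, Category.assoc, Category.assoc, Category.assoc, zs, comp_zero,
      add_zero, hx]
  have e2 : (π₂ ≫ x + c ≫ η) ≫ b₀ = (π₂ ≫ π₁) ≫ β ≫ B.snd := by
    rw [Preadditive.add_comp, Category.assoc, Category.assoc, Category.assoc, hb₀, ← hc,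
      Preadditive.comp_sub, add_sub_cancel]
  rw [Preadditive.comp_add, reassoc_of% e1, reassoc_of% e2, ← Preadditive.comp_add,
    ← Preadditive.comp_add, ← Preadditive.comp_add, hB, Category.comp_id, Category.assoc]

lemma exact_coneMap' [Epi s] (hd : (ShortComplex.mk d₀ d₁ zd).Exact) (hb₁ : s ≫ b₁ = b₀ ≫ d₀) :
    (ShortComplex.mk _ _ (coneMap_comp' (B := B) zd hb₁)).Exact := by
  rw [ShortComplex.exact_iff_exact_up_to_refinements] at hd ⊢
  dsimp only at hd ⊢
  intro A y hy
  obtain ⟨A', π, hπ, w, hw⟩ := hd y hy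
  exact ⟨A', π, hπ, -(w ≫ B.inr), by simp [hw, Preadditive.comp_sub]⟩

end Abelian

end

end WeilEtale

namespace WeilEtale

noncomputable section

section Abelian

variable {𝒞 𝒢 𝒜 : Type*} [Category 𝒞] [Abelian 𝒞] [Category 𝒢] [Preadditive 𝒢] [HasZeroObject 𝒢]
  [Category 𝒜] [Abelian 𝒜]

/-- The functor `Λ` preserves exactness at the third term of exact complexes starting with `P`. -/
def PreservesExactFrom (Λ : 𝒞 ⥤ 𝒜) [Λ.PreservesZeroMorphisms] (P : 𝒞) : Prop :=
  ∀ {K L M : 𝒞} {e₁ : P ⟶ K} {e₂ : K ⟶ L} {e₃ : L ⟶ M} {z₁ : e₁ ≫ e₂ = 0} {z₂ : e₂ ≫ e₃ = 0},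
    (ShortComplex.mk e₁ e₂ z₁).Exact → (ShortComplex.mk e₂ e₃ z₂).Exact →
      ((ShortComplex.mk e₂ e₃ z₂).map Λ).Exact

lemma PreservesExactFrom.exactAt {Λ : 𝒞 ⥤ 𝒜} [Λ.PreservesZeroMorphisms] {F : 𝒞}
    (I : InjectiveResolution F) (hI : ∀ n, PreservesExactFrom Λ (I.cocomplex.X n)) {i : ℕ}
    (hi : 2 ≤ i) : ((Λ.mapHomologicalComplex _).obj I.cocomplex).ExactAt i := by
  obtain ⟨n, rfl⟩ : ∃ n, i = n + 2 := ⟨i - 2, by omega⟩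
  rw [HomologicalComplex.exactAt_iff' _ (n + 1) (n + 2) (n + 3) (by simp) (by simp)]
  exact hI n (I.exact_succ n) (I.exact_succ (n + 1))

/-- If `0 ⟶ F ⟶ D ⟶ D ⟶ 0` is a resolution by an object that is acyclic for `Λ`, the derived functor
of `Λ` at `F` is represented by `Λ D ⟶ Λ D`. -/
lemma exists_quasiIso_double (Γ : 𝒞 ⥤ 𝒢) (υ : 𝒢 ⥤ 𝒜) [Γ.Additive] [υ.Additive]
    [(Γ ⋙ υ).PreservesMonomorphisms]
    (hΛ : ∀ S : ShortComplex 𝒞, S.Exact → Mono S.f → (S.map (Γ ⋙ υ)).Exact)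
    {F D : 𝒞} {η : F ⟶ D} {s : D ⟶ D} {zs : η ≫ s = 0} (hs : (ShortComplex.mk η s zs).Exact)
    [Mono η] [Epi s] (hD : PreservesExactFrom (Γ ⋙ υ) D) (I : InjectiveResolution F)
    (hI : ∀ n, PreservesExactFrom (Γ ⋙ υ) (I.cocomplex.X n)) :
    ∃ b : HomologicalComplex.double (Γ.map s) (show (ComplexShape.up ℕ).Rel 0 1 from rfl) ⟶
      (Γ.mapHomologicalComplex _).obj I.cocomplex,
      QuasiIso ((υ.mapHomologicalComplex _).map b) := by
  obtain ⟨ι, hι', hι, _⟩ : ∃ (ι : F ⟶ I.cocomplex.X 0) (z : ι ≫ I.cocomplex.d 0 1 = 0),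
      (ShortComplex.mk ι (I.cocomplex.d 0 1) z).Exact ∧ Mono ι :=
    ⟨I.ι.f 0, I.ι_f_zero_comp_complex_d, ShortComplex.exact_of_f_is_kernel _ I.isLimitKernelFork,
      inferInstanceAs (Mono (I.ι.f 0))⟩
  let b₀ : D ⟶ I.cocomplex.X 0 := Injective.factorThru ι η
  have hb₀ : η ≫ b₀ = ι := Injective.comp_factorThru ι η
  obtain ⟨b₁, hb₁⟩ : ∃ b₁ : D ⟶ I.cocomplex.X 1, s ≫ b₁ = b₀ ≫ I.cocomplex.d 0 1 := by
    have : Epi (ShortComplex.mk η s zs).g := inferInstanceAs (Epi s)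
    have h0 : η ≫ b₀ ≫ I.cocomplex.d 0 1 = 0 := by rw [reassoc_of% hb₀, hι']
    exact ⟨hs.desc _ h0, hs.g_desc _ h0⟩
  let B := BinaryBiproduct.bicone D (I.cocomplex.X 0)
  have hB : B.fst ≫ B.inl + B.snd ≫ B.inr = 𝟙 B.pt := biprod.total
  have h01 : (0 : ℕ) ≠ 1 := by decide
  let b := HomologicalComplex.mkHomFromDouble (f := Γ.map s) (K := (Γ.mapHomologicalComplex _).obj
    I.cocomplex) (show (ComplexShape.up ℕ).Rel 0 1 from rfl) h01 (Γ.map b₀) (Γ.map b₁)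
      ((Γ.map_comp _ _).symm.trans ((congrArg Γ.map hb₁.symm).trans (Γ.map_comp _ _)))
    (fun j _ => by
      have : b₁ ≫ I.cocomplex.d 1 j = 0 := by
        rw [← cancel_epi s, reassoc_of% hb₁, I.cocomplex.d_comp_d, comp_zero, comp_zero]
      exact (Γ.map_comp _ _).symm.trans ((congrArg Γ.map this).trans (Γ.map_zero _ _)))
  refine ⟨b, ?_⟩
  have hm := mono_coneMap (B := B) hs hb₀
  have h₁ := hΛ _ (exact_coneMap (B := B) hι hb₀ hb₁ zs hB) hm
  have h₂ := hD (exact_coneMap (B := B) hι hb₀ hb₁ zs hB) (exact_coneMap' (B := B) (I.exact_succ 0) hb₁)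
  let B' := (Γ ⋙ υ).mapBinaryBicone B
  have hm' : Mono ((Γ ⋙ υ).map (s ≫ B.inl + b₀ ≫ B.inr)) :=
    Functor.PreservesMonomorphisms.preserves (F := Γ ⋙ υ) _
  refine quasiIso_of_exact (B := B')
    (K := (υ.mapHomologicalComplex _).obj ((Γ.mapHomologicalComplex _).obj I.cocomplex))
    (t := (Γ ⋙ υ).map s) (g₀ := (Γ ⋙ υ).map b₀) (g₁ := (Γ ⋙ υ).map b₁)
    (l := (Γ ⋙ υ).map (s ≫ B.inl + b₀ ≫ B.inr))
    (m := (Γ ⋙ υ).map (B.fst ≫ b₁ - B.snd ≫ I.cocomplex.d 0 1))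
    ((υ.mapHomologicalComplex _).map b) (υ.mapIso (HomologicalComplex.doubleXIso₀ (Γ.map s) _))
    (υ.mapIso (HomologicalComplex.doubleXIso₁ (Γ.map s) _ h01)) ?_ ?_ ?_ ?_ ?_ ?_ ?_ hm' h₁ h₂
  · refine (congrArg υ.map (HomologicalComplex.double_d (Γ.map s) _ h01)).trans ?_
    rw [υ.map_comp, υ.map_comp]
    rfl
  · exact (congrArg υ.map (HomologicalComplex.mkHomFromDouble_f₀ _ h01 _ _ _ _)).trans
      (υ.map_comp _ _)
  · exact (congrArg υ.map (HomologicalComplex.mkHomFromDouble_f₁ _ h01 _ _ _ _)).trans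
      (υ.map_comp _ _)
  · exact fun i hi => υ.map_isZero (HomologicalComplex.isZero_double_X _ _ i (by omega) (by omega))
  · exact fun i hi => PreservesExactFrom.exactAt I hI hi
  · rw [(Γ ⋙ υ).map_add, (Γ ⋙ υ).map_comp, (Γ ⋙ υ).map_comp]
    rfl
  · rw [(Γ ⋙ υ).map_sub, (Γ ⋙ υ).map_comp, (Γ ⋙ υ).map_comp]
    rfl

end Abelian

end

end WeilEtale

namespace WeilEtale

noncomputable section

variable {F k : Type u} [Field F] [Fintype F] [Field k] [Algebra F k] [IsAlgClosure F k]
  {X : Over (Spec (.of F))} {E : SchemeSubcategory X}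

open EquivSheaf

/-- The complex `γ_* I` does not depend on the choice of the right adjoint `γ_*`. -/
def pushforwardComplexIso {γ γ' : WeilSheaf k E ⥤ GaloisSheaf k E} (adj : gammaPullback k E ⊣ γ)
    (adj' : gammaPullback k E ⊣ γ') (I : CochainComplex (WeilSheaf k E) ℕ) :
    pushforwardComplex adj I ≅ pushforwardComplex adj' I :=
  have : γ.Additive := adj.right_adjoint_additive
  have : γ'.Additive := adj'.right_adjoint_additive
  (NatIso.mapHomologicalComplex (adj.rightAdjointUniq adj') _).app I

lemma preservesExactFrom_of_injective (𝓘 : WeilSheaf k E) [Injective 𝓘] :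
    PreservesExactFrom (smoothSections k E) 𝓘 :=
  fun h₁ h₂ => exact_map_smoothSections h₁ h₂ (epi_map_shiftSub_of_injective 𝓘)

lemma preservesExactFrom_induced (𝓕 : WeilSheaf k E) :
    PreservesExactFrom (smoothSections k E) ((inducedFunctor k E).obj 𝓕) :=
  fun h₁ h₂ => exact_map_smoothSections h₁ h₂ (epi_map_shiftSub_coind 𝓕.sheaf)

lemma cohomologyVanishes {𝓕 : WeilSheaf k E} {γ : WeilSheaf k E ⥤ GaloisSheaf k E}
    (adj : gammaPullback k E ⊣ γ) (I : InjectiveResolution 𝓕) {i : ℕ} (hi : 1 < i) :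
    CohomologyVanishes (pushforwardComplex adj I.cocomplex) i := by
  have h : CohomologyVanishes (pushforwardComplex (gammaAdjunction k E) I.cocomplex) i :=
    PreservesExactFrom.exactAt (Λ := smoothSections k E) I
      (fun n => preservesExactFrom_of_injective _) hi
  exact h.of_iso (((underlying k E).mapHomologicalComplex _).mapIso
    (pushforwardComplexIso (gammaAdjunction k E) adj I.cocomplex))

lemma quasiIsomorphic_double {𝓕 : WeilSheaf k E} {γ : WeilSheaf k E ⥤ GaloisSheaf k E}
    (adj : gammaPullback k E ⊣ γ) (I : InjectiveResolution 𝓕) :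
    QuasiIsomorphic (pushforwardComplex adj I.cocomplex) (HomologicalComplex.double
      ((smoothFunctor k E).map (shift 𝓕) - 𝟙 ((smoothFunctor k E).obj (induced 𝓕)))
      (show (ComplexShape.up ℕ).Rel 0 1 from rfl)) := by
  obtain ⟨b, hb⟩ := exists_quasiIso_double (smoothFunctor k E) (underlying k E)
    (fun S hS _ => exact_smoothSections hS) (exact_toInduced 𝓕) (preservesExactFrom_induced 𝓕) I
    (fun n => preservesExactFrom_of_injective _)
  have e : (smoothFunctor k E).map (shiftSub 𝓕) = (smoothFunctor k E).map (shift 𝓕) -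
      𝟙 ((smoothFunctor k E).obj (induced 𝓕)) :=
    ((smoothFunctor k E).map_sub).trans (congrArg _ ((smoothFunctor k E).map_id _))
  rw [← e]
  let a := pushforwardComplexIso adj (gammaAdjunction k E) I.cocomplex
  refine ⟨_, a.hom, b, ?_, hb⟩
  have : IsIso (((underlying k E).mapHomologicalComplex _).map a.hom) := inferInstance
  exact inferInstanceAs (QuasiIso (((underlying k E).mapHomologicalComplex _).map a.hom))

end

end WeilEtale

theorem mainTheorem4 {F k : Type u} [Field F] [Fintype F] [Field k] [Algebra F k]
    [IsAlgClosure F k] {X : Over (Spec (.of F))} (E : WeilEtale.SchemeSubcategory X) :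
    -- `γ^*` has a right adjoint `γ_*`, and injective resolutions exist in `𝓣_G`
    (WeilEtale.gammaPullback k E).IsLeftAdjoint ∧
    HasInjectiveResolutions (WeilEtale.WeilSheaf k E) ∧
    ∀ 𝓕 : WeilEtale.WeilSheaf k E,
      -- `Rγ_* 𝓕` is quasi-isomorphic to `Ξ(𝓕) --(t - 1)--> Ξ(𝓕)`
      (∃ (Ξ : WeilEtale.GaloisSheaf k E) (t : Ξ ⟶ Ξ) (_ : WeilEtale.XiStructure 𝓕 Ξ t),
        ∀ (γ : WeilEtale.WeilSheaf k E ⥤ WeilEtale.GaloisSheaf k E)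
          (adj : WeilEtale.gammaPullback k E ⊣ γ) (I : InjectiveResolution 𝓕),
          WeilEtale.QuasiIsomorphic (WeilEtale.pushforwardComplex adj I.cocomplex)
            (HomologicalComplex.double (t - 𝟙 Ξ)
              (show (ComplexShape.up ℕ).Rel 0 1 from rfl))) ∧
      -- `R^i γ_* 𝓕 = 0` for `i > 1`
      (∀ (γ : WeilEtale.WeilSheaf k E ⥤ WeilEtale.GaloisSheaf k E)
        (adj : WeilEtale.gammaPullback k E ⊣ γ) (I : InjectiveResolution 𝓕) (i : ℕ), 1 < i →
        WeilEtale.CohomologyVanishes (WeilEtale.pushforwardComplex adj I.cocomplex) i) :=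
  ⟨(WeilEtale.gammaAdjunction k E).isLeftAdjoint, inferInstance, fun 𝓕 =>
    ⟨⟨_, _, WeilEtale.xiStructure 𝓕, fun _ adj I => WeilEtale.quasiIsomorphic_double adj I⟩,
      fun _ adj I _ hi => WeilEtale.cohomologyVanishes adj I hi⟩⟩
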